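/- Let $m\ge 1$ and let $M$ be a smooth (Hausdorff, $\sigma$-compact) manifold of dimension $2m+1$ with a co-oriented contact distribution $H\subset TM$. Put $\mathcal E(w)=\big((\Lambda^{2m+1}TM)^{\otimes 2}\big)^{w/(4m+4)}$ (oriented roots), so that $\mathcal E(w)$ consists of densities $s$ with $s(c\,\mathrm{vol})=|c|^{w/(2m+2)}s(\mathrm{vol})$ on nonzero top forms. A positive contact form $\theta$ corresponds to the positive scale $\tau\in\Gamma(\mathcal E_+(2))$ with $\tau(\epsilon^\theta)=1$, $\epsilon^\theta=\theta\wedge(d\theta)^{m}$, and $k=\tau\theta\in\Gamma(T^*M(2))$ is the conformal contact form of $H$; it does not depend on $\theta$. Let $\mathbf q$ be a contact projective structure: the class of all torsion-free affine connections for which $H$ is totally geodesic and which have the same unparametrised $H$-geodesics as one of them. With $\omega=d\theta$, $\omega^{ab}$ the bivector with $\omega^{ab}\omega_{bc}=-\delta^a{}_c+t^a\theta_c$ ($t$ the Reeb field), $\nabla\in\mathbf q$, $\nu_{abc}=\nabla_c\omega_{ab}$, $\lambda_b=\omega^{ca}\nu_{abc}$, the torsion of $(M,H,\mathbf q)$ is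 the restriction to $H$ of $T_{ab}{}^c=-2\omega^{ce}\nu^\circ_{abe}$, $\nu^\circ_{abc}=\nu_{abc}+\frac1{2m+1}(\lambda_b\omega_{ac}-\lambda_a\omega_{bc}+2\lambda_c\omega_{ab})$; it is independent of $\theta$ and $\nabla$. With $\mathcal L_{ab}=\tau\omega_{ab}$, $\mathcal L^{ab}=\tau^{-1}\omega^{ab}$, $T^{abc}=\mathcal L^{ad}\mathcal L^{be}T_{de}{}^c$, $U^{ab}=\nabla_cT^{c(ab)}$, $V^{ab}=\nabla_cT^{abc}$, $W^a=\nabla_b\nabla_cT^{bac}+(2m+1)\mathsf P_{bc}T^{bac}$ ($\mathsf P$ the projective Schouten tensor) put $$E_{abc}=T^{efg}\mathcal L_{ea}\mathcal L_{fb}\mathcal L_{gc}-\tfrac{2}{2m+1}V^{ef}\mathcal L_{ea}\mathcal L_{fb}k_c+\tfrac{2}{2m+1}V^{ef}\mathcal L_{fc}\mathcal L_{e[b}k_{a]}-\tfrac{4}{2m-1}U^{ef}\mathcal L_{fc}\mathcal L_{e[b}k_{a]}+\tfrac{8}{(2m-1)(2m+1)}W^{e}\mathcal L_{e[b}k_{a]}k_c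 .$$ A distinguished projective structure of $(M,H,\mathbf q)$ is a projective structure $\mathbf p$ such that for every positive scale $\tau$ there is a connection $\nabla\in\mathbf q$ with $\nabla_a\tau=0$, $\nabla_{(a}k_{b)}=0$ and $W_{ab}{}^d{}_ck_d=-\frac14E_{abc}$ ($W_{ab}{}^c{}_d$ the projective Weyl curvature, $E$ formed from $\tau$ and $\nabla$) whose projective class is $\mathbf p$. Finally let $\mathcal T^*=J^1\mathcal E(1)$ be the cotractor bundle of $(M,\mathbf p)$ with its normal tractor connection. In the splitting $\Lambda^2\mathcal T^*\cong T^*M(2)\oplus\Lambda^2T^*M(2)$ given by $\nabla\in\mathbf p$ the tractor connection is $\nabla_a(\kappa_b,\mu_{bc})=(\nabla_a\kappa_b-\mu_{ab},\ \nabla_a\mu_{bc}+2\mathsf P_{a[b}\kappa_{c]})$, and $\kappa$ is the projecting part. A normal solution of the Killing-type equation is a $\kappa\in\Gamma(T^*M(2))$ with $\nabla_{(a}\kappa_{b)}=0$ for $\nabla\in\mathbf p$ that is the projecting part of a parallel section of $\Lambda^2\mathcal T^*$. **Theorem.** If the torsion of $(M,H,\mathbf q)$ vanishes, then $(M,H,\mathbf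 q)$ has a distinguished projective structure, and for every distinguished projective structure $\mathbf p$ the conformal contact form $k$ is a normal solution of the projective Killing-type equation of $(M,\mathbf p)$; moreover $k$ is the projecting part of a parallel section of $\Lambda^2\mathcal T^*$ that is nondegenerate at every point, i.e. of a parallel tractor symplectic form. -/

import Mathlib

open scoped Manifold ContDiff Topology

noncomputable section

namespace ContactProjective

/-! ### Tangent vectors, covectors, top forms on a manifold of dimension `2m+1` -/

/-- The model space `ℝ^(2m+1)`. -/
abbrev Model (m : ℕ) : Type := EuclideanSpace ℝ (Fin (2 * m + 1))

section

variable {m : ℕ} {M : Type*} [TopologicalSpace M] [ChartedSpace (Model m) M]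

/-- The tangent space `T_x M`. -/
abbrev Tan (m : ℕ) {M : Type*} [TopologicalSpace M] [ChartedSpace (Model m) M] (x : M) : Type :=
  TangentSpace (𝓡 (2 * m + 1)) x

/-- The cotangent space `T*_x M`. -/
abbrev Cotan (m : ℕ) {M : Type*} [TopologicalSpace M] [ChartedSpace (Model m) M] (x : M) : Type :=
  Tan m x →L[ℝ] ℝ

/-- The top exterior power `Λ^(2m+1) T*_x M`. -/
abbrev TopForm (m : ℕ) {M : Type*} [TopologicalSpace M] [ChartedSpace (Model m) M] (x : M) :
    Type :=
  (Tan m x) [⋀^Fin (2 * m + 1)]→ₗ[ℝ] ℝ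

/-- A basis of `T_x M` (tangent spaces are copies of the model space, and this is its standard
basis).  It is only used to write out traces and determinants. -/
def frame (x : M) (i : Fin (2 * m + 1)) : Tan m x :=
  (EuclideanSpace.single i (1 : ℝ) : Model m)

/-- The basis of `T*_x M` dual to `frame`. -/
def coframe (x : M) (i : Fin (2 * m + 1)) : Cotan m x :=
  (EuclideanSpace.proj i : Model m →L[ℝ] ℝ)

/-- The differential of a function at `x`, applied to a tangent vector. -/
def dfun (f : M → ℝ) (x : M) (u : Tan m x) : ℝ :=
  mfderiv (𝓡 (2 * m + 1)) 𝓘(ℝ, ℝ) f x u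

variable [IsManifold (𝓡 (2 * m + 1)) ∞ M]

/-- The identification `T_y M → T_x M` given by the coordinate frame of the preferred chart at
`x`, for `y` in the domain of that chart. -/
def transport (x y : M) : Tan m y →L[ℝ] Tan m x :=
  ((trivializationAt (Model m) (TangentSpace (𝓡 (2 * m + 1)) : M → Type _) x).symmL ℝ x).comp
    ((trivializationAt (Model m) (TangentSpace (𝓡 (2 * m + 1)) : M → Type _) x).continuousLinearMapAt
      ℝ y)

/-- Extension of a tangent vector at `x` to a vector field with constant components in the chart
at `x` (a smooth vector field near `x`). -/
def extVec {x : M} (v : Tan m x) (y : M) : Tan m y :=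
  (trivializationAt (Model m) (TangentSpace (𝓡 (2 * m + 1)) : M → Type _) x).symmL ℝ y
    ((trivializationAt (Model m) (TangentSpace (𝓡 (2 * m + 1)) : M → Type _) x).continuousLinearMapAt
      ℝ x v)

/-- Extension of a covector at `x` with constant components in the chart at `x`. -/
def extCov {x : M} (α : Cotan m x) (y : M) : Cotan m y :=
  α.comp (transport x y)

/-- Extension of a top form at `x` with constant components in the chart at `x`. -/
def extTop {x : M} (vol : TopForm m x) (y : M) : TopForm m y :=
  vol.compLinearMap (transport x y).toLinearMap

/-! ### Affine connections -/

/-- Connections on the tangent bundle. -/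
abbrev Conn (m : ℕ) (M : Type*) [TopologicalSpace M] [ChartedSpace (Model m) M]
    [IsManifold (𝓡 (2 * m + 1)) ∞ M] : Type _ :=
  CovariantDerivative (𝓡 (2 * m + 1)) (Model m) (TangentSpace (𝓡 (2 * m + 1)) : M → Type _)

/-- Smooth torsion-free affine connections. -/
def IsAffine (D : Conn m M) : Prop :=
  CovariantDerivative.ContMDiffCovariantDerivative D ∞ ∧ D.torsion = 0

theorem extVec_add {x : M} (v w : Tan m x) : extVec (v + w) = extVec v + extVec w := by
  funext y
  simp only [Pi.add_apply, extVec, map_add]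

theorem extVec_smul {x : M} (c : ℝ) (v : Tan m x) : extVec (c • v) = c • extVec v := by
  funext y
  simp only [Pi.smul_apply, extVec, map_smul]

theorem contMDiffAt_extVec {x : M} (v : Tan m x) :
    ContMDiffAt (𝓡 (2 * m + 1)) ((𝓡 (2 * m + 1)).prod 𝓘(ℝ, Model m)) ∞
      (fun y => (⟨y, extVec v y⟩ : TangentBundle (𝓡 (2 * m + 1)) M)) x := by
  have hx := FiberBundle.mem_baseSet_trivializationAt' (F := Model m)
    (E := (TangentSpace (𝓡 (2 * m + 1)) : M → Type _)) x
  refine (FiberBundle.contMDiffAt_extend (𝓡 (2 * m + 1)) (Model m) v).congr_of_eventuallyEq ?_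
  filter_upwards [(trivializationAt (Model m)
    (TangentSpace (𝓡 (2 * m + 1)) : M → Type _) x).open_baseSet.mem_nhds hx] with y hy
  have h1 := Bundle.Trivialization.symmₗ_apply (R := ℝ) (hb := hy)
    (y := ((trivializationAt (Model m)
      (TangentSpace (𝓡 (2 * m + 1)) : M → Type _) x) ⟨x, v⟩).2)
  have h2 := congrFun (Bundle.Trivialization.coe_linearMapAt_of_mem (R := ℝ) _ hx) v
  have h3 : extVec v y = FiberBundle.extend (Model m) v y := by
    refine Eq.trans ?_ h1
    rw [← h2]
    rfl
  rw [h3]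

theorem mdifferentiableAt_extVec {x : M} (v : Tan m x) :
    MDifferentiableAt (𝓡 (2 * m + 1)) ((𝓡 (2 * m + 1)).prod 𝓘(ℝ, Model m))
      (fun y => (⟨y, extVec v y⟩ : TangentBundle (𝓡 (2 * m + 1)) M)) x :=
  (contMDiffAt_extVec v).mdifferentiableAt (by simp)

/-- `extVec v` does extend `v`. -/
theorem extVec_self {x : M} (v : Tan m x) : extVec v x = v :=
  Bundle.Trivialization.symmL_continuousLinearMapAt _
    (FiberBundle.mem_baseSet_trivializationAt' x) v

/-- The Christoffel symbols `v ↦ ∇_u v` in the coordinate frame of the chart at `x`. -/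
def christoffel (D : Conn m M) (x : M) (u : Tan m x) : Tan m x →L[ℝ] Tan m x :=
  have : FiniteDimensional ℝ (Tan m x) := inferInstanceAs (FiniteDimensional ℝ (Model m))
  have : T2Space (Tan m x) := inferInstanceAs (T2Space (Model m))
  LinearMap.toContinuousLinearMap
    { toFun := fun v => D (extVec v) x u
      map_add' := fun v w => by
        rw [extVec_add, D.isCovariantDerivativeOnUniv.add
          (mdifferentiableAt_extVec v) (mdifferentiableAt_extVec w)]
        rfl
      map_smul' := fun c v => by
        rw [extVec_smul, D.isCovariantDerivativeOnUniv.smul_const c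
          (mdifferentiableAt_extVec v)]
        rfl }

/-- The trace of the Christoffel symbols. -/
def christoffelTrace (D : Conn m M) (x : M) (u : Tan m x) : ℝ :=
  ∑ i, coframe x i (christoffel D x u (frame x i))

/-- The curvature `R(u,v)w`, with the convention
`R(U,V)W = ∇_U ∇_V W - ∇_V ∇_U W - ∇_[U,V] W`. -/
def curvature (D : Conn m M) (x : M) (u v w : Tan m x) : Tan m x :=
  D (fun y => D (extVec w) y (extVec v y)) x u
    - D (fun y => D (extVec w) y (extVec u y)) x v
    - D (extVec w) x (VectorField.mlieBracket (𝓡 (2 * m + 1)) (extVec u) (extVec v) x)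

/-- The Ricci tensor `Ric_bd = R_cb^c_d`. -/
def ricci (D : Conn m M) (x : M) (b d : Tan m x) : ℝ :=
  ∑ i, coframe x i (curvature D x (frame x i) b d)

/-- The projective Schouten tensor `P_ab = ((n+1) Ric_ab + Ric_ba) / (n (n+2))`, `n = 2m`. -/
def schouten (D : Conn m M) (x : M) (a b : Tan m x) : ℝ :=
  1 / ((2 * m : ℝ) * (2 * m + 2)) * ((2 * m + 1) * ricci D x a b + ricci D x b a)

/-- The projective Weyl curvature `W_ab^c_d`, written `W(a,b)d`, defined by
`R_ab^c_d = W_ab^c_d + δ^c_a P_bd - δ^c_b P_ad + β_ab δ^c_d`, `β_ab = P_ba - P_ab`. -/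
def weyl (D : Conn m M) (x : M) (a b d : Tan m x) : Tan m x :=
  curvature D x a b d - schouten D x b d • a + schouten D x a d • b
    - (schouten D x b a - schouten D x a b) • d

/-! ### Weighted tensor fields

`𝓔(w)` is the oriented root `𝓚^(w/(2m+2))` of `𝓚 = (Λ^(2m+1) TM)^2`.  An element of
`𝓔(w)_x ⊗ V` is a `V`-valued function `S` of nonzero top forms `vol` at `x` such that
`S (c vol) = |c|^(w/(2m+2)) S vol` for `c ≠ 0`. The value at the zero form is irrelevant. -/

/-- Carrier for weighted tensor fields with `r` upper and `s` lower indices. -/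
abbrev WField (m : ℕ) (M : Type*) [TopologicalSpace M] [ChartedSpace (Model m) M]
    (r s : ℕ) : Type _ :=
  (x : M) → TopForm m x → (Fin r → Cotan m x) → (Fin s → Tan m x) → ℝ

/-- `S` is a smooth tensor field with `r` upper and `s` lower indices, of weight `w`. -/
structure IsWeightedTensor {r s : ℕ} (w : ℝ) (S : WField m M r s) : Prop where
  homogeneous : ∀ (x : M) (vol : TopForm m x) (c : ℝ), vol ≠ 0 → c ≠ 0 → ∀ α v,
    S x (c • vol) α v = |c| ^ (w / (2 * m + 2)) * S x vol α v
  multilinear : ∀ (x : M) (vol : TopForm m x), vol ≠ 0 →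
    ∃ f : MultilinearMap ℝ (fun _ : Fin r => Cotan m x)
        (MultilinearMap ℝ (fun _ : Fin s => Tan m x) ℝ),
      ∀ α v, S x vol α v = f α v
  smooth : ∀ (x : M) (vol : TopForm m x), vol ≠ 0 →
    ∀ (α : Fin r → Cotan m x) (v : Fin s → Tan m x), ContMDiffAt (𝓡 (2 * m + 1)) 𝓘(ℝ, ℝ) ∞
      (fun y => S y (extTop vol y) (fun i => extCov (α i) y) (fun j => extVec (v j) y)) x

/-- The covariant derivative of a tensor field of weight `w`; the direction of differentiation is
the first lower argument of the result.  This is the coordinate formula at `x`, in the chart at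
`x`; upper and lower indices contribute the usual Christoffel terms and the weight contributes
`w/(2m+2) Γ^c_{ac}`. -/
def nabla {r s : ℕ} (D : Conn m M) (w : ℝ) (S : WField m M r s) : WField m M r (s + 1) :=
  fun x vol α uv =>
    let u := uv 0
    let v : Fin s → Tan m x := fun j => uv j.succ
    dfun (fun y => S y (extTop vol y) (fun i => extCov (α i) y) (fun j => extVec (v j) y)) x u
      + ∑ i, S x vol (Function.update α i ((α i).comp (christoffel D x u))) v
      - ∑ j, S x vol α (Function.update v j (christoffel D x u (v j)))
      + w / (2 * m + 2) * christoffelTrace D x u * S x vol α v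

/-! ### Co-oriented contact structures -/

/-- The exterior derivative of a 1-form. -/
def extDer (θ : (x : M) → Cotan m x) (x : M) (u v : Tan m x) : ℝ :=
  dfun (fun y => θ y (extVec v y)) x u - dfun (fun y => θ y (extVec u y)) x v
    - θ x (VectorField.mlieBracket (𝓡 (2 * m + 1)) (extVec u) (extVec v) x)

/-- `θ` is a smooth contact form with kernel `H`. -/
structure IsContactForm (H : (x : M) → Submodule ℝ (Tan m x)) (θ : (x : M) → Cotan m x) :
    Prop where
  smooth : ∀ (x : M) (v : Tan m x),
    ContMDiffAt (𝓡 (2 * m + 1)) 𝓘(ℝ, ℝ) ∞ (fun y => θ y (extVec v y)) x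
  ne_zero : ∀ x, θ x ≠ 0
  ker : ∀ x u, u ∈ H x ↔ θ x u = 0
  nondegenerate : ∀ x, ∀ u ∈ H x, (∀ v ∈ H x, extDer θ x u v = 0) → u = 0

/-- A co-oriented contact manifold: a contact distribution `H` with an orientation of `TM/H`, the
latter given as the class of positive contact forms. -/
structure ContactStructure (m : ℕ) (M : Type*) [TopologicalSpace M] [ChartedSpace (Model m) M]
    [IsManifold (𝓡 (2 * m + 1)) ∞ M] where
  H : (x : M) → Submodule ℝ (Tan m x)
  positive : Set ((x : M) → Cotan m x)
  nonempty : positive.Nonempty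
  contact : ∀ θ ∈ positive, IsContactForm H θ
  mem_iff : ∀ θ ∈ positive, ∀ θ', θ' ∈ positive ↔
    ∃ f : M → ℝ, ContMDiff (𝓡 (2 * m + 1)) 𝓘(ℝ, ℝ) ∞ f ∧ (∀ x, 0 < f x) ∧
      θ' = fun x => f x • θ x

/-- The matrix of `dθ + θ ⊗ θ` in the frame at `x`. -/
def gram (θ : (x : M) → Cotan m x) (x : M) : Matrix (Fin (2 * m + 1)) (Fin (2 * m + 1)) ℝ :=
  Matrix.of fun i j =>
    extDer θ x (frame x i) (frame x j) + θ x (frame x i) * θ x (frame x j)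

/-- The square `(ε^θ(e_0, …, e_2m))²` of the contact volume form `ε^θ = θ ∧ dθ ∧ ⋯ ∧ dθ` on the
frame `e` at `x`. By the Pfaffian identity (take a frame adapted to the splitting of `T_x M` into
the Reeb direction and `ker θ`) it is `(m!)²` times the determinant of the matrix of
`dθ + θ ⊗ θ`. -/
def contactVolumeSq (θ : (x : M) → Cotan m x) (x : M) : ℝ :=
  ((m.factorial : ℝ)) ^ 2 * (gram θ x).det

/-- The positive scale `τ ∈ 𝓔_+(2)` corresponding to a contact form `θ`, normalised by
`τ (ε^θ) = 1`, that is `τ (c ε^θ) = |c|^(1/(m+1))`. -/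
def scale (θ : (x : M) → Cotan m x) : WField m M 0 0 := fun x vol _ _ =>
  ((vol (frame x)) ^ 2 / contactVolumeSq θ x) ^ (1 / (2 * m + 2) : ℝ)

/-- The weighted 1-form `τ θ`, where `τ` is the scale of `θ`. -/
def weightedForm (θ : (x : M) → Cotan m x) : WField m M 0 1 := fun x vol α v =>
  scale θ x vol α ![] * θ x (v 0)

/-- The conformal contact form `k ∈ Γ(T*M(2))`, i.e. `k = τ θ` for any positive contact form `θ`
with its scale `τ` (`τ θ` does not depend on the choice of `θ`). -/
def ContactStructure.k (C : ContactStructure m M) : WField m M 0 1 :=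
  weightedForm C.nonempty.some

/-- The Reeb vector field: `θ(t) = 1`, `dθ(t, ·) = 0`.  Equivalently `t` is the vector with
`(dθ + θ ⊗ θ)(·, t) = θ`. -/
def reeb (θ : (x : M) → Cotan m x) (x : M) : Tan m x :=
  ∑ i, (∑ j, (gram θ x)⁻¹ i j * θ x (frame x j)) • frame x i

/-- The bivector `ω^{ab}` (as a function of two covectors), the unique skew one with
`ω^{ab} ω_{bc} = -δ^a_c + t^a θ_c`, where `ω = dθ`.  Explicitly `ω^{ab} = t^a t^b - g^{ab}`, with
`g^{ab}` the inverse matrix of `ω_{ab} + θ_a θ_b`. -/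
def omegaUp (θ : (x : M) → Cotan m x) (x : M) (α β : Cotan m x) : ℝ :=
  α (reeb θ x) * β (reeb θ x)
    - ∑ i, ∑ j, (gram θ x)⁻¹ i j * α (frame x i) * β (frame x j)

/-! ### Contact projective structures -/

/-- The velocity of a curve. -/
def velocity (γ : ℝ → M) (t : ℝ) : Tan m (γ t) :=
  mfderiv 𝓘(ℝ, ℝ) (𝓡 (2 * m + 1)) γ t (1 : ℝ)

/-- `γ` restricted to the open interval `J` is a smooth regular curve which is, up to
parametrisation, a geodesic of `D`: `∇_{γ'} γ'` is everywhere proportional to `γ'`. Here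
`∇_{γ'} γ'` is computed from any vector field extending `γ'` locally along `γ`. -/
def IsGeodesicOn (D : Conn m M) (J : Set ℝ) (γ : ℝ → M) : Prop :=
  IsOpen J ∧ J.OrdConnected ∧ ContMDiffOn 𝓘(ℝ, ℝ) (𝓡 (2 * m + 1)) ∞ γ J ∧
    ∀ t ∈ J, velocity (m := m) γ t ≠ 0 ∧
      ∃ X : (x : M) → Tan m x,
        ContMDiff (𝓡 (2 * m + 1)) ((𝓡 (2 * m + 1)).prod 𝓘(ℝ, Model m)) ∞
          (fun x => (⟨x, X x⟩ : TangentBundle (𝓡 (2 * m + 1)) M)) ∧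
        (∀ᶠ s in 𝓝 t, X (γ s) = velocity γ s) ∧
        ∃ c : ℝ, D X (γ t) (velocity γ t) = c • velocity (m := m) γ t

/-- `H` is totally geodesic for `D`: a geodesic is tangent to `H` at all times or at no time. -/
def IsCompatible (C : ContactStructure m M) (D : Conn m M) : Prop :=
  ∀ J γ, IsGeodesicOn D J γ →
    (∀ t ∈ J, velocity γ t ∈ C.H (γ t)) ∨ (∀ t ∈ J, velocity γ t ∉ C.H (γ t))

/-- The `H`-geodesics of `D`, as unparametrised curves. -/
def IsHGeodesicOn (C : ContactStructure m M) (D : Conn m M) (J : Set ℝ) (γ : ℝ → M) : Prop :=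
  IsGeodesicOn D J γ ∧ ∀ t ∈ J, velocity γ t ∈ C.H (γ t)

/-- `q` is a contact projective structure on the contact manifold: the class of all `H`-compatible
torsion-free affine connections that have the same unparametrised `H`-geodesics as one of them. -/
def IsContactProjectiveStructure (C : ContactStructure m M) (q : Set (Conn m M)) : Prop :=
  ∃ D₀ : Conn m M, IsAffine D₀ ∧ IsCompatible C D₀ ∧
    q = {D | IsAffine D ∧ IsCompatible C D ∧
      ∀ J γ, IsHGeodesicOn C D J γ ↔ IsHGeodesicOn C D₀ J γ}

/-! ### The torsion of a contact projective structure -/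

/-- `ν_abc = ∇_c ω_ab`, `ω = dθ`. -/
def nu (D : Conn m M) (θ : (x : M) → Cotan m x) (x : M) (a b c : Tan m x) : ℝ :=
  nabla D 0 (fun y _ _ (v : Fin 2 → Tan m y) => extDer θ y (v 0) (v 1)) x 0 ![] ![c, a, b]

/-- `λ_b = ω^{ca} ν_abc`. -/
def lam (D : Conn m M) (θ : (x : M) → Cotan m x) (x : M) (b : Tan m x) : ℝ :=
  ∑ i, ∑ j, omegaUp θ x (coframe x i) (coframe x j) * nu D θ x (frame x j) b (frame x i)

/-- The trace-free part of `ν` (relevant on `H` only). -/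
def nuFree (D : Conn m M) (θ : (x : M) → Cotan m x) (x : M) (a b c : Tan m x) : ℝ :=
  nu D θ x a b c + 1 / (2 * m + 1 : ℝ) *
    ((lam D θ x b * extDer θ x a c - lam D θ x a * extDer θ x b c)
      + 2 * lam D θ x c * extDer θ x a b)

/-- The torsion `T_ab^c = -2 ω^{ce} ν°_abe`, contracted with `γ_c`. It is a tensor on `H`, that is,
`a` and `b` are meant to be in `H`. -/
def torsionT (D : Conn m M) (θ : (x : M) → Cotan m x) (x : M) (γ : Cotan m x)
    (a b : Tan m x) : ℝ :=
  -2 * ∑ i, omegaUp θ x γ (coframe x i) * nuFree D θ x a b (frame x i)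

/-- The torsion of the contact projective structure vanishes. (The torsion does not depend on the
connection in `q` nor on the positive contact form from which it is computed.) -/
def IsTorsionFree (C : ContactStructure m M) (q : Set (Conn m M)) : Prop :=
  ∀ D ∈ q, ∀ θ ∈ C.positive, ∀ x, ∀ γ, ∀ a ∈ C.H x, ∀ b ∈ C.H x, torsionT D θ x γ a b = 0

/-! ### The distinguished projective structure -/

/-- `𝓛_ab = τ ω_ab`, of weight `2`. -/
def levi (θ : (x : M) → Cotan m x) (x : M) (vol : TopForm m x) (a b : Tan m x) : ℝ :=
  scale θ x vol ![] ![] * extDer θ x a b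

/-- `𝓛^{ab} = τ⁻¹ ω^{ab}`, of weight `-2`. -/
def leviUp (θ : (x : M) → Cotan m x) (x : M) (vol : TopForm m x) (α β : Cotan m x) : ℝ :=
  (scale θ x vol ![] ![])⁻¹ * omegaUp θ x α β

/-- `T^{abc} = 𝓛^{ad} 𝓛^{be} T_de^c`, of weight `-4`. -/
def torsionUp (D : Conn m M) (θ : (x : M) → Cotan m x) : WField m M 3 0 := fun x vol α _ =>
  ∑ i, ∑ j, leviUp θ x vol (α 0) (coframe x i) * leviUp θ x vol (α 1) (coframe x j)
    * torsionT D θ x (α 2) (frame x i) (frame x j)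

/-- `U^{ab} = ∇_c T^{c(ab)}`. -/
def tensorU (D : Conn m M) (θ : (x : M) → Cotan m x) : WField m M 2 0 := fun x vol α _ =>
  1 / 2 * ∑ i, (nabla D (-4) (torsionUp D θ) x vol ![coframe x i, α 0, α 1] ![frame x i]
    + nabla D (-4) (torsionUp D θ) x vol ![coframe x i, α 1, α 0] ![frame x i])

/-- `V^{ab} = ∇_c T^{abc}`. -/
def tensorV (D : Conn m M) (θ : (x : M) → Cotan m x) : WField m M 2 0 := fun x vol α _ =>
  ∑ i, nabla D (-4) (torsionUp D θ) x vol ![α 0, α 1, coframe x i] ![frame x i]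

/-- `W^a = ∇_b ∇_c T^{bac} + (2m+1) P_bc T^{bac}`. -/
def tensorW (D : Conn m M) (θ : (x : M) → Cotan m x) : WField m M 1 0 := fun x vol α _ =>
  ∑ i, nabla D (-4) (tensorV D θ) x vol ![coframe x i, α 0] ![frame x i]
    + (2 * m + 1) * ∑ i, ∑ j, schouten D x (frame x i) (frame x j)
      * torsionUp D θ x vol ![coframe x i, α 0, coframe x j] ![]

/-- `𝓛_{e[b} k_{a]}`. -/
def leviSkew (θ : (x : M) → Cotan m x) (x : M) (vol : TopForm m x) (e a b : Tan m x) : ℝ :=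
  1 / 2 * (levi θ x vol e b * weightedForm θ x vol ![] ![a]
    - levi θ x vol e a * weightedForm θ x vol ![] ![b])

/-- The extension `E_abc`, of weight `2`, of the torsion, formed from a contact form `θ` (with
scale `τ`) and a connection:
`E_abc = T^{efg} 𝓛_ea 𝓛_fb 𝓛_gc - 2/(2m+1) V^{ef} 𝓛_ea 𝓛_fb k_c + 2/(2m+1) V^{ef} 𝓛_fc 𝓛_{e[b} k_{a]}
  - 4/(2m-1) U^{ef} 𝓛_fc 𝓛_{e[b} k_{a]} + 8/((2m-1)(2m+1)) W^e 𝓛_{e[b} k_{a]} k_c`. -/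
def tensorE (D : Conn m M) (θ : (x : M) → Cotan m x) (x : M) (vol : TopForm m x)
    (a b c : Tan m x) : ℝ :=
  (∑ e, ∑ f, ∑ g, torsionUp D θ x vol ![coframe x e, coframe x f, coframe x g] ![]
      * levi θ x vol (frame x e) a * levi θ x vol (frame x f) b * levi θ x vol (frame x g) c)
    - 2 / (2 * m + 1 : ℝ) * (∑ e, ∑ f, tensorV D θ x vol ![coframe x e, coframe x f] ![]
      * levi θ x vol (frame x e) a * levi θ x vol (frame x f) b) * weightedForm θ x vol ![] ![c]
    + 2 / (2 * m + 1 : ℝ) * (∑ e, ∑ f, tensorV D θ x vol ![coframe x e, coframe x f] ![]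
      * levi θ x vol (frame x f) c * leviSkew θ x vol (frame x e) a b)
    - 4 / (2 * m - 1 : ℝ) * (∑ e, ∑ f, tensorU D θ x vol ![coframe x e, coframe x f] ![]
      * levi θ x vol (frame x f) c * leviSkew θ x vol (frame x e) a b)
    + 8 / ((2 * m - 1) * (2 * m + 1) : ℝ) * (∑ e, tensorW D θ x vol ![coframe x e] ![]
      * leviSkew θ x vol (frame x e) a b) * weightedForm θ x vol ![] ![c]

/-- The projective class `[D]` of a torsion-free affine connection: all torsion-free affine
connections with the same unparametrised geodesics. -/
def projectiveClass (D : Conn m M) : Set (Conn m M) :=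
  {D' | IsAffine D' ∧ ∀ J γ, IsGeodesicOn D' J γ ↔ IsGeodesicOn D J γ}

/-- The weighted 1-form `κ` (of weight `2`) solves the Killing-type equation `∇_(a κ_b) = 0`. -/
def IsKilling (D : Conn m M) (κ : WField m M 0 1) : Prop :=
  ∀ (x : M) (vol : TopForm m x), vol ≠ 0 → ∀ u v : Tan m x,
    nabla D 2 κ x vol ![] ![u, v] + nabla D 2 κ x vol ![] ![v, u] = 0

/-- The conditions characterising the connection `∇^τ ∈ q` of the scale `τ` of `θ`:
`∇_a τ = 0`, `∇_(a k_b) = 0`, `W_ab^d_c k_d = -1/4 E_abc`. -/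
structure IsDistinguishedConnection (C : ContactStructure m M) (q : Set (Conn m M))
    (θ : (x : M) → Cotan m x) (D : Conn m M) : Prop where
  mem : D ∈ q
  scale_parallel : ∀ (x : M) (vol : TopForm m x), vol ≠ 0 → ∀ u : Tan m x,
    nabla D 2 (scale θ) x vol ![] ![u] = 0
  killing : IsKilling D C.k
  weyl_eq : ∀ (x : M) (vol : TopForm m x), vol ≠ 0 → ∀ a b c : Tan m x,
    C.k x vol ![] ![weyl D x a b c] = -(1 / 4) * tensorE D θ x vol a b c

/-- `p` is the distinguished projective structure of `(M, H, q)`: for every positive contact form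
(equivalently, positive scale `τ`) it is the projective class of `∇^τ`. -/
def IsDistinguishedProjectiveStructure (C : ContactStructure m M) (q p : Set (Conn m M)) : Prop :=
  ∀ θ ∈ C.positive, ∃ D, IsDistinguishedConnection C q θ D ∧ p = projectiveClass D

/-! ### Tractor 2-forms -/

/-- `D' = D + Υ` for a smooth 1-form `Υ`, i.e. `D'_a ξ^b = D_a ξ^b + Υ_a ξ^b + δ_a^b Υ_c ξ^c`. -/
def IsProjectiveChange (D D' : Conn m M) (Υ : (x : M) → Cotan m x) : Prop :=
  (∀ (x : M) (v : Tan m x),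
    ContMDiffAt (𝓡 (2 * m + 1)) 𝓘(ℝ, ℝ) ∞ (fun y => Υ y (extVec v y)) x) ∧
  ∀ (X : (x : M) → Tan m x) (x : M),
    MDifferentiableAt (𝓡 (2 * m + 1)) ((𝓡 (2 * m + 1)).prod 𝓘(ℝ, Model m))
      (fun y => (⟨y, X y⟩ : TangentBundle (𝓡 (2 * m + 1)) M)) x →
    ∀ u : Tan m x, D' X x u = D X x u + Υ x u • X x + Υ x (X x) • u

/-- A section of `Λ² 𝓣*` on `(M, p)`, where `𝓣* = J¹ 𝓔(1)`. In the splitting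
`Λ² 𝓣* = T*M(2) ⊕ Λ² T*M(2)` given by `D ∈ p` it is a pair `(κ_b, μ_bc)`; passing from `D` to
`D + Υ` leaves `κ` unchanged and turns `μ_bc` into `μ_bc + Υ_b κ_c - Υ_c κ_b`. -/
structure TractorTwoForm (p : Set (Conn m M)) where
  /-- The projecting part. -/
  proj : WField m M 0 1
  /-- The second component, in the splitting of `D ∈ p`. -/
  mu : Conn m M → WField m M 0 2
  proj_tensor : IsWeightedTensor 2 proj
  mu_tensor : ∀ D ∈ p, IsWeightedTensor 2 (mu D)
  mu_skew : ∀ D ∈ p, ∀ (x : M) (vol : TopForm m x), vol ≠ 0 → ∀ u v : Tan m x,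
    mu D x vol ![] ![u, v] = -mu D x vol ![] ![v, u]
  change : ∀ D ∈ p, ∀ D' ∈ p, ∀ Υ, IsProjectiveChange D D' Υ →
    ∀ (x : M) (vol : TopForm m x), vol ≠ 0 → ∀ u v : Tan m x,
      mu D' x vol ![] ![u, v] = mu D x vol ![] ![u, v]
        + Υ x u * proj x vol ![] ![v] - Υ x v * proj x vol ![] ![u]

/-- `Ω` is parallel for the tractor connection
`∇_a (κ_b, μ_bc) = (∇_a κ_b - μ_ab, ∇_a μ_bc + P_ab κ_c - P_ac κ_b)`. -/
def TractorTwoForm.IsParallel {p : Set (Conn m M)} (Ω : TractorTwoForm p) : Prop :=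
  ∀ D ∈ p, ∀ (x : M) (vol : TopForm m x), vol ≠ 0 →
    (∀ a b : Tan m x, nabla D 2 Ω.proj x vol ![] ![a, b] - Ω.mu D x vol ![] ![a, b] = 0) ∧
    (∀ a b c : Tan m x, nabla D 2 (Ω.mu D) x vol ![] ![a, b, c]
      + schouten D x a b * Ω.proj x vol ![] ![c] - schouten D x a c * Ω.proj x vol ![] ![b] = 0)

/-- `Ω` is symplectic, i.e. nondegenerate on each fibre `ℝ ⊕ T_x M` of the (split) tractor
bundle. -/
def TractorTwoForm.IsSymplectic {p : Set (Conn m M)} (Ω : TractorTwoForm p) : Prop :=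
  ∀ D ∈ p, ∀ (x : M) (vol : TopForm m x), vol ≠ 0 → ∀ (ρ : ℝ) (u : Tan m x),
    (∀ (ρ' : ℝ) (v : Tan m x), ρ * Ω.proj x vol ![] ![v] - ρ' * Ω.proj x vol ![] ![u]
      + Ω.mu D x vol ![] ![u, v] = 0) → ρ = 0 ∧ u = 0

/-- `κ ∈ Γ(T*M(2))` is a normal solution of the Killing-type equation of `(M, p)`: it solves
`∇_(a κ_b) = 0` and is the projecting part of a parallel section of `Λ² 𝓣*`. -/
def IsNormalSolution (p : Set (Conn m M)) (κ : WField m M 0 1) : Prop :=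
  IsWeightedTensor 2 κ ∧ (∀ D ∈ p, IsKilling D κ) ∧
    ∃ Ω : TractorTwoForm p, Ω.IsParallel ∧ Ω.proj = κ

end

end ContactProjective

end

open ContactProjective

/-! Write `ω = dθ` for a positive contact form `θ` with scale `τ`. Everything turns on connections
normalised for `θ` (`IsNormalized`): `∇τ = 0`, `∇θ = ½ω`, and `θ` annihilates the projective Weyl
curvature `W`.

If `∇θ = ½ω`, the Ricci identity for `θ` together with the first Bianchi identity gives `θ(R(u,v)w)
= ½ (∇_w ω)(u,v)` (`nab2_om_cyclic`); if `∇τ = 0`, the Ricci tensor is symmetric (`ric_symm`). Hence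
`θ(W(a,b)c) = ½ ∇_c ω(a,b) − P(b,c) θ(a) + P(a,c) θ(b)`. The vanishing of the left side is precisely
the second tractor equation for the pair `(τθ, ½τω)`, and `∇θ = ½ω` is the first. So `k = τθ` is the
projecting part of a parallel tractor 2-form on the projective class of a normalised connection; its
second component for `D + Υ` is `τ(½ω + Υ ∧ θ)`, and it is nondegenerate because `ω + θ ⊗ θ` is
(`IsNormalized.exists_tractorTwoForm`).

For a given distinguished structure, vanishing torsion makes `E` vanish, and the Killing equation
with `∇τ = 0` says that `∇θ` is skew; so the distinguished connections are normalised and the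
previous paragraph applies.

For existence, start from any connection in `q`. There are geodesics in all directions of `H`, so
compatibility forces `∇θ` to be skew on `H`. Vanishing torsion says that `∇ω` on `H` is pure trace,
of exactly the shape produced by a change `Υ ∨ id`; removing it gives a connection with parallel
Reeb field and parallel `ω` (`exists_adapted`). A further change `θ ∨ A`, with `A` horizontal and
trace-free, respects the `H`-geodesics, `∇τ` and `∇θ`, but moves `∇ω` and the Ricci tensor; `A` can
be solved for, from the Ricci tensor and a divergence, so that `θ(W) = 0`
(`exists_theta_weyl_eq_zero`). Finally one normalised connection serves all scales: for `fθ` the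
scale is `f⁻¹τ`, the projective change by `Υ = ½ d log f` makes it parallel, and `k`, `W` and the
geodesics do not notice. -/

set_option linter.unusedSectionVars false

noncomputable section

namespace ContactProjective

section

variable {m : ℕ} {M : Type*} [TopologicalSpace M] [ChartedSpace (Model m) M]

/-! ### Smooth functions and derivations -/

variable (m) in
/-- Smooth functions on `M`. -/
abbrev SmoothFn (f : M → ℝ) : Prop := ContMDiff (𝓡 (2 * m + 1)) 𝓘(ℝ, ℝ) ∞ f

variable (m) in
/-- Functions differentiable at `x`. -/
abbrev DiffFnAt (f : M → ℝ) (x : M) : Prop := MDifferentiableAt (𝓡 (2 * m + 1)) 𝓘(ℝ, ℝ) f x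

theorem SmoothFn.diff {f : M → ℝ} (hf : SmoothFn m f) (x : M) : DiffFnAt m f x :=
  (hf x).mdifferentiableAt (by simp)

theorem dfun_eq_mvfderiv (f : M → ℝ) (x : M) (u : Tan m x) :
    dfun f x u = mvfderiv (𝓡 (2 * m + 1)) f x u := rfl

theorem dfun_congr {f g : M → ℝ} {x : M} (h : f =ᶠ[𝓝 x] g) (u : Tan m x) :
    dfun f x u = dfun g x u := by
  unfold dfun
  rw [h.mfderiv_eq]
  rfl

theorem dfun_add {f g : M → ℝ} {x : M} (hf : DiffFnAt m f x) (hg : DiffFnAt m g x) (u : Tan m x) :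
    dfun (fun y => f y + g y) x u = dfun f x u + dfun g x u := by
  simp only [dfun_eq_mvfderiv]
  rw [mvfderiv_fun_add hf hg]
  rfl

theorem dfun_sub {f g : M → ℝ} {x : M} (hf : DiffFnAt m f x) (hg : DiffFnAt m g x) (u : Tan m x) :
    dfun (fun y => f y - g y) x u = dfun f x u - dfun g x u := by
  simp only [dfun_eq_mvfderiv]
  rw [mvfderiv_fun_sub hf hg]
  rfl

theorem dfun_mul {f g : M → ℝ} {x : M} (hf : DiffFnAt m f x) (hg : DiffFnAt m g x) (u : Tan m x) :
    dfun (fun y => f y * g y) x u = f x * dfun g x u + dfun f x u * g x := by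
  simp only [dfun_eq_mvfderiv]
  rw [mvfderiv_fun_mul hf hg]
  simp [mul_comm]

theorem dfun_const (c : ℝ) (x : M) (u : Tan m x) : dfun (fun _ => c) x u = 0 := by
  simp only [dfun_eq_mvfderiv]
  rw [mvfderiv_const]
  rfl

theorem dfun_const_mul {f : M → ℝ} {x : M} (hf : DiffFnAt m f x) (c : ℝ) (u : Tan m x) :
    dfun (fun y => c * f y) x u = c * dfun f x u := by
  rw [dfun_mul mdifferentiableAt_const hf, dfun_const]
  ring

theorem DiffFnAt.sum {ι : Type*} {f : ι → M → ℝ} {x : M} (s : Finset ι)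
    (hf : ∀ i ∈ s, DiffFnAt m (f i) x) : DiffFnAt m (fun y => ∑ i ∈ s, f i y) x := by
  classical
  induction s using Finset.induction_on with
  | empty => simpa using mdifferentiableAt_const
  | insert a s ha ih =>
    simp only [Finset.sum_insert ha]
    exact (hf a (Finset.mem_insert_self a s)).add
      (ih fun i hi => hf i (Finset.mem_insert_of_mem hi))

theorem dfun_sum {ι : Type*} {f : ι → M → ℝ} {x : M} (s : Finset ι)
    (hf : ∀ i ∈ s, DiffFnAt m (f i) x) (u : Tan m x) :
    dfun (fun y => ∑ i ∈ s, f i y) x u = ∑ i ∈ s, dfun (f i) x u := by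
  classical
  induction s using Finset.induction_on with
  | empty => simpa using dfun_const 0 x u
  | insert a s ha ih =>
    have h1 : ∀ i ∈ s, DiffFnAt m (f i) x := fun i hi => hf i (Finset.mem_insert_of_mem hi)
    have h2 : DiffFnAt m (fun y => ∑ i ∈ s, f i y) x := DiffFnAt.sum s h1
    simp only [Finset.sum_insert ha]
    rw [dfun_add (hf a (Finset.mem_insert_self a s)) h2, ih h1]

theorem dfun_add_right (f : M → ℝ) (x : M) (u v : Tan m x) :
    dfun f x (u + v) = dfun f x u + dfun f x v :=
  map_add (mfderiv (𝓡 (2 * m + 1)) 𝓘(ℝ, ℝ) f x) u v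

theorem dfun_smul_right (f : M → ℝ) (x : M) (c : ℝ) (u : Tan m x) :
    dfun f x (c • u) = c * dfun f x u :=
  map_smul (mfderiv (𝓡 (2 * m + 1)) 𝓘(ℝ, ℝ) f x) c u

/-- The differential of a function as a linear form. -/
def dlin (f : M → ℝ) (x : M) : Tan m x →ₗ[ℝ] ℝ where
  toFun := dfun f x
  map_add' := dfun_add_right f x
  map_smul' := dfun_smul_right f x

@[simp] theorem dlin_apply (f : M → ℝ) (x : M) (u : Tan m x) : dlin f x u = dfun f x u := rfl

/-! ### Frames -/

theorem frame_sum (x : M) (v : Tan m x) : ∑ i, coframe x i v • frame x i = v := by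
  have h := (EuclideanSpace.basisFun (Fin (2 * m + 1)) ℝ).sum_repr (v : Model m)
  simpa [frame, coframe] using! h

theorem coframe_frame (x : M) (i j : Fin (2 * m + 1)) :
    coframe x i (frame x j) = if i = j then (1 : ℝ) else 0 := by
  have : coframe x i (frame x j) = (EuclideanSpace.single j (1 : ℝ) : Model m) i := rfl
  rw [this]
  simp

theorem coframe_ext {x : M} {v w : Tan m x} (h : ∀ i, coframe x i v = coframe x i w) : v = w := by
  rw [← frame_sum x v, ← frame_sum x w]
  simp only [h]

theorem linear_ext_frame {x : M} {V : Type*} [AddCommGroup V] [Module ℝ V]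
    {f g : Tan m x →ₗ[ℝ] V} (h : ∀ i, f (frame x i) = g (frame x i)) : f = g := by
  ext v
  rw [← frame_sum x v]
  simp only [map_sum, map_smul, h]

/-! ### Smooth vector fields and coordinate frames -/

variable [IsManifold (𝓡 (2 * m + 1)) ∞ M]

/-- Smooth vector fields. -/
abbrev SmoothVF (X : (x : M) → Tan m x) : Prop :=
  ContMDiff (𝓡 (2 * m + 1)) ((𝓡 (2 * m + 1)).prod 𝓘(ℝ, Model m)) ∞
    (fun x => (⟨x, X x⟩ : TangentBundle (𝓡 (2 * m + 1)) M))

/-- Vector fields smooth at `x`. -/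
abbrev SmoothVFAt (X : (x : M) → Tan m x) (x : M) : Prop :=
  ContMDiffAt (𝓡 (2 * m + 1)) ((𝓡 (2 * m + 1)).prod 𝓘(ℝ, Model m)) ∞
    (fun x => (⟨x, X x⟩ : TangentBundle (𝓡 (2 * m + 1)) M)) x

/-- Vector fields differentiable at `x`. -/
abbrev DiffVFAt (X : (x : M) → Tan m x) (x : M) : Prop :=
  MDifferentiableAt (𝓡 (2 * m + 1)) ((𝓡 (2 * m + 1)).prod 𝓘(ℝ, Model m))
    (fun x => (⟨x, X x⟩ : TangentBundle (𝓡 (2 * m + 1)) M)) x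

theorem SmoothVFAt.diff {X : (x : M) → Tan m x} {x : M} (hX : SmoothVFAt X x) : DiffVFAt X x :=
  hX.mdifferentiableAt (by simp)

theorem SmoothVF.diff {X : (x : M) → Tan m x} (hX : SmoothVF X) (x : M) : DiffVFAt X x :=
  SmoothVFAt.diff (hX x)

variable (m) in
/-- The domain of the preferred chart at `x`. -/
def dom (x : M) : Set M :=
  (trivializationAt (Model m) (TangentSpace (𝓡 (2 * m + 1)) : M → Type _) x).baseSet

theorem isOpen_dom (x : M) : IsOpen (dom m x) :=
  (trivializationAt (Model m) (TangentSpace (𝓡 (2 * m + 1)) : M → Type _) x).open_baseSet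

theorem mem_dom (x : M) : x ∈ dom m x :=
  FiberBundle.mem_baseSet_trivializationAt' x

theorem dom_mem_nhds {x y : M} (h : y ∈ dom m x) : dom m x ∈ 𝓝 y := (isOpen_dom x).mem_nhds h

theorem transport_extVec {x y : M} (hy : y ∈ dom m x) (v : Tan m x) :
    transport x y (extVec v y) = v := by
  unfold transport extVec
  simp only [ContinuousLinearMap.comp_apply]
  rw [Bundle.Trivialization.continuousLinearMapAt_symmL _ hy,
    Bundle.Trivialization.symmL_continuousLinearMapAt _ (mem_dom x)]

theorem extVec_transport {x y : M} (hy : y ∈ dom m x) (v : Tan m y) :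
    extVec (transport x y v) y = v := by
  unfold transport extVec
  simp only [ContinuousLinearMap.comp_apply]
  rw [Bundle.Trivialization.continuousLinearMapAt_symmL _ (mem_dom x),
    Bundle.Trivialization.symmL_continuousLinearMapAt _ hy]

theorem transport_self (x : M) (v : Tan m x) : transport x x v = v := by
  rw [← extVec_self (transport x x v), extVec_transport (mem_dom x)]

/-- The components of a vector in the coordinate frame of the chart at `x`. -/
def coef (x : M) (i : Fin (2 * m + 1)) (y : M) : Cotan m y :=
  (coframe x i).comp (transport x y)

theorem coef_self (x : M) (i : Fin (2 * m + 1)) : coef x i x = coframe x i := by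
  ext v
  simp [coef, transport_self]

theorem extVec_sum {x y : M} (v : Tan m x) : extVec v y = ∑ i, coframe x i v • extVec (frame x i) y := by
  conv_lhs => rw [← frame_sum x v]
  simp only [extVec, map_sum, map_smul]

theorem coef_sum {x y : M} (hy : y ∈ dom m x) (v : Tan m y) :
    ∑ i, coef x i y v • extVec (frame x i) y = v := by
  simp only [coef, ContinuousLinearMap.comp_apply]
  rw [← extVec_sum, extVec_transport hy]

theorem coef_extVec {x y : M} (hy : y ∈ dom m x) (i : Fin (2 * m + 1)) (v : Tan m x) :
    coef x i y (extVec v y) = coframe x i v := by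
  simp only [coef, ContinuousLinearMap.comp_apply]
  rw [transport_extVec hy]

theorem coef_eq_trivialization (x : M) (i : Fin (2 * m + 1)) {y : M} (hy : y ∈ dom m x)
    (v : Tan m y) :
    coef x i y v = (coframe x i ∘L (trivializationAt (Model m) (TangentSpace (𝓡 (2 * m + 1)) : M → Type _) x).symmL ℝ x)
      ((trivializationAt (Model m) (TangentSpace (𝓡 (2 * m + 1)) : M → Type _) x) ⟨y, v⟩).2 := by
  have h2 := congrFun (Bundle.Trivialization.coe_linearMapAt_of_mem (R := ℝ)
    (trivializationAt (Model m) (TangentSpace (𝓡 (2 * m + 1)) : M → Type _) x) hy) v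
  rw [← h2]
  rfl

theorem contMDiffAt_coef {X : (x : M) → Tan m x} {x y : M} (hy : y ∈ dom m x)
    (hX : SmoothVFAt X y) (i : Fin (2 * m + 1)) :
    ContMDiffAt (𝓡 (2 * m + 1)) 𝓘(ℝ, ℝ) ∞ (fun z => coef x i z (X z)) y := by
  have h1 := (Bundle.Trivialization.contMDiffAt_section_iff
    (e := trivializationAt (Model m) (TangentSpace (𝓡 (2 * m + 1)) : M → Type _) x) hy).1 hX
  have h2 := ((coframe x i ∘L (trivializationAt (Model m) (TangentSpace (𝓡 (2 * m + 1)) : M → Type _) x).symmL ℝ x :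
    Model m →L[ℝ] ℝ).contMDiff (n := ∞)).contMDiffAt.comp y h1
  refine h2.congr_of_eventuallyEq ?_
  filter_upwards [dom_mem_nhds hy] with z hz
  exact coef_eq_trivialization x i hz (X z)

theorem mdifferentiableAt_coef {X : (x : M) → Tan m x} {x y : M} (hy : y ∈ dom m x)
    (hX : DiffVFAt X y) (i : Fin (2 * m + 1)) :
    DiffFnAt m (fun z => coef x i z (X z)) y := by
  have h1 := (Bundle.Trivialization.mdifferentiableAt_section_iff (𝓡 (2 * m + 1))
    (e := trivializationAt (Model m) (TangentSpace (𝓡 (2 * m + 1)) : M → Type _) x) X hy).1 hX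
  have h2 := ((coframe x i ∘L (trivializationAt (Model m) (TangentSpace (𝓡 (2 * m + 1)) : M → Type _) x).symmL ℝ x :
    Model m →L[ℝ] ℝ).contMDiff (n := ∞)).contMDiffAt.mdifferentiableAt (by simp) |>.comp y h1
  refine h2.congr_of_eventuallyEq ?_
  filter_upwards [dom_mem_nhds hy] with z hz
  exact coef_eq_trivialization x i hz (X z)

theorem contMDiffAt_extVec_of_mem {x y : M} (hy : y ∈ dom m x) (v : Tan m x) :
    SmoothVFAt (extVec v) y := by
  refine (Bundle.Trivialization.contMDiffAt_section_iff
    (e := trivializationAt (Model m) (TangentSpace (𝓡 (2 * m + 1)) : M → Type _) x) hy).2 ?_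
  refine (contMDiffAt_const (c := (trivializationAt (Model m) (TangentSpace (𝓡 (2 * m + 1)) : M → Type _)
    x).continuousLinearMapAt ℝ x v)).congr_of_eventuallyEq ?_
  filter_upwards [dom_mem_nhds hy] with z hz
  have h2 := congrFun (Bundle.Trivialization.coe_linearMapAt_of_mem (R := ℝ)
    (trivializationAt (Model m) (TangentSpace (𝓡 (2 * m + 1)) : M → Type _) x) hz) (extVec v z)
  refine h2.symm.trans ?_
  exact Bundle.Trivialization.continuousLinearMapAt_symmL _ hz _

variable (m) in
/-- A bump function equal to one near `x` and supported in the chart at `x`. -/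
def bump (x : M) : SmoothBumpFunction (𝓡 (2 * m + 1)) x := Classical.arbitrary _

/-- A globally smooth vector field agreeing near `x` with the constant coordinate field `extVec v`. -/
def fieldAt {x : M} (v : Tan m x) (y : M) : Tan m y := bump m x y • extVec v y

theorem fieldAt_eventuallyEq {x : M} (v : Tan m x) : ∀ᶠ y in 𝓝 x, fieldAt v y = extVec v y := by
  filter_upwards [(bump m x).eventuallyEq_one] with y hy
  rw [fieldAt, hy, Pi.one_apply, one_smul]

theorem fieldAt_self {x : M} (v : Tan m x) : fieldAt v x = v := by
  rw [(fieldAt_eventuallyEq v).self_of_nhds, extVec_self]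

theorem fieldAt_sum {x : M} (v : Tan m x) (y : M) :
    fieldAt v y = ∑ i, coframe x i v • fieldAt (frame x i) y := by
  simp only [fieldAt]
  rw [extVec_sum, Finset.smul_sum]
  exact Finset.sum_congr rfl fun i _ => smul_comm _ _ _

/-- The bump is supported in the chart domain, so the cut-off field extends by zero. Global fields
are needed because smoothness of a connection is tested on them. -/
theorem smoothVF_fieldAt [T2Space M] {x : M} (v : Tan m x) : SmoothVF (fieldAt v) := by
  have hs : ContMDiffOn (𝓡 (2 * m + 1)) ((𝓡 (2 * m + 1)).prod 𝓘(ℝ, Model m)) ∞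
      (fun y => (⟨y, extVec v y⟩ : TangentBundle (𝓡 (2 * m + 1)) M)) (dom m x) :=
    fun y hy => (contMDiffAt_extVec_of_mem hy v).contMDiffWithinAt
  exact ContMDiffOn.smul_section_of_tsupport ((bump m x).contMDiff.contMDiffOn) (isOpen_dom x)
    ((bump m x).tsupport_subset_chartAt_source) hs

theorem coef_fieldAt_eventually {x : M} (i : Fin (2 * m + 1)) (v : Tan m x) :
    ∀ᶠ y in 𝓝 x, coef x i y (fieldAt v y) = coframe x i v := by
  filter_upwards [fieldAt_eventuallyEq v, dom_mem_nhds (mem_dom (m := m) x)] with y h1 h2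
  rw [h1, coef_extVec h2]

theorem coef_sum_eventually (x : M) :
    ∀ᶠ y in 𝓝 x, ∀ v : Tan m y, ∑ i, coef x i y v • fieldAt (frame x i) y = v := by
  have h : ∀ᶠ y in 𝓝 x, ∀ i : Fin (2 * m + 1),
      fieldAt (frame x i) y = extVec (frame x i) y :=
    Filter.eventually_all.2 fun i => fieldAt_eventuallyEq _
  filter_upwards [h, dom_mem_nhds (mem_dom (m := m) x)] with y h1 h2 v
  simp only [h1]
  exact coef_sum h2 v

theorem SmoothVF.add {X Y : (x : M) → Tan m x} (hX : SmoothVF X) (hY : SmoothVF Y) :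
    SmoothVF (fun y => X y + Y y) := ContMDiff.add_section hX hY

theorem SmoothVF.sub {X Y : (x : M) → Tan m x} (hX : SmoothVF X) (hY : SmoothVF Y) :
    SmoothVF (fun y => X y - Y y) := ContMDiff.sub_section hX hY

theorem SmoothVF.smul {f : M → ℝ} {X : (x : M) → Tan m x} (hf : SmoothFn m f) (hX : SmoothVF X) :
    SmoothVF (fun y => f y • X y) := ContMDiff.smul_section hf hX

theorem SmoothVF.sum {ι : Type*} {s : Finset ι} {X : ι → (x : M) → Tan m x}
    (hX : ∀ i ∈ s, SmoothVF (X i)) : SmoothVF (fun y => ∑ i ∈ s, X i y) :=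
  ContMDiff.sum_section hX

/-- A vector field is smooth at `x` when its components in the chart at `x` are. -/
theorem smoothVFAt_of_coef {X : (x : M) → Tan m x} {x : M}
    (h : ∀ i, ContMDiffAt (𝓡 (2 * m + 1)) 𝓘(ℝ, ℝ) ∞ (fun z => coef x i z (X z)) x) :
    SmoothVFAt X x := by
  have h1 : ContMDiffAt (𝓡 (2 * m + 1)) ((𝓡 (2 * m + 1)).prod 𝓘(ℝ, Model m)) ∞
      (fun y => (⟨y, ∑ i, coef x i y (X y) • extVec (frame x i) y⟩ :
        TangentBundle (𝓡 (2 * m + 1)) M)) x :=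
    ContMDiffAt.sum_section fun i _ =>
      ContMDiffAt.smul_section (h i) (contMDiffAt_extVec_of_mem (mem_dom x) (frame x i))
  refine h1.congr_of_eventuallyEq ?_
  filter_upwards [dom_mem_nhds (mem_dom (m := m) x)] with y hy
  rw [coef_sum hy]

end

section

variable {m : ℕ} {M : Type*} [TopologicalSpace M] [ChartedSpace (Model m) M]
  [IsManifold (𝓡 (2 * m + 1)) ∞ M]

/-! ### Coordinate expressions -/

/-- The trivialisation at `x` is the derivative of the chart, and that derivative is the identity at
`x` itself. Coordinate fields are therefore images of constant fields under the inverse chart. -/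
theorem extVec_eq_mfderiv {x y : M} (hy : y ∈ dom m x) (v : Tan m x) :
    extVec v y = mfderiv 𝓘(ℝ, Model m) (𝓡 (2 * m + 1)) (extChartAt (𝓡 (2 * m + 1)) x).symm
      (extChartAt (𝓡 (2 * m + 1)) x y) v := by
  unfold extVec
  rw [TangentBundle.symmL_trivializationAt (I := 𝓡 (2 * m + 1)) hy,
    TangentBundle.continuousLinearMapAt_trivializationAt (I := 𝓡 (2 * m + 1)) (mem_dom x),
    mfderiv_extChartAt_self]
  rw [ModelWithCorners.range_eq_univ, mfderivWithin_univ]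
  rfl

/-- The chain rule through the inverse chart; differentiation along a coordinate field becomes a
Fréchet derivative in the model space. -/
theorem dfun_extVec {x y : M} (hy : y ∈ dom m x) {f : M → ℝ} (hf : DiffFnAt m f y) (v : Tan m x) :
    dfun f y (extVec v y) = fderiv ℝ (f ∘ (extChartAt (𝓡 (2 * m + 1)) x).symm)
      (extChartAt (𝓡 (2 * m + 1)) x y) (v : Model m) := by
  have hy' : y ∈ (extChartAt (𝓡 (2 * m + 1)) x).source := by rwa [extChartAt_source]
  have h1 : (extChartAt (𝓡 (2 * m + 1)) x).symm (extChartAt (𝓡 (2 * m + 1)) x y) = y :=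
    (extChartAt (𝓡 (2 * m + 1)) x).left_inv hy'
  have h2 : MDifferentiableAt 𝓘(ℝ, Model m) (𝓡 (2 * m + 1)) (extChartAt (𝓡 (2 * m + 1)) x).symm
      (extChartAt (𝓡 (2 * m + 1)) x y) := by
    have := mdifferentiableWithinAt_extChartAt_symm (I := 𝓡 (2 * m + 1))
      ((extChartAt (𝓡 (2 * m + 1)) x).map_source hy')
    rwa [ModelWithCorners.range_eq_univ, mdifferentiableWithinAt_univ] at this
  rw [extVec_eq_mfderiv hy]
  unfold dfun
  rw [← mfderiv_eq_fderiv]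
  exact (mfderiv_comp_apply_of_eq _ hf h2 h1 v).symm

theorem contDiffOn_chart {x : M} {f : M → ℝ} (hf : SmoothFn m f) :
    ContDiffOn ℝ ∞ (f ∘ (extChartAt (𝓡 (2 * m + 1)) x).symm)
      (extChartAt (𝓡 (2 * m + 1)) x).target := by
  have h := (hf.contMDiffOn (s := Set.univ)).comp (contMDiffOn_extChartAt_symm (I := 𝓡 (2 * m + 1)) (n := ∞) x)
    (fun _ _ => Set.mem_univ _)
  exact contMDiffOn_iff_contDiffOn.1 h

theorem contMDiffAt_chart {x y : M} (hy : y ∈ dom m x) :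
    ContMDiffAt (𝓡 (2 * m + 1)) 𝓘(ℝ, Model m) ∞ (extChartAt (𝓡 (2 * m + 1)) x) y :=
  contMDiffAt_extChartAt' hy

theorem contMDiffAt_dfun_extVec {x : M} {f : M → ℝ} (hf : SmoothFn m f) (v : Tan m x) {y : M}
    (hy : y ∈ dom m x) :
    ContMDiffAt (𝓡 (2 * m + 1)) 𝓘(ℝ, ℝ) ∞ (fun z => dfun f z (extVec v z)) y := by
  have hopen := isOpen_extChartAt_target (I := 𝓡 (2 * m + 1)) x
  have hy' : extChartAt (𝓡 (2 * m + 1)) x y ∈ (extChartAt (𝓡 (2 * m + 1)) x).target :=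
    (extChartAt (𝓡 (2 * m + 1)) x).map_source (by rwa [extChartAt_source])
  have h1 : ContDiffAt ℝ ∞ (fun p => fderiv ℝ (f ∘ (extChartAt (𝓡 (2 * m + 1)) x).symm) p
      (v : Model m)) (extChartAt (𝓡 (2 * m + 1)) x y) := by
    have := ((contDiffOn_chart (x := x) hf).fderiv_of_isOpen (m := ∞) hopen (by simp)).contDiffAt
      (hopen.mem_nhds hy')
    exact this.clm_apply contDiffAt_const
  refine (h1.contMDiffAt.comp y (contMDiffAt_chart hy)).congr_of_eventuallyEq ?_
  filter_upwards [dom_mem_nhds hy] with z hz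
  exact dfun_extVec hz (hf.diff z) v

theorem smoothFn_dfun {f : M → ℝ} (hf : SmoothFn m f) {X : (x : M) → Tan m x} (hX : SmoothVF X) :
    SmoothFn m (fun y => dfun f y (X y)) := by
  intro x
  have h : ContMDiffAt (𝓡 (2 * m + 1)) 𝓘(ℝ, ℝ) ∞
      (fun y => ∑ i, coef x i y (X y) * dfun f y (extVec (frame x i) y)) x :=
    contMDiffAt_finsetSum fun i _ =>
      (contMDiffAt_coef (mem_dom x) (hX x) i).mul (contMDiffAt_dfun_extVec hf _ (mem_dom x))
  refine h.congr_of_eventuallyEq ?_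
  filter_upwards [dom_mem_nhds (mem_dom (m := m) x)] with y hy
  conv_lhs => rw [← coef_sum hy (X y)]
  rw [← dlin_apply, map_sum]
  simp

theorem fderiv_fderiv_apply {F : Model m → ℝ} {p : Model m}
    (h : DifferentiableAt ℝ (fderiv ℝ F) p) (u v : Model m) :
    fderiv ℝ (fun q => fderiv ℝ F q v) p u = fderiv ℝ (fderiv ℝ F) p u v := by
  rw [fderiv_clm_apply h (differentiableAt_const v)]
  simp

/-- Coordinate vector fields commute on functions. -/
theorem dfun_dfun_comm {x : M} {f : M → ℝ} (hf : SmoothFn m f) (u v : Tan m x) :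
    dfun (fun y => dfun f y (fieldAt v y)) x u = dfun (fun y => dfun f y (fieldAt u y)) x v := by
  have hopen := isOpen_extChartAt_target (I := 𝓡 (2 * m + 1)) x
  set φ := extChartAt (𝓡 (2 * m + 1)) x with hφ
  have hx' : φ x ∈ φ.target := φ.map_source (by simp [hφ])
  set F := f ∘ φ.symm with hF
  have hFd : ContDiffAt ℝ ∞ F (φ x) := (contDiffOn_chart (x := x) hf).contDiffAt (hopen.mem_nhds hx')
  -- Either order of differentiation is the second Fréchet derivative of `f` in the chart, which is
  -- symmetric.
  have key : ∀ u v : Tan m x, dfun (fun y => dfun f y (fieldAt v y)) x u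
      = fderiv ℝ (fderiv ℝ F) (φ x) (u : Model m) (v : Model m) := by
    intro u v
    have e1 : (fun y => dfun f y (fieldAt v y)) =ᶠ[𝓝 x] fun y => dfun f y (extVec v y) := by
      filter_upwards [fieldAt_eventuallyEq v] with y hy
      rw [hy]
    rw [dfun_congr e1]
    have h2 : DiffFnAt m (fun y => dfun f y (extVec v y)) x :=
      (contMDiffAt_dfun_extVec hf v (mem_dom x)).mdifferentiableAt (by simp)
    have h3 := dfun_extVec (mem_dom x) h2 u
    rw [extVec_self] at h3
    rw [h3]
    have e2 : ((fun y => dfun f y (extVec v y)) ∘ φ.symm) =ᶠ[𝓝 (φ x)]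
        fun p => fderiv ℝ F p (v : Model m) := by
      filter_upwards [hopen.mem_nhds hx'] with p hp
      have hp' : φ.symm p ∈ dom m x := by
        have := φ.map_target hp
        rwa [hφ, extChartAt_source] at this
      simp only [Function.comp_apply]
      rw [dfun_extVec hp' (hf.diff _), ← hφ, φ.right_inv hp]
    rw [e2.fderiv_eq]
    have h4 : DifferentiableAt ℝ (fderiv ℝ F) (φ x) :=
      (hFd.fderiv_right (m := 1) (by norm_cast)).differentiableAt (by simp)
    exact fderiv_fderiv_apply h4 (u : Model m) (v : Model m)
  rw [key u v, key v u]
  exact (hFd.isSymmSndFDerivAt (by rw [minSmoothness_of_isRCLikeNormedField]; norm_cast)).eq _ _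

/-- A constant vector field on the model space. -/
def constField {x : M} (w : Tan m x) (z : Model m) : TangentSpace 𝓘(ℝ, Model m) z := (w : Model m)

omit [IsManifold (𝓡 (2 * m + 1)) ∞ M] in
theorem mdifferentiableAt_constField {x : M} (w : Tan m x) (z : Model m) :
    MDifferentiableAt 𝓘(ℝ, Model m) (𝓘(ℝ, Model m).prod 𝓘(ℝ, Model m))
      (fun z => (⟨z, constField w z⟩ : TangentBundle 𝓘(ℝ, Model m) (Model m))) z := by
  have : ContMDiffAt 𝓘(ℝ, Model m) (𝓘(ℝ, Model m).prod 𝓘(ℝ, Model m)) ∞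
      (fun z => (⟨z, constField w z⟩ : TangentBundle 𝓘(ℝ, Model m) (Model m))) z := by
    rw [contMDiffAt_vectorSpace_iff_contDiffAt]
    exact contDiffAt_const
  exact this.mdifferentiableAt (by simp)

-- This is the form in which naturality of the Lie bracket can be applied to coordinate fields.
open VectorField in
theorem extVec_eq_mpullback {x z : M} (hz : z ∈ dom m x) (v : Tan m x) :
    extVec v z = mpullback (𝓡 (2 * m + 1)) 𝓘(ℝ, Model m)
      (extChartAt (𝓡 (2 * m + 1)) x) (constField v) z := by
  have hz' : z ∈ (extChartAt (𝓡 (2 * m + 1)) x).source := by rwa [extChartAt_source]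
  have h1 := isInvertible_mfderiv_extChartAt (I := 𝓡 (2 * m + 1)) hz'
  have h2 : mfderiv (𝓡 (2 * m + 1)) 𝓘(ℝ, Model m) (extChartAt (𝓡 (2 * m + 1)) x) z (extVec v z)
      = constField v (extChartAt (𝓡 (2 * m + 1)) x z) := by
    have a1 := DFunLike.congr_fun (TangentBundle.continuousLinearMapAt_trivializationAt
      (I := 𝓡 (2 * m + 1)) hz) (extVec v z)
    have a2 := DFunLike.congr_fun (TangentBundle.continuousLinearMapAt_trivializationAt
      (I := 𝓡 (2 * m + 1)) (mem_dom (m := m) x)) v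
    rw [mfderiv_extChartAt_self] at a2
    exact (a1.symm.trans (Bundle.Trivialization.continuousLinearMapAt_symmL _ hz _)).trans a2
  exact (h1.inverse_apply_eq.2 h2.symm).symm

-- The bracket is natural under pullback by the chart, and constant fields commute. The bracket
-- terms in `curvature` and `extDer` consequently vanish.
open VectorField in
theorem mlieBracket_extVec {x y : M} (hy : y ∈ dom m x) (u v : Tan m x) :
    mlieBracket (𝓡 (2 * m + 1)) (extVec u) (extVec v) y = 0 := by
  have : IsManifold (𝓡 (2 * m + 1)) (minSmoothness ℝ 2) M := by
    rw [minSmoothness_of_isRCLikeNormedField]; infer_instance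
  have : IsManifold 𝓘(ℝ, Model m) (minSmoothness ℝ 2) (Model m) := by
    rw [minSmoothness_of_isRCLikeNormedField]; infer_instance
  have e : ∀ v : Tan m x, extVec v =ᶠ[𝓝 y] mpullback (𝓡 (2 * m + 1)) 𝓘(ℝ, Model m)
      (extChartAt (𝓡 (2 * m + 1)) x) (constField v) := fun v => by
    filter_upwards [dom_mem_nhds hy] with z hz using extVec_eq_mpullback hz v
  rw [(e u).mlieBracket_vectorField_eq (e v)]
  refine (mpullback_mlieBracket (n := ∞) (mdifferentiableAt_constField _ _)
    (mdifferentiableAt_constField _ _) (contMDiffAt_chart hy)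
    (by rw [minSmoothness_of_isRCLikeNormedField]; norm_cast)).symm.trans ?_
  rw [mpullback_apply]
  have h0 : mlieBracket 𝓘(ℝ, Model m) (constField u) (constField v)
      (extChartAt (𝓡 (2 * m + 1)) x y) = 0 := by
    have hc : ∀ w : Tan m x, fderivWithin ℝ (fun z => (constField w z : Model m)) Set.univ = 0 :=
      fun w => by
        ext1 z
        exact fderivWithin_const_apply (𝕜 := ℝ) (s := Set.univ) (x := z) (w : Model m)
    rw [← mlieBracketWithin_univ, mlieBracketWithin_eq_lieBracketWithin]
    unfold lieBracketWithin
    erw [hc, hc]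
    exact sub_self _
  rw [h0, map_zero]

end

section

variable {m : ℕ} {M : Type*} [TopologicalSpace M] [ChartedSpace (Model m) M]
  [IsManifold (𝓡 (2 * m + 1)) ∞ M]

/-! ### Calculus of connections -/

omit [IsManifold (𝓡 (2 * m + 1)) ∞ M] in
theorem DiffFnAt.mul {f g : M → ℝ} {x : M} (hf : DiffFnAt m f x) (hg : DiffFnAt m g x) :
    DiffFnAt m (fun y => f y * g y) x := MDifferentiableAt.mul hf hg

theorem conn_congr (D : Conn m M) {X Y : (x : M) → Tan m x} {x : M} (hX : DiffVFAt X x)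
    (h : ∀ᶠ y in 𝓝 x, X y = Y y) : D X x = D Y x := by
  have hY : DiffVFAt Y x := hX.congr_of_eventuallyEq (by
    filter_upwards [h] with y hy
    rw [hy])
  exact D.isCovariantDerivativeOnUniv.congr_of_eventuallyEq hX hY Filter.univ_mem h

theorem conn_add (D : Conn m M) {X Y : (x : M) → Tan m x} {x : M} (hX : DiffVFAt X x)
    (hY : DiffVFAt Y x) (u : Tan m x) : D (fun y => X y + Y y) x u = D X x u + D Y x u :=
  congrArg (fun L => L u) (D.isCovariantDerivativeOnUniv.add hX hY)

theorem conn_smul (D : Conn m M) {f : M → ℝ} {X : (x : M) → Tan m x} {x : M}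
    (hf : DiffFnAt m f x) (hX : DiffVFAt X x) (u : Tan m x) :
    D (fun y => f y • X y) x u = f x • D X x u + dfun f x u • X x :=
  congrArg (fun L => L u) (D.isCovariantDerivativeOnUniv.leibniz hX hf)

theorem DiffVFAt.add {X Y : (x : M) → Tan m x} {x : M} (hX : DiffVFAt X x) (hY : DiffVFAt Y x) :
    DiffVFAt (fun y => X y + Y y) x := mdifferentiableAt_add_section hX hY

theorem DiffVFAt.smul {f : M → ℝ} {X : (x : M) → Tan m x} {x : M} (hf : DiffFnAt m f x)
    (hX : DiffVFAt X x) : DiffVFAt (fun y => f y • X y) x :=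
  MDifferentiableAt.smul_section hf hX

theorem DiffVFAt.zero (x : M) : DiffVFAt (fun y => (0 : Tan m y)) x :=
  ((Bundle.contMDiff_zeroSection ℝ (TangentSpace (𝓡 (2 * m + 1)) : M → Type _)
    (IB := 𝓡 (2 * m + 1)) (n := ∞)) x).mdifferentiableAt (by simp)

theorem conn_zero (D : Conn m M) (x : M) (u : Tan m x) : D (fun y => (0 : Tan m y)) x u = 0 := by
  have h := conn_add D (DiffVFAt.zero x) (DiffVFAt.zero x) u
  simpa using h

theorem DiffVFAt.sum {ι : Type*} {X : ι → (x : M) → Tan m x} {x : M} (s : Finset ι)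
    (hX : ∀ i ∈ s, DiffVFAt (X i) x) : DiffVFAt (fun y => ∑ i ∈ s, X i y) x := by
  classical
  induction s using Finset.induction_on with
  | empty => simpa using DiffVFAt.zero x
  | insert a s ha ih =>
    simp only [Finset.sum_insert ha]
    exact (hX a (Finset.mem_insert_self a s)).add
      (ih fun i hi => hX i (Finset.mem_insert_of_mem hi))

theorem conn_sum (D : Conn m M) {ι : Type*} {X : ι → (x : M) → Tan m x} {x : M} (s : Finset ι)
    (hX : ∀ i ∈ s, DiffVFAt (X i) x) (u : Tan m x) :
    D (fun y => ∑ i ∈ s, X i y) x u = ∑ i ∈ s, D (X i) x u := by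
  classical
  induction s using Finset.induction_on with
  | empty => simpa using conn_zero D x u
  | insert a s ha ih =>
    simp only [Finset.sum_insert ha]
    have h1 : ∀ i ∈ s, DiffVFAt (X i) x := fun i hi => hX i (Finset.mem_insert_of_mem hi)
    rw [conn_add D (hX a (Finset.mem_insert_self a s)) (DiffVFAt.sum s h1), ih h1]

theorem diffVFAt_fieldAt {x : M} (v : Tan m x) : DiffVFAt (fieldAt v) x :=
  (mdifferentiableAt_extVec v).congr_of_eventuallyEq (by
    filter_upwards [fieldAt_eventuallyEq v] with y hy
    rw [hy])

theorem conn_extVec (D : Conn m M) {x : M} (v : Tan m x) : D (extVec v) x = D (fieldAt v) x :=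
  (conn_congr D (diffVFAt_fieldAt v) (fieldAt_eventuallyEq v)).symm

/-- The Leibniz rule in the coordinate frame. Only the components of `X` get differentiated, which
is what makes derivatives along a curve depend on the values along that curve alone (`conn_along`).
-/
theorem conn_expand (D : Conn m M) {X : (x : M) → Tan m x} {x : M} (hX : DiffVFAt X x)
    (u : Tan m x) : D X x u = ∑ i, (dfun (fun z => coef x i z (X z)) x u • frame x i
      + coframe x i (X x) • D (fieldAt (frame x i)) x u) := by
  have hc : ∀ i, DiffFnAt m (fun z => coef x i z (X z)) x :=
    fun i => mdifferentiableAt_coef (mem_dom x) hX i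
  have h1 : ∀ᶠ y in 𝓝 x, X y = ∑ i, coef x i y (X y) • fieldAt (frame x i) y := by
    filter_upwards [coef_sum_eventually (m := m) x] with y hy
    rw [hy]
  rw [conn_congr D hX h1,
    conn_sum D Finset.univ fun i _ => DiffVFAt.smul (hc i) (diffVFAt_fieldAt _)]
  refine Finset.sum_congr rfl fun i _ => ?_
  rw [conn_smul D (hc i) (diffVFAt_fieldAt _), fieldAt_self, coef_self]
  exact add_comm _ _

theorem SmoothVF.conn [T2Space M] {D : Conn m M} (hD : IsAffine D) {X Y : (x : M) → Tan m x}
    (hX : SmoothVF X) (hY : SmoothVF Y) : SmoothVF (fun y => D X y (Y y)) := by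
  have h := hD.1.contMDiff.contMDiff (σ := X) (by simpa using hX.contMDiffOn)
  exact ContMDiff.clm_bundle_apply (contMDiffOn_univ.1 h) hY

theorem torsionFree {D : Conn m M} (hD : IsAffine D) {X Y : (x : M) → Tan m x} {x : M}
    (hX : DiffVFAt X x) (hY : DiffVFAt Y x) :
    D Y x (X x) - D X x (Y x) = VectorField.mlieBracket (𝓡 (2 * m + 1)) X Y x :=
  D.torsion_eq_zero_iff.1 hD.2 hX hY

theorem mlieBracket_fieldAt {x : M} (u v : Tan m x) :
    ∀ᶠ y in 𝓝 x, VectorField.mlieBracket (𝓡 (2 * m + 1)) (fieldAt u) (fieldAt v) y = 0 := by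
  filter_upwards [(fieldAt_eventuallyEq u).eventually_nhds,
    (fieldAt_eventuallyEq v).eventually_nhds, dom_mem_nhds (mem_dom (m := m) x)] with y h1 h2 h3
  rw [Filter.EventuallyEq.mlieBracket_vectorField_eq h1 h2, mlieBracket_extVec h3]

theorem conn_fieldAt_comm_eventually [T2Space M] {D : Conn m M} (hD : IsAffine D) {x : M}
    (u v : Tan m x) :
    ∀ᶠ y in 𝓝 x, D (fieldAt v) y (fieldAt u y) = D (fieldAt u) y (fieldAt v y) := by
  filter_upwards [mlieBracket_fieldAt u v] with y hy
  have := torsionFree hD ((smoothVF_fieldAt u).diff y) ((smoothVF_fieldAt v).diff y)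
  rw [hy] at this
  exact sub_eq_zero.1 this

theorem conn_fieldAt_comm [T2Space M] {D : Conn m M} (hD : IsAffine D) {x : M} (u v : Tan m x) :
    D (fieldAt v) x u = D (fieldAt u) x v := by
  have := (conn_fieldAt_comm_eventually hD u v).self_of_nhds
  rwa [fieldAt_self, fieldAt_self] at this

/-! ### Smooth tensor fields and their covariant derivatives -/

/-- Smooth 1-forms. -/
def SmoothForm (θ : (x : M) → Cotan m x) : Prop :=
  ∀ X : (x : M) → Tan m x, SmoothVF X → SmoothFn m (fun y => θ y (X y))

/-- Smooth tensors with two lower indices. -/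
def SmoothTwo (T : (x : M) → Tan m x →ₗ[ℝ] Tan m x →ₗ[ℝ] ℝ) : Prop :=
  ∀ X Y : (x : M) → Tan m x, SmoothVF X → SmoothVF Y → SmoothFn m (fun y => T y (X y) (Y y))

/-- Smooth fields of endomorphisms of the tangent bundle. -/
def SmoothEnd (A : (x : M) → Tan m x →ₗ[ℝ] Tan m x) : Prop :=
  ∀ X : (x : M) → Tan m x, SmoothVF X → SmoothVF (fun y => A y (X y))

theorem smoothForm_iff [T2Space M] {θ : (x : M) → Cotan m x} :
    SmoothForm θ ↔ ∀ (x : M) (v : Tan m x),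
      ContMDiffAt (𝓡 (2 * m + 1)) 𝓘(ℝ, ℝ) ∞ (fun y => θ y (extVec v y)) x := by
  constructor
  · intro h x v
    refine (h _ (smoothVF_fieldAt v) x).congr_of_eventuallyEq ?_
    filter_upwards [fieldAt_eventuallyEq v] with y hy
    rw [hy]
  · intro h X hX x
    have h1 : ContMDiffAt (𝓡 (2 * m + 1)) 𝓘(ℝ, ℝ) ∞
        (fun y => ∑ i, coef x i y (X y) * θ y (extVec (frame x i) y)) x :=
      contMDiffAt_finsetSum fun i _ => (contMDiffAt_coef (mem_dom x) (hX x) i).mul (h x _)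
    refine h1.congr_of_eventuallyEq ?_
    filter_upwards [dom_mem_nhds (mem_dom (m := m) x)] with y hy
    conv_lhs => rw [← coef_sum hy (X y)]
    simp

/-- Derivatives of the components of `X` cancel on the left, so that side is tensorial in `X` and
determined by the frame. The right side then serves as the definition of the covariant derivative in
`nab1` and `nab2`. -/
theorem linear_leibniz (D : Conn m M) {x : M} (ℓ : (y : M) → Tan m y →ₗ[ℝ] ℝ)
    (hℓ : ∀ i, DiffFnAt m (fun y => ℓ y (fieldAt (frame x i) y)) x) {X : (x : M) → Tan m x}
    (hX : DiffVFAt X x) (u : Tan m x) :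
    dfun (fun y => ℓ y (X y)) x u - ℓ x (D X x u) = ∑ i, coframe x i (X x) *
      (dfun (fun y => ℓ y (fieldAt (frame x i) y)) x u - ℓ x (D (fieldAt (frame x i)) x u)) := by
  have hc : ∀ i, DiffFnAt m (fun z => coef x i z (X z)) x :=
    fun i => mdifferentiableAt_coef (mem_dom x) hX i
  have h1 : (fun y => ℓ y (X y)) =ᶠ[𝓝 x]
      fun y => ∑ i, coef x i y (X y) * ℓ y (fieldAt (frame x i) y) := by
    filter_upwards [coef_sum_eventually (m := m) x] with y hy
    conv_lhs => rw [← hy (X y)]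
    simp
  rw [dfun_congr h1, dfun_sum _ fun i _ => DiffFnAt.mul (hc i) (hℓ i), conn_expand D hX u, map_sum,
    ← Finset.sum_sub_distrib]
  refine Finset.sum_congr rfl fun i _ => ?_
  rw [dfun_mul (hc i) (hℓ i), coef_self, fieldAt_self, map_add, map_smul, map_smul]
  simp only [smul_eq_mul]
  ring

/-- The vector-valued analogue of `linear_leibniz`, behind `nabE`. -/
theorem endomorphism_leibniz (D : Conn m M) {x : M} (A : (y : M) → Tan m y →ₗ[ℝ] Tan m y)
    (hA : ∀ i, DiffVFAt (fun y => A y (fieldAt (frame x i) y)) x) {X : (x : M) → Tan m x}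
    (hX : DiffVFAt X x) (hAX : DiffVFAt (fun y => A y (X y)) x) (u : Tan m x) :
    D (fun y => A y (X y)) x u - A x (D X x u) = ∑ i, coframe x i (X x) •
      (D (fun y => A y (fieldAt (frame x i) y)) x u - A x (D (fieldAt (frame x i)) x u)) := by
  have hc : ∀ i, DiffFnAt m (fun z => coef x i z (X z)) x :=
    fun i => mdifferentiableAt_coef (mem_dom x) hX i
  have h1 : ∀ᶠ y in 𝓝 x, A y (X y) = ∑ i, coef x i y (X y) • A y (fieldAt (frame x i) y) := by
    filter_upwards [coef_sum_eventually (m := m) x] with y hy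
    conv_lhs => rw [← hy (X y)]
    simp
  rw [conn_congr D hAX h1, conn_sum D _ fun i _ => DiffVFAt.smul (hc i) (hA i), conn_expand D hX u, map_sum,
    ← Finset.sum_sub_distrib]
  refine Finset.sum_congr rfl fun i _ => ?_
  rw [conn_smul D (hc i) (hA i), coef_self, fieldAt_self, map_add, map_smul, map_smul]
  module

/-- The covariant derivative `∇_u θ (v)` of a 1-form. -/
def nab1 (D : Conn m M) (θ : (x : M) → Cotan m x) (x : M) : Tan m x →ₗ[ℝ] Tan m x →ₗ[ℝ] ℝ :=
  ∑ i, LinearMap.smulRight (dlin (fun y => θ y (fieldAt (frame x i) y)) x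
    - (θ x).toLinearMap ∘ₗ (D (fieldAt (frame x i)) x).toLinearMap) (coframe x i).toLinearMap

/-- The covariant derivative `∇_u T (v, w)` of a tensor with two lower indices. -/
def nab2 (D : Conn m M) (T : (x : M) → Tan m x →ₗ[ℝ] Tan m x →ₗ[ℝ] ℝ) (x : M) :
    Tan m x →ₗ[ℝ] Tan m x →ₗ[ℝ] Tan m x →ₗ[ℝ] ℝ :=
  ∑ i, ∑ j, LinearMap.smulRight
    (dlin (fun y => T y (fieldAt (frame x i) y) (fieldAt (frame x j) y)) x
      - (T x).flip (frame x j) ∘ₗ (D (fieldAt (frame x i)) x).toLinearMap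
      - T x (frame x i) ∘ₗ (D (fieldAt (frame x j)) x).toLinearMap)
    (LinearMap.smulRight (coframe x i).toLinearMap (coframe x j).toLinearMap)

/-- The covariant derivative `(∇_u A) v` of a field of endomorphisms. -/
def nabE (D : Conn m M) (A : (x : M) → Tan m x →ₗ[ℝ] Tan m x) (x : M) :
    Tan m x →ₗ[ℝ] Tan m x →ₗ[ℝ] Tan m x :=
  ∑ i, (LinearMap.smulRightₗ (coframe x i).toLinearMap) ∘ₗ
    ((D (fun y => A y (fieldAt (frame x i) y)) x).toLinearMap
      - A x ∘ₗ (D (fieldAt (frame x i)) x).toLinearMap)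

theorem nab1_spec [T2Space M] (D : Conn m M) {θ : (x : M) → Cotan m x} (hθ : SmoothForm θ)
    {X : (x : M) → Tan m x} {x : M} (hX : DiffVFAt X x) (u : Tan m x) :
    dfun (fun y => θ y (X y)) x u = nab1 D θ x u (X x) + θ x (D X x u) := by
  have h := linear_leibniz D (fun y => (θ y).toLinearMap)
    (fun i => (hθ _ (smoothVF_fieldAt (frame x i))).diff x) hX u
  rw [← sub_eq_iff_eq_add]
  refine h.trans ?_
  simp only [nab1, LinearMap.sum_apply, LinearMap.smulRight_apply, LinearMap.smul_apply,
    LinearMap.sub_apply, LinearMap.comp_apply, dlin_apply, smul_eq_mul,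
    ContinuousLinearMap.coe_coe]
  exact Finset.sum_congr rfl fun i _ => mul_comm _ _

theorem nab2_spec [T2Space M] (D : Conn m M) {T : (x : M) → Tan m x →ₗ[ℝ] Tan m x →ₗ[ℝ] ℝ}
    (hT : SmoothTwo T) {X Y : (x : M) → Tan m x} {x : M} (hX : DiffVFAt X x) (hY : SmoothVF Y)
    (u : Tan m x) :
    dfun (fun y => T y (X y) (Y y)) x u
      = nab2 D T x u (X x) (Y x) + T x (D X x u) (Y x) + T x (X x) (D Y x u) := by
  -- One slot is expanded at a time: `h1` freezes the second field, `h2` puts a frame field in the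
  -- first slot.
  have h1 := linear_leibniz D (fun y => (T y).flip (Y y))
    (fun i => (hT _ _ (smoothVF_fieldAt (frame x i)) hY).diff x) hX u
  have h2 := fun i => linear_leibniz D (fun y => T y (fieldAt (frame x i) y))
    (fun j => (hT _ _ (smoothVF_fieldAt (frame x i)) (smoothVF_fieldAt (frame x j))).diff x)
    (hY.diff x) u
  simp only [LinearMap.flip_apply, fieldAt_self] at h1 h2
  have h3 : T x (X x) (D Y x u) = ∑ i, coframe x i (X x) * T x (frame x i) (D Y x u) := by
    conv_lhs => rw [← frame_sum x (X x)]
    simp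
  have h4 : ∀ i, T x (D (fieldAt (frame x i)) x u) (Y x) =
      ∑ j, coframe x j (Y x) * T x (D (fieldAt (frame x i)) x u) (frame x j) := fun i => by
    conv_lhs => rw [← frame_sum x (Y x)]
    simp
  have h5 : dfun (fun y => T y (X y) (Y y)) x u = (∑ i, coframe x i (X x) *
      ((T x (frame x i)) (D Y x u) + ∑ j, coframe x j (Y x) *
      (dfun (fun y => T y (fieldAt (frame x i) y) (fieldAt (frame x j) y)) x u
        - T x (frame x i) (D (fieldAt (frame x j)) x u))
      - ∑ j, coframe x j (Y x) * T x (D (fieldAt (frame x i)) x u) (frame x j)))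
      + T x (D X x u) (Y x) := by
    rw [← sub_eq_iff_eq_add, h1]
    refine Finset.sum_congr rfl fun i _ => ?_
    rw [← h2 i, ← h4 i]
    ring
  rw [h5, h3]
  simp only [nab2, LinearMap.sum_apply, LinearMap.smulRight_apply, LinearMap.smul_apply,
    LinearMap.sub_apply, LinearMap.comp_apply, LinearMap.flip_apply, dlin_apply, smul_eq_mul,
    ContinuousLinearMap.coe_coe]
  rw [add_right_comm, ← Finset.sum_add_distrib]
  congr 1
  refine Finset.sum_congr rfl fun i _ => ?_
  rw [mul_sub, mul_add, Finset.mul_sum, Finset.mul_sum, add_sub_assoc, ← Finset.sum_sub_distrib,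
    add_comm]
  congr 1
  refine Finset.sum_congr rfl fun j _ => ?_
  ring

theorem nabE_spec [T2Space M] (D : Conn m M) {A : (x : M) → Tan m x →ₗ[ℝ] Tan m x}
    (hA : SmoothEnd A) {X : (x : M) → Tan m x} {x : M} (hX : SmoothVF X) (u : Tan m x) :
    D (fun y => A y (X y)) x u = nabE D A x u (X x) + A x (D X x u) := by
  have h := endomorphism_leibniz D A (fun i => (hA _ (smoothVF_fieldAt (frame x i))).diff x)
    (hX.diff x) ((hA X hX).diff x) u
  rw [← sub_eq_iff_eq_add]
  refine h.trans ?_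
  simp [nabE, LinearMap.smulRightₗ]

theorem SmoothTwo.nab1 [T2Space M] {D : Conn m M} (hD : IsAffine D) {θ : (x : M) → Cotan m x}
    (hθ : SmoothForm θ) : SmoothTwo (nab1 D θ) := by
  intro X Y hX hY
  have h : (fun y => ContactProjective.nab1 D θ y (X y) (Y y))
      = fun y => dfun (fun z => θ z (Y z)) y (X y) - θ y (D Y y (X y)) := by
    funext y
    rw [nab1_spec D hθ (hY.diff y)]
    ring
  rw [h]
  exact (smoothFn_dfun (hθ Y hY) hX).sub (hθ _ (hY.conn hD hX))

theorem SmoothEnd.nabE [T2Space M] {D : Conn m M} (hD : IsAffine D)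
    {A : (x : M) → Tan m x →ₗ[ℝ] Tan m x} (hA : SmoothEnd A)
    {X Y : (x : M) → Tan m x} (hX : SmoothVF X) (hY : SmoothVF Y) :
    SmoothVF (fun y => nabE D A y (X y) (Y y)) := by
  have h : (fun y => ContactProjective.nabE D A y (X y) (Y y))
      = fun y => D (fun z => A z (Y z)) y (X y) - A y (D Y y (X y)) := by
    funext y
    rw [nabE_spec D hA hY]
    abel
  rw [h]
  exact ((hA Y hY).conn hD hX).sub (hA _ (hY.conn hD hX))

end

section

variable {m : ℕ} {M : Type*} [TopologicalSpace M] [ChartedSpace (Model m) M]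
  [IsManifold (𝓡 (2 * m + 1)) ∞ M]

/-! ### Traces -/

/-- The trace of an endomorphism of a tangent space. -/
def tr {x : M} : (Tan m x →ₗ[ℝ] Tan m x) →ₗ[ℝ] ℝ where
  toFun A := ∑ i, coframe x i (A (frame x i))
  map_add' A B := by simp [Finset.sum_add_distrib]
  map_smul' c A := by simp [Finset.mul_sum]

theorem tr_apply {x : M} (A : Tan m x →ₗ[ℝ] Tan m x) :
    tr A = ∑ i, coframe x i (A (frame x i)) := rfl

theorem tr_smulRight {x : M} (α : Tan m x →ₗ[ℝ] ℝ) (v : Tan m x) :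
    tr (LinearMap.smulRight α v) = α v := by
  conv_rhs => rw [← frame_sum x v]
  simp only [tr_apply, LinearMap.smulRight_apply, map_smul, map_sum, smul_eq_mul]
  exact Finset.sum_congr rfl fun i _ => mul_comm _ _

theorem tr_id (x : M) : tr (LinearMap.id : Tan m x →ₗ[ℝ] Tan m x) = 2 * m + 1 := by
  simp only [tr_apply, LinearMap.id_apply, coframe_frame]
  simp

/-- The trace does not depend on the basis. The coordinate frame varies smoothly with `y`, so this
form of the trace can be differentiated. -/
theorem tr_eq_coef_sum {x y : M} (hy : ∀ v : Tan m y, ∑ i, coef x i y v • fieldAt (frame x i) y = v)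
    (A : Tan m y →ₗ[ℝ] Tan m y) : tr A = ∑ i, coef x i y (A (fieldAt (frame x i) y)) := by
  have h1 : ∀ i, coframe y i (A (frame y i))
      = ∑ j, coef x j y (frame y i) * coframe y i (A (fieldAt (frame x j) y)) := fun i => by
    conv_lhs => rw [← hy (frame y i)]
    simp
  have h2 : ∀ j, coef x j y (A (fieldAt (frame x j) y))
      = ∑ i, coef x j y (frame y i) * coframe y i (A (fieldAt (frame x j) y)) := fun j => by
    conv_lhs => rw [← frame_sum y (A (fieldAt (frame x j) y))]
    simp only [map_sum, map_smul, smul_eq_mul]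
    exact Finset.sum_congr rfl fun i _ => mul_comm _ _
  rw [tr_apply, Finset.sum_congr rfl fun i _ => h1 i, Finset.sum_comm]
  exact Finset.sum_congr rfl fun j _ => (h2 j).symm

theorem smoothFn_tr [T2Space M] {A : (x : M) → Tan m x →ₗ[ℝ] Tan m x} (hA : SmoothEnd A) :
    SmoothFn m (fun y => tr (A y)) := by
  intro x
  have h : ContMDiffAt (𝓡 (2 * m + 1)) 𝓘(ℝ, ℝ) ∞
      (fun y => ∑ i, coef x i y (A y (fieldAt (frame x i) y))) x :=
    contMDiffAt_finsetSum fun i _ =>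
      contMDiffAt_coef (mem_dom x) (hA _ (smoothVF_fieldAt (frame x i)) x) i
  refine h.congr_of_eventuallyEq ?_
  filter_upwards [coef_sum_eventually (m := m) x] with y hy using tr_eq_coef_sum hy _

/-- The coordinate coframe is constant on the coordinate frame, so only Christoffel terms survive.
-/
theorem dfun_coef (D : Conn m M) {x : M} (i : Fin (2 * m + 1)) {Z : (x : M) → Tan m x}
    (hZ : DiffVFAt Z x) (u : Tan m x) :
    dfun (fun y => coef x i y (Z y)) x u = coframe x i (D Z x u)
      - ∑ k, coframe x k (Z x) * coframe x i (D (fieldAt (frame x k)) x u) := by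
  have h0 : ∀ k, (fun y => coef x i y (fieldAt (frame x k) y)) =ᶠ[𝓝 x]
      fun _ => coframe x i (frame x k) := fun k => coef_fieldAt_eventually i (frame x k)
  have h := linear_leibniz D (fun y => (coef x i y).toLinearMap) (x := x)
    (fun k => (mdifferentiableAt_const (c := coframe x i (frame x k))).congr_of_eventuallyEq (h0 k))
    hZ u
  simp only [ContinuousLinearMap.coe_coe] at h
  simp only [dfun_congr (h0 _), dfun_const, coef_self] at h
  simp only [zero_sub, mul_neg, Finset.sum_neg_distrib] at h
  linarith

/-- Covariant differentiation commutes with contraction: the Christoffel terms of the upper and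
lower index cancel. -/
theorem dfun_tr [T2Space M] (D : Conn m M) {A : (x : M) → Tan m x →ₗ[ℝ] Tan m x}
    (hA : SmoothEnd A) (x : M) (u : Tan m x) :
    dfun (fun y => tr (A y)) x u = tr (nabE D A x u) := by
  have h1 : (fun y => tr (A y)) =ᶠ[𝓝 x]
      fun y => ∑ i, coef x i y (A y (fieldAt (frame x i) y)) := by
    filter_upwards [coef_sum_eventually (m := m) x] with y hy using tr_eq_coef_sum hy _
  have hs : ∀ i, SmoothVF (fun y => A y (fieldAt (frame x i) y)) :=
    fun i => hA _ (smoothVF_fieldAt (frame x i))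
  rw [dfun_congr h1, dfun_sum _ fun i _ => mdifferentiableAt_coef (mem_dom x) ((hs i).diff x) i]
  simp only [dfun_coef D _ ((hs _).diff x), nabE_spec D hA (smoothVF_fieldAt _), fieldAt_self]
  rw [Finset.sum_sub_distrib, Finset.sum_comm]
  have h2 : ∀ k, ∑ i, coframe x k (A x (frame x i)) * coframe x i (D (fieldAt (frame x k)) x u)
      = coframe x k (A x (D (fieldAt (frame x k)) x u)) := fun k => by
    conv_rhs => rw [← frame_sum x (D (fieldAt (frame x k)) x u)]
    simp only [map_sum, map_smul, smul_eq_mul]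
    exact Finset.sum_congr rfl fun i _ => mul_comm _ _
  rw [Finset.sum_congr rfl fun k _ => h2 k]
  simp only [map_add, Finset.sum_add_distrib, tr_apply]
  ring

/-! ### Curvature -/

/-- The field of endomorphisms `v ↦ ∇_v W`. -/
def nabV (D : Conn m M) (W : (x : M) → Tan m x) (x : M) : Tan m x →ₗ[ℝ] Tan m x :=
  (D W x).toLinearMap

@[simp] theorem nabV_apply (D : Conn m M) (W : (x : M) → Tan m x) (x : M) (v : Tan m x) :
    nabV D W x v = D W x v := rfl

theorem smoothEnd_nabV [T2Space M] {D : Conn m M} (hD : IsAffine D) {W : (x : M) → Tan m x}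
    (hW : SmoothVF W) : SmoothEnd (nabV D W) := fun _ hX => hW.conn hD hX

/-- The antisymmetrised second derivative of a vector field. -/
def curvAux (D : Conn m M) (W : (x : M) → Tan m x) (x : M) :
    Tan m x →ₗ[ℝ] Tan m x →ₗ[ℝ] Tan m x :=
  nabE D (nabV D W) x - (nabE D (nabV D W) x).flip

theorem curvAux_spec [T2Space M] {D : Conn m M} (hD : IsAffine D) {U V W : (x : M) → Tan m x}
    (hU : SmoothVF U) (hV : SmoothVF V) (hW : SmoothVF W) (x : M) :
    curvAux D W x (U x) (V x) = D (fun y => D W y (V y)) x (U x) - D (fun y => D W y (U y)) x (V x)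
      - D W x (D V x (U x) - D U x (V x)) := by
  have h1 := nabE_spec D (smoothEnd_nabV hD hW) hV (U x) (x := x)
  have h2 := nabE_spec D (smoothEnd_nabV hD hW) hU (V x) (x := x)
  simp only [nabV_apply] at h1 h2
  simp only [curvAux, LinearMap.sub_apply, LinearMap.flip_apply, h1, h2, map_sub]
  abel

theorem curvAux_fieldAt [T2Space M] {D : Conn m M} (hD : IsAffine D) {W : (x : M) → Tan m x}
    (hW : SmoothVF W) {x : M} (u v : Tan m x) :
    curvAux D W x u v = D (fun y => D W y (fieldAt v y)) x u
      - D (fun y => D W y (fieldAt u y)) x v := by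
  have h := curvAux_spec hD (smoothVF_fieldAt u) (smoothVF_fieldAt v) hW x
  simp only [fieldAt_self] at h
  rw [h, conn_fieldAt_comm hD u v, sub_self, map_zero, sub_zero]

theorem curvAux_add [T2Space M] {D : Conn m M} (hD : IsAffine D) {W W' : (x : M) → Tan m x}
    (hW : SmoothVF W) (hW' : SmoothVF W') (x : M) :
    curvAux D (fun y => W y + W' y) x = curvAux D W x + curvAux D W' x := by
  ext1 u; ext1 v
  have e : ∀ v : Tan m x, D (fun y => D (fun z => W z + W' z) y (fieldAt v y)) x
      = D (fun y => D W y (fieldAt v y) + D W' y (fieldAt v y)) x := fun v => by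
    congr 1; funext y; exact conn_add D (hW.diff y) (hW'.diff y) _
  rw [LinearMap.add_apply, LinearMap.add_apply, curvAux_fieldAt hD (hW.add hW'),
    curvAux_fieldAt hD hW, curvAux_fieldAt hD hW', e, e,
    conn_add D ((hW.conn hD (smoothVF_fieldAt v)).diff x) ((hW'.conn hD (smoothVF_fieldAt v)).diff x),
    conn_add D ((hW.conn hD (smoothVF_fieldAt u)).diff x) ((hW'.conn hD (smoothVF_fieldAt u)).diff x)]
  abel

/-- Terms with one derivative of `f` are symmetric in `u` and `v`, and the second derivatives of `f`
cancel because coordinate fields commute. This is the tensoriality of the curvature in the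
differentiated field. -/
theorem curvAux_smul [T2Space M] {D : Conn m M} (hD : IsAffine D) {f : M → ℝ}
    {W : (x : M) → Tan m x} (hf : SmoothFn m f) (hW : SmoothVF W) (x : M) :
    curvAux D (fun y => f y • W y) x = f x • curvAux D W x := by
  ext1 u; ext1 v
  have e : ∀ u v : Tan m x, D (fun y => D (fun z => f z • W z) y (fieldAt v y)) x u
      = f x • D (fun y => D W y (fieldAt v y)) x u + dfun f x u • D W x v
        + (dfun f x v • D W x u + dfun (fun y => dfun f y (fieldAt v y)) x u • W x) := fun u v => by
    have e1 : (fun y => D (fun z => f z • W z) y (fieldAt v y))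
        = fun y => f y • D W y (fieldAt v y) + dfun f y (fieldAt v y) • W y := by
      funext y; exact conn_smul D (hf.diff y) (hW.diff y) _
    have h1 := (hW.conn hD (smoothVF_fieldAt v)).diff x
    have h2 := (smoothFn_dfun hf (smoothVF_fieldAt v)).diff x
    rw [e1, conn_add D (DiffVFAt.smul (hf.diff x) h1) (DiffVFAt.smul h2 (hW.diff x)),
      conn_smul D (hf.diff x) h1, conn_smul D h2 (hW.diff x), fieldAt_self]
  rw [LinearMap.smul_apply, LinearMap.smul_apply, curvAux_fieldAt hD (hW.smul hf),
    curvAux_fieldAt hD hW, e, e, dfun_dfun_comm hf u v]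
  module

theorem curvAux_congr [T2Space M] {D : Conn m M} (hD : IsAffine D) {W W' : (x : M) → Tan m x}
    (hW : SmoothVF W) (hW' : SmoothVF W') {x : M} (h : ∀ᶠ y in 𝓝 x, W y = W' y) :
    curvAux D W x = curvAux D W' x := by
  ext1 u; ext1 v
  have e : ∀ v : Tan m x, D (fun y => D W y (fieldAt v y)) x = D (fun y => D W' y (fieldAt v y)) x :=
    fun v => by
      refine conn_congr D ((hW.conn hD (smoothVF_fieldAt v)).diff x) ?_
      filter_upwards [h.eventually_nhds] with y hy
      rw [conn_congr D (hW.diff y) hy]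
  rw [curvAux_fieldAt hD hW, curvAux_fieldAt hD hW', e, e]

theorem curvAux_sum [T2Space M] {D : Conn m M} (hD : IsAffine D) {ι : Type*} (s : Finset ι)
    {W : ι → (x : M) → Tan m x} (hW : ∀ i, SmoothVF (W i)) (x : M) :
    curvAux D (fun y => ∑ i ∈ s, W i y) x = ∑ i ∈ s, curvAux D (W i) x := by
  classical
  induction s using Finset.induction_on with
  | empty =>
    have h0 : SmoothVF (fun y => (0 : Tan m y)) :=
      Bundle.contMDiff_zeroSection ℝ (TangentSpace (𝓡 (2 * m + 1)) : M → Type _)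
    have h := curvAux_add hD h0 h0 x
    simpa using h
  | insert a s ha ih =>
    simp only [Finset.sum_insert ha]
    rw [curvAux_add hD (hW a) (SmoothVF.sum fun i _ => hW i), ih]

/-- The curvature as a multilinear map. -/
def Rm (D : Conn m M) (x : M) : Tan m x →ₗ[ℝ] Tan m x →ₗ[ℝ] Tan m x →ₗ[ℝ] Tan m x :=
  ∑ i, (curvAux D (fieldAt (frame x i)) x).compr₂ (LinearMap.smulRightₗ (coframe x i).toLinearMap)

theorem Rm_apply (D : Conn m M) (x : M) (u v w : Tan m x) :
    Rm D x u v w = ∑ i, coframe x i w • curvAux D (fieldAt (frame x i)) x u v := by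
  simp only [Rm, LinearMap.sum_apply, LinearMap.compr₂_apply]
  rfl

/-- Function-linearity reduces `W` to its coordinate components; a bump function turns these into
global smooth functions without changing the germ at `x`. -/
theorem Rm_eq_curvAux [T2Space M] {D : Conn m M} (hD : IsAffine D) {W : (x : M) → Tan m x}
    (hW : SmoothVF W) {x : M} (u v : Tan m x) : Rm D x u v (W x) = curvAux D W x u v := by
  have hs : ∀ i, SmoothFn m (fun y => bump m x y • coef x i y (W y)) := fun i =>
    (bump m x).contMDiff_smul fun y hy =>
      (contMDiffAt_coef (x := x) (y := y) hy (hW y) i).contMDiffWithinAt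
  have h1 : ∀ᶠ y in 𝓝 x, W y = ∑ i, (bump m x y • coef x i y (W y)) • fieldAt (frame x i) y := by
    filter_upwards [coef_sum_eventually (m := m) x, (bump m x).eventuallyEq_one] with y hy h1
    simp only [h1, Pi.one_apply, one_smul]
    rw [hy]
  rw [curvAux_congr hD hW (SmoothVF.sum fun i _ => (smoothVF_fieldAt (frame x i)).smul (hs i)) h1,
    curvAux_sum hD _ fun i => (smoothVF_fieldAt (frame x i)).smul (hs i), Rm_apply]
  simp only [curvAux_smul hD (hs _) (smoothVF_fieldAt _), LinearMap.sum_apply, LinearMap.smul_apply]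
  have hb : bump m x x = 1 := (bump m x).eq_one
  simp only [hb, one_smul, coef_self]

theorem Rm_spec [T2Space M] {D : Conn m M} (hD : IsAffine D) {U V W : (x : M) → Tan m x}
    (hU : SmoothVF U) (hV : SmoothVF V) (hW : SmoothVF W) (x : M) :
    Rm D x (U x) (V x) (W x) = D (fun y => D W y (V y)) x (U x) - D (fun y => D W y (U y)) x (V x)
      - D W x (D V x (U x) - D U x (V x)) := by
  rw [Rm_eq_curvAux hD hW, curvAux_spec hD hU hV hW]

theorem Rm_fieldAt [T2Space M] {D : Conn m M} (hD : IsAffine D) {x : M} (u v w : Tan m x) :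
    Rm D x u v w = D (fun y => D (fieldAt w) y (fieldAt v y)) x u
      - D (fun y => D (fieldAt w) y (fieldAt u y)) x v := by
  have h := Rm_eq_curvAux hD (smoothVF_fieldAt w) u v
  rw [fieldAt_self] at h
  rw [h, curvAux_fieldAt hD (smoothVF_fieldAt w)]

/-- Both sides depend only on germs of the extending fields, and the bracket term is zero. -/
theorem curvature_eq [T2Space M] {D : Conn m M} (hD : IsAffine D) {x : M} (u v w : Tan m x) :
    curvature D x u v w = Rm D x u v w := by
  have e : ∀ v : Tan m x, D (fun y => D (extVec w) y (extVec v y)) x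
      = D (fun y => D (fieldAt w) y (fieldAt v y)) x := fun v => by
    refine (conn_congr D (((smoothVF_fieldAt w).conn hD (smoothVF_fieldAt v)).diff x) ?_).symm
    filter_upwards [(fieldAt_eventuallyEq w).eventually_nhds, fieldAt_eventuallyEq v] with y h1 h2
    rw [h2, conn_congr D ((smoothVF_fieldAt w).diff y) h1]
  rw [curvature, mlieBracket_extVec (mem_dom x), map_zero, sub_zero, e, e, Rm_fieldAt hD]

theorem SmoothVF.Rm [T2Space M] {D : Conn m M} (hD : IsAffine D) {U V W : (x : M) → Tan m x}
    (hU : SmoothVF U) (hV : SmoothVF V) (hW : SmoothVF W) :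
    SmoothVF (fun y => Rm D y (U y) (V y) (W y)) := by
  simp only [Rm_spec hD hU hV hW]
  exact (((hW.conn hD hV).conn hD hU).sub ((hW.conn hD hU).conn hD hV)).sub
    (hW.conn hD ((hV.conn hD hU).sub (hU.conn hD hV)))

theorem Rm_skew (D : Conn m M) (x : M) (u v w : Tan m x) : Rm D x u v w = -Rm D x v u w := by
  simp only [Rm_apply, curvAux, LinearMap.sub_apply, LinearMap.flip_apply]
  rw [← Finset.sum_neg_distrib]
  exact Finset.sum_congr rfl fun i _ => by module

/-- The first Bianchi identity. -/
theorem bianchi [T2Space M] {D : Conn m M} (hD : IsAffine D) {x : M} (u v w : Tan m x) :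
    Rm D x u v w + Rm D x v w u + Rm D x w u v = 0 := by
  -- Torsion-freeness for commuting fields holds near `x`, hence survives another derivative; it
  -- pairs off the six terms.
  have e : ∀ v w : Tan m x, D (fun y => D (fieldAt w) y (fieldAt v y)) x
      = D (fun y => D (fieldAt v) y (fieldAt w y)) x := fun v w =>
    conn_congr D (((smoothVF_fieldAt w).conn hD (smoothVF_fieldAt v)).diff x)
      (conn_fieldAt_comm_eventually hD v w)
  rw [Rm_fieldAt hD, Rm_fieldAt hD, Rm_fieldAt hD, e v w, e u w, e v u]
  abel

/-- The Ricci identity for 1-forms. -/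
theorem ricci_identity [T2Space M] {D : Conn m M} (hD : IsAffine D) {θ : (x : M) → Cotan m x}
    (hθ : SmoothForm θ) {x : M} (u v w : Tan m x) :
    nab2 D (nab1 D θ) x u v w - nab2 D (nab1 D θ) x v u w = -θ x (Rm D x u v w) := by
  -- Second derivatives of the function `θ(w)` commute; the first-order cross terms below are
  -- symmetric in `u` and `v`, leaving `∇∇θ` and the curvature.
  have key : ∀ u v : Tan m x, dfun (fun y => dfun (fun z => θ z (fieldAt w z)) y (fieldAt v y)) x u
      = nab2 D (nab1 D θ) x u v w + nab1 D θ x (D (fieldAt v) x u) w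
        + nab1 D θ x v (D (fieldAt w) x u) + nab1 D θ x u (D (fieldAt w) x v)
        + θ x (D (fun y => D (fieldAt w) y (fieldAt v y)) x u) := fun u v => by
    have hv := smoothVF_fieldAt v
    have hw := smoothVF_fieldAt w
    have e1 : (fun y => dfun (fun z => θ z (fieldAt w z)) y (fieldAt v y))
        = fun y => nab1 D θ y (fieldAt v y) (fieldAt w y) + θ y (D (fieldAt w) y (fieldAt v y)) := by
      funext y; exact nab1_spec D hθ (hw.diff y) _
    rw [e1, dfun_add ((SmoothTwo.nab1 hD hθ _ _ hv hw).diff x) ((hθ _ (hw.conn hD hv)).diff x),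
      nab2_spec D (SmoothTwo.nab1 hD hθ) (hv.diff x) hw,
      nab1_spec D hθ ((hw.conn hD hv).diff x), fieldAt_self, fieldAt_self]
    ring
  have h := dfun_dfun_comm (hθ _ (smoothVF_fieldAt w)) u v
  rw [key, key, conn_fieldAt_comm hD u v] at h
  rw [Rm_fieldAt hD, map_sub]
  linarith

/-- The Ricci tensor as a bilinear form. -/
def Ric (D : Conn m M) (x : M) : Tan m x →ₗ[ℝ] Tan m x →ₗ[ℝ] ℝ :=
  ∑ i, (Rm D x (frame x i)).compr₂ (coframe x i).toLinearMap

theorem Ric_apply (D : Conn m M) (x : M) (b d : Tan m x) :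
    Ric D x b d = tr ((Rm D x).flip b |>.flip d) := by
  simp [Ric, tr_apply]

theorem ricci_eq [T2Space M] {D : Conn m M} (hD : IsAffine D) {x : M} (b d : Tan m x) :
    ricci D x b d = Ric D x b d := by
  simp [ricci, Ric, curvature_eq hD]

theorem smoothTwo_Ric [T2Space M] {D : Conn m M} (hD : IsAffine D) : SmoothTwo (Ric D) := by
  intro X Y hX hY
  simp only [Ric_apply]
  exact smoothFn_tr (A := fun y => ((Rm D y).flip (X y)).flip (Y y)) fun U hU => hU.Rm hD hX hY

/-- The trace of the curvature is the skew part of the Ricci tensor. -/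
theorem tr_Rm [T2Space M] {D : Conn m M} (hD : IsAffine D) {x : M} (u v : Tan m x) :
    tr (Rm D x u v) = Ric D x v u - Ric D x u v := by
  rw [Ric_apply, Ric_apply, ← map_sub]
  congr 1
  ext1 w
  have := bianchi hD u v w
  simp only [LinearMap.sub_apply, LinearMap.flip_apply]
  rw [Rm_skew D x w v u, add_assoc] at *
  rw [eq_neg_of_add_eq_zero_left this]
  abel

end

section

variable {m : ℕ} {M : Type*} [TopologicalSpace M] [ChartedSpace (Model m) M]
  [IsManifold (𝓡 (2 * m + 1)) ∞ M]

/-! ### Changing a connection by a tensor -/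

/-- A linear form on a tangent space, as a continuous one. -/
def toCotan {x : M} (L : Tan m x →ₗ[ℝ] ℝ) : Cotan m x := ∑ i, L (frame x i) • coframe x i

@[simp] theorem toCotan_apply {x : M} (L : Tan m x →ₗ[ℝ] ℝ) (v : Tan m x) : toCotan L v = L v := by
  conv_rhs => rw [← frame_sum x v]
  simp only [toCotan, _root_.sum_apply, _root_.smul_apply, map_sum,
    map_smul, smul_eq_mul]
  exact Finset.sum_congr rfl fun i _ => mul_comm _ _

/-- A bilinear map on a tangent space, as a continuous one. -/
def toContinuousBilin {x : M} (S : Tan m x →ₗ[ℝ] Tan m x →ₗ[ℝ] Tan m x) :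
    Tan m x →L[ℝ] Tan m x →L[ℝ] Tan m x :=
  ∑ i, ∑ j, (coframe x i).smulRight ((coframe x j).smulRight (S (frame x i) (frame x j)))

theorem toContinuousBilin_apply {x : M} (S : Tan m x →ₗ[ℝ] Tan m x →ₗ[ℝ] Tan m x)
    (u v : Tan m x) : toContinuousBilin S u v = S u v := by
  conv_rhs => rw [← frame_sum x u, ← frame_sum x v]
  simp only [toContinuousBilin, _root_.sum_apply, map_sum, map_smul,
    LinearMap.sum_apply, LinearMap.smul_apply, ContinuousLinearMap.smulRight_apply,
    _root_.smul_apply, Finset.smul_sum]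
  rw [Finset.sum_comm]
  exact Finset.sum_congr rfl fun i _ => Finset.sum_congr rfl fun j _ => smul_comm _ _ _

/-- The connection `D + S`. -/
def connAdd (D : Conn m M) (S : (x : M) → Tan m x →ₗ[ℝ] Tan m x →ₗ[ℝ] Tan m x) : Conn m M :=
  D.addOneForm fun x => toContinuousBilin (S x)

theorem connAdd_apply (D : Conn m M) (S : (x : M) → Tan m x →ₗ[ℝ] Tan m x →ₗ[ℝ] Tan m x)
    (X : (x : M) → Tan m x) (x : M) (u : Tan m x) :
    connAdd D S X x u = D X x u + S x (X x) u := by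
  rw [← toContinuousBilin_apply]
  rfl

/-- `D'` agrees with `D + S` on differentiable vector fields. -/
def IsChange (D D' : Conn m M) (S : (x : M) → Tan m x →ₗ[ℝ] Tan m x →ₗ[ℝ] Tan m x) : Prop :=
  ∀ (X : (x : M) → Tan m x) (x : M), DiffVFAt X x → ∀ u, D' X x u = D X x u + S x (X x) u

theorem isChange_connAdd (D : Conn m M) (S : (x : M) → Tan m x →ₗ[ℝ] Tan m x →ₗ[ℝ] Tan m x) :
    IsChange D (connAdd D S) S := fun X x _ u => connAdd_apply D S X x u

/-- Smooth tensors with two lower indices and one upper index. -/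
def SmoothBilin (S : (x : M) → Tan m x →ₗ[ℝ] Tan m x →ₗ[ℝ] Tan m x) : Prop :=
  ∀ X Y : (x : M) → Tan m x, SmoothVF X → SmoothVF Y → SmoothVF (fun y => S y (X y) (Y y))

/-- In the trivialisation a section of the Hom bundle is a matrix whose columns are the images of
coordinate fields, so smoothness can be checked column by column. -/
theorem contMDiffAt_hom {L : (x : M) → Tan m x →L[ℝ] Tan m x} {x : M}
    (hL : ∀ v : Tan m x, SmoothVFAt (fun y => L y (extVec v y)) x) :
    ContMDiffAt (𝓡 (2 * m + 1)) ((𝓡 (2 * m + 1)).prod 𝓘(ℝ, Model m →L[ℝ] Model m)) ∞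
      (fun y => (⟨y, L y⟩ : Bundle.TotalSpace (Model m →L[ℝ] Model m)
        (fun y : M => Tan m y →L[ℝ] Tan m y))) x := by
  rw [contMDiffAt_hom_bundle]
  refine ⟨contMDiffAt_id, ?_⟩
  let e := trivializationAt (Model m) (TangentSpace (𝓡 (2 * m + 1)) : M → Type _) x
  let c : Fin (2 * m + 1) → M → Model m := fun i y =>
    (e ⟨y, L y (extVec (e.symmL ℝ x (EuclideanSpace.single i (1 : ℝ))) y)⟩).2
  have hc : ∀ i, ContMDiffAt (𝓡 (2 * m + 1)) 𝓘(ℝ, Model m) ∞ (c i) x := fun i =>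
    (Bundle.Trivialization.contMDiffAt_section_iff (e := e) (mem_dom x)).1 (hL _)
  have h1 : ContMDiffAt (𝓡 (2 * m + 1)) 𝓘(ℝ, Model m →L[ℝ] Model m) ∞
      (fun y => ∑ i, ContinuousLinearMap.smulRightL ℝ (Model m) (Model m)
        (EuclideanSpace.proj i : Model m →L[ℝ] ℝ) (c i y)) x :=
    contMDiffAt_finsetSum fun i _ => (ContinuousLinearMap.contMDiff
      (ContinuousLinearMap.smulRightL ℝ (Model m) (Model m)
        (EuclideanSpace.proj i : Model m →L[ℝ] ℝ))).contMDiffAt.comp x (hc i)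
  refine h1.congr_of_eventuallyEq ?_
  filter_upwards [dom_mem_nhds (mem_dom (m := m) x)] with y hy
  ext1 w
  have hw : w = ∑ i, w i • (EuclideanSpace.single i (1 : ℝ) : Model m) := by
    have h := (EuclideanSpace.basisFun (Fin (2 * m + 1)) ℝ).sum_repr w
    simpa using h.symm
  have h2 : ∀ i, extVec (e.symmL ℝ x (EuclideanSpace.single i (1 : ℝ))) y
      = e.symmL ℝ y (EuclideanSpace.single i (1 : ℝ)) := fun i => by
    unfold extVec
    rw [Bundle.Trivialization.continuousLinearMapAt_symmL _ (mem_dom x)]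
  have h3 : ∀ v : Tan m y, e.continuousLinearMapAt ℝ y v = (e ⟨y, v⟩).2 := fun v =>
    congrFun (Bundle.Trivialization.coe_linearMapAt_of_mem (R := ℝ) e hy) v
  have h4 : (e.continuousLinearMapAt ℝ y ∘L L y ∘L e.symmL ℝ y) w
      = ∑ i, w i • c i y := by
    conv_lhs => rw [hw]
    rw [map_sum]
    refine Finset.sum_congr rfl fun i _ => ?_
    rw [map_smul]
    congr 1
    change e.continuousLinearMapAt ℝ y (L y (e.symmL ℝ y (EuclideanSpace.single i (1 : ℝ)))) = c i y
    rw [h3, ← h2]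
  refine h4.trans ?_
  simp [_root_.sum_apply]

theorem isAffine_connAdd [T2Space M] {D : Conn m M} (hD : IsAffine D)
    {S : (x : M) → Tan m x →ₗ[ℝ] Tan m x →ₗ[ℝ] Tan m x}
    (hsymm : ∀ x u v, S x u v = S x v u) (hS : SmoothBilin S) : IsAffine (connAdd D S) := by
  refine ⟨⟨⟨fun {σ} hσ => ?_⟩⟩, ?_⟩
  · have hσ' : SmoothVF σ := contMDiffOn_univ.1 (by simpa using hσ)
    have h1 := contMDiffOn_univ.1 (hD.1.contMDiff.contMDiff hσ)
    rw [contMDiffOn_univ]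
    refine ContMDiff.add_section h1 fun x => contMDiffAt_hom fun v => ?_
    refine (hS σ _ hσ' (smoothVF_fieldAt v) x).congr_of_eventuallyEq ?_
    filter_upwards [fieldAt_eventuallyEq v] with y hy
    rw [hy, toContinuousBilin_apply]
  · rw [CovariantDerivative.torsion_eq_zero_iff]
    intro X Y x hX hY
    rw [connAdd_apply, connAdd_apply, hsymm, ← torsionFree hD hX hY]
    abel

theorem IsChange.nab1_eq [T2Space M] {D D' : Conn m M}
    {S : (x : M) → Tan m x →ₗ[ℝ] Tan m x →ₗ[ℝ] Tan m x} (h : IsChange D D' S)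
    {θ : (x : M) → Cotan m x} (hθ : SmoothForm θ) {x : M} (u v : Tan m x) :
    nab1 D' θ x u v = nab1 D θ x u v - θ x (S x v u) := by
  have h1 := nab1_spec D hθ (diffVFAt_fieldAt v) u
  have h2 := nab1_spec D' hθ (diffVFAt_fieldAt v) u
  rw [h _ _ (diffVFAt_fieldAt v), map_add] at h2
  simp only [fieldAt_self] at h1 h2
  linarith

theorem IsChange.nab2_eq [T2Space M] {D D' : Conn m M}
    {S : (x : M) → Tan m x →ₗ[ℝ] Tan m x →ₗ[ℝ] Tan m x} (h : IsChange D D' S)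
    {T : (x : M) → Tan m x →ₗ[ℝ] Tan m x →ₗ[ℝ] ℝ} (hT : SmoothTwo T) {x : M} (u v w : Tan m x) :
    nab2 D' T x u v w = nab2 D T x u v w - T x (S x v u) w - T x v (S x w u) := by
  have h1 := nab2_spec D hT (diffVFAt_fieldAt v) (smoothVF_fieldAt w) u
  have h2 := nab2_spec D' hT (diffVFAt_fieldAt v) (smoothVF_fieldAt w) u
  rw [h _ _ (diffVFAt_fieldAt v), h _ _ (diffVFAt_fieldAt w), map_add, map_add] at h2
  simp only [fieldAt_self, LinearMap.add_apply] at h1 h2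
  linarith

/-- The symmetric product `α(u) A(v) + α(v) A(u)`. -/
def symProd (α : (x : M) → Cotan m x) (A : (x : M) → Tan m x →ₗ[ℝ] Tan m x) (x : M) :
    Tan m x →ₗ[ℝ] Tan m x →ₗ[ℝ] Tan m x :=
  LinearMap.mk₂ ℝ (fun u v => α x u • A x v + α x v • A x u)
    (fun u u' v => by simp only [map_add]; module)
    (fun c u v => by simp only [map_smul, smul_eq_mul]; module)
    (fun u v v' => by simp only [map_add]; module)
    (fun c u v => by simp only [map_smul, smul_eq_mul]; module)

@[simp] theorem symProd_apply (α : (x : M) → Cotan m x) (A : (x : M) → Tan m x →ₗ[ℝ] Tan m x)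
    (x : M) (u v : Tan m x) : symProd α A x u v = α x u • A x v + α x v • A x u := rfl

theorem symProd_comm (α : (x : M) → Cotan m x) (A : (x : M) → Tan m x →ₗ[ℝ] Tan m x)
    (x : M) (u v : Tan m x) : symProd α A x u v = symProd α A x v u := add_comm _ _

theorem smoothBilin_symProd {α : (x : M) → Cotan m x} {A : (x : M) → Tan m x →ₗ[ℝ] Tan m x}
    (hα : SmoothForm α) (hA : SmoothEnd A) : SmoothBilin (symProd α A) := fun X Y hX hY =>
  ((hA Y hY).smul (hα X hX)).add ((hA X hX).smul (hα Y hY))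

/-- The usual formula: the curvature changes by the skew part of `∇S + S ∘ S`, here for `S = α ∨ A`.
It is used for `Υ ∨ id` (projective changes) and for `θ ∨ A` (the correction of the Weyl
contraction). -/
theorem IsChange.Rm_eq [T2Space M] {D D' : Conn m M} (hD : IsAffine D) (hD' : IsAffine D')
    {α : (x : M) → Cotan m x} {A : (x : M) → Tan m x →ₗ[ℝ] Tan m x}
    (hα : SmoothForm α) (hA : SmoothEnd A) (h : IsChange D D' (symProd α A)) {x : M}
    (u v w : Tan m x) :
    Rm D' x u v w = Rm D x u v w
      + (α x w • nabE D A x u v + nab1 D α x u w • A x v + α x v • nabE D A x u w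
        + nab1 D α x u v • A x w + symProd α A x (symProd α A x w v) u)
      - (α x w • nabE D A x v u + nab1 D α x v w • A x u + α x u • nabE D A x v w
        + nab1 D α x v u • A x w + symProd α A x (symProd α A x w u) v) := by
  have hw := smoothVF_fieldAt w
  have key : ∀ u v : Tan m x, D' (fun y => D' (fieldAt w) y (fieldAt v y)) x u
      = D (fun y => D (fieldAt w) y (fieldAt v y)) x u
      + (α x w • nabE D A x u v + nab1 D α x u w • A x v + α x v • nabE D A x u w
        + nab1 D α x u v • A x w + symProd α A x (symProd α A x w v) u)
      + (α x w • A x (D (fieldAt v) x u) + α x (D (fieldAt v) x u) • A x w)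
      + symProd α A x (D (fieldAt w) x u) v + symProd α A x (D (fieldAt w) x v) u := by
    intro u v
    have hv := smoothVF_fieldAt v
    have e1 : (fun y => D' (fieldAt w) y (fieldAt v y))
        = fun y => D (fieldAt w) y (fieldAt v y) + (α y (fieldAt w y) • A y (fieldAt v y)
          + α y (fieldAt v y) • A y (fieldAt w y)) := by
      funext y; exact h _ _ (hw.diff y) _
    have s1 := hw.conn hD hv
    have s2 := (hA _ hv).smul (hα _ hw)
    have s3 := (hA _ hw).smul (hα _ hv)
    rw [e1, h _ _ ((s1.add (s2.add s3)).diff x), conn_add D (s1.diff x) ((s2.add s3).diff x),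
      conn_add D (s2.diff x) (s3.diff x), conn_smul D ((hα _ hw).diff x) ((hA _ hv).diff x),
      conn_smul D ((hα _ hv).diff x) ((hA _ hw).diff x), nabE_spec D hA hv, nabE_spec D hA hw,
      nab1_spec D hα (hw.diff x), nab1_spec D hα (hv.diff x)]
    simp only [fieldAt_self, symProd_apply, map_add, map_smul, LinearMap.add_apply,
      LinearMap.smul_apply]
    module
  rw [Rm_fieldAt hD', Rm_fieldAt hD, key, key, conn_fieldAt_comm hD u v]
  abel

/-- The identity endomorphism field. -/
def idEnd (x : M) : Tan m x →ₗ[ℝ] Tan m x := LinearMap.id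

@[simp] theorem idEnd_apply (x : M) (v : Tan m x) : idEnd x v = v := rfl

theorem smoothEnd_idEnd : SmoothEnd (m := m) (M := M) idEnd := fun _ hX => hX

theorem nabE_idEnd [T2Space M] (D : Conn m M) (x : M) (u v : Tan m x) :
    nabE D idEnd x u v = 0 := by
  have h := nabE_spec D smoothEnd_idEnd (smoothVF_fieldAt v) u (x := x)
  simp only [idEnd_apply, fieldAt_self] at h
  exact left_eq_add.1 (h.trans (add_comm _ _))

/-! ### Projective changes -/

theorem IsProjectiveChange.smooth [T2Space M] {D D' : Conn m M} {Υ : (x : M) → Cotan m x}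
    (h : IsProjectiveChange D D' Υ) : SmoothForm Υ := smoothForm_iff.2 h.1

theorem IsProjectiveChange.isChange {D D' : Conn m M} {Υ : (x : M) → Cotan m x}
    (h : IsProjectiveChange D D' Υ) : IsChange D D' (symProd Υ idEnd) := fun X x hX u => by
  rw [h.2 X x hX u, symProd_apply, idEnd_apply, idEnd_apply]
  abel

/-- The tensor `∇_u Υ (v) - Υ(u) Υ(v)`. -/
def rhoDiff (D : Conn m M) (Υ : (x : M) → Cotan m x) (x : M) : Tan m x →ₗ[ℝ] Tan m x →ₗ[ℝ] ℝ :=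
  nab1 D Υ x - (Υ x).toLinearMap.smulRight (Υ x).toLinearMap

@[simp] theorem rhoDiff_apply (D : Conn m M) (Υ : (x : M) → Cotan m x) (x : M) (u v : Tan m x) :
    rhoDiff D Υ x u v = nab1 D Υ x u v - Υ x u * Υ x v := by
  simp [rhoDiff]

section
variable [T2Space M] {D D' : Conn m M} (hD : IsAffine D) (hD' : IsAffine D')
  {Υ : (x : M) → Cotan m x} (h : IsProjectiveChange D D' Υ)
include hD hD' h

theorem IsProjectiveChange.Rm_eq {x : M} (u v w : Tan m x) :
    Rm D' x u v w = Rm D x u v w + (rhoDiff D Υ x u v - rhoDiff D Υ x v u) • w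
      + rhoDiff D Υ x u w • v - rhoDiff D Υ x v w • u := by
  rw [IsChange.Rm_eq hD hD' h.smooth smoothEnd_idEnd h.isChange]
  simp only [nabE_idEnd, symProd_apply, idEnd_apply, map_add, map_smul, rhoDiff_apply,
    LinearMap.add_apply, LinearMap.smul_apply]
  module

theorem IsProjectiveChange.Ric_eq {x : M} (b d : Tan m x) :
    Ric D' x b d = Ric D x b d + rhoDiff D Υ x d b - (2 * m + 1) * rhoDiff D Υ x b d := by
  have e : ((Rm D' x).flip b).flip d = ((Rm D x).flip b).flip d
      + LinearMap.smulRight ((rhoDiff D Υ x).flip b - rhoDiff D Υ x b) d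
      + LinearMap.smulRight ((rhoDiff D Υ x).flip d) b - rhoDiff D Υ x b d • LinearMap.id := by
    ext1 w
    simp only [LinearMap.flip_apply, LinearMap.add_apply, LinearMap.sub_apply,
      LinearMap.smulRight_apply, LinearMap.smul_apply, LinearMap.id_apply]
    exact h.Rm_eq hD hD' w b d
  rw [Ric_apply, Ric_apply, e, map_sub, map_add, map_add, map_smul, tr_smulRight, tr_smulRight,
    tr_id]
  simp only [LinearMap.flip_apply, LinearMap.sub_apply, smul_eq_mul]
  ring

/-- With `n = 2m`, the Ricci tensor changes by `ρᵀ − (n+1)ρ` for `ρ = ∇Υ − Υ ⊗ Υ`. The weights `n+1`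
and `1` in the Schouten tensor, over `n(n+2)`, invert exactly this combination. -/
theorem IsProjectiveChange.schouten_eq (hm : 1 ≤ m) {x : M} (a b : Tan m x) :
    schouten D' x a b = schouten D x a b - rhoDiff D Υ x a b := by
  have h0 : (m : ℝ) ≠ 0 := by positivity
  have h1 : (2 * m + 2 : ℝ) ≠ 0 := by positivity
  simp only [schouten, ricci_eq hD, ricci_eq hD', h.Ric_eq hD hD']
  field_simp
  ring

/-- The changes of the curvature and of the Schouten tensor cancel. This invariance is what lets one
normalised connection serve every scale. -/
theorem IsProjectiveChange.weyl_eq (hm : 1 ≤ m) {x : M} (a b d : Tan m x) :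
    weyl D' x a b d = weyl D x a b d := by
  simp only [weyl, curvature_eq hD, curvature_eq hD', h.schouten_eq hD hD' hm, h.Rm_eq hD hD']
  module

end

end

section

variable {m : ℕ} {M : Type*} [TopologicalSpace M] [ChartedSpace (Model m) M]
  [IsManifold (𝓡 (2 * m + 1)) ∞ M]

/-! ### The algebra of a contact form -/

/-- The derivative `u(θ(v))`, with `v` extended constantly in the chart. -/
def coordDer (θ : (x : M) → Cotan m x) (x : M) : Tan m x →ₗ[ℝ] Tan m x →ₗ[ℝ] ℝ :=
  ∑ i, LinearMap.smulRight (dlin (fun y => θ y (fieldAt (frame x i) y)) x) (coframe x i).toLinearMap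

/-- The exterior derivative of a 1-form, as a bilinear form. -/
def om (θ : (x : M) → Cotan m x) (x : M) : Tan m x →ₗ[ℝ] Tan m x →ₗ[ℝ] ℝ :=
  coordDer θ x - (coordDer θ x).flip

/-- The bilinear form `dθ + θ ⊗ θ`. -/
def gm (θ : (x : M) → Cotan m x) (x : M) : Tan m x →ₗ[ℝ] Tan m x →ₗ[ℝ] ℝ :=
  om θ x + (θ x).toLinearMap.smulRight (θ x).toLinearMap

theorem om_skew (θ : (x : M) → Cotan m x) (x : M) (u v : Tan m x) : om θ x u v = -om θ x v u := by
  simp [om]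

theorem om_self (θ : (x : M) → Cotan m x) (x : M) (u : Tan m x) : om θ x u u = 0 := by
  simp [om]

theorem gm_apply (θ : (x : M) → Cotan m x) (x : M) (u v : Tan m x) :
    gm θ x u v = om θ x u v + θ x u * θ x v := by
  simp [gm]

theorem coordDer_apply [T2Space M] {θ : (x : M) → Cotan m x} (hθ : SmoothForm θ) (x : M)
    (u v : Tan m x) : coordDer θ x u v = dfun (fun y => θ y (fieldAt v y)) x u := by
  have e : (fun y => θ y (fieldAt v y))
      = fun y => ∑ i, coframe x i v * θ y (fieldAt (frame x i) y) := by
    funext y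
    rw [fieldAt_sum, map_sum]
    simp only [map_smul, smul_eq_mul]
  have hd : ∀ i, DiffFnAt m (fun y => θ y (fieldAt (frame x i) y)) x := fun i =>
    (hθ _ (smoothVF_fieldAt (frame x i))).diff x
  rw [e, dfun_sum _ fun i _ => DiffFnAt.mul mdifferentiableAt_const (hd i)]
  simp only [coordDer, LinearMap.sum_apply, LinearMap.smulRight_apply, LinearMap.smul_apply,
    dlin_apply, smul_eq_mul]
  refine Finset.sum_congr rfl fun i _ => ?_
  rw [dfun_const_mul (hd i)]
  exact mul_comm _ _

theorem om_eq_nab1 [T2Space M] {D : Conn m M} (hD : IsAffine D) {θ : (x : M) → Cotan m x}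
    (hθ : SmoothForm θ) (x : M) (u v : Tan m x) :
    om θ x u v = nab1 D θ x u v - nab1 D θ x v u := by
  have h1 := nab1_spec D hθ (diffVFAt_fieldAt v) u
  have h2 := nab1_spec D hθ (diffVFAt_fieldAt u) v
  rw [conn_fieldAt_comm hD u v] at h1
  rw [fieldAt_self] at h1 h2
  rw [om, LinearMap.sub_apply, LinearMap.sub_apply, LinearMap.flip_apply, coordDer_apply hθ,
    coordDer_apply hθ, h1, h2]
  ring

theorem extDer_eq [T2Space M] {θ : (x : M) → Cotan m x} (hθ : SmoothForm θ) (x : M)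
    (u v : Tan m x) : extDer θ x u v = om θ x u v := by
  have e : ∀ v : Tan m x, (fun y => θ y (extVec v y)) =ᶠ[𝓝 x] fun y => θ y (fieldAt v y) :=
    fun v => by
      filter_upwards [fieldAt_eventuallyEq v] with y hy
      rw [hy]
  rw [extDer, mlieBracket_extVec (mem_dom x), map_zero, sub_zero, dfun_congr (e v),
    dfun_congr (e u), om, LinearMap.sub_apply, LinearMap.sub_apply, LinearMap.flip_apply,
    coordDer_apply hθ, coordDer_apply hθ]

theorem SmoothTwo.om [T2Space M] {D : Conn m M} (hD : IsAffine D) {θ : (x : M) → Cotan m x}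
    (hθ : SmoothForm θ) : SmoothTwo (om θ) := by
  intro X Y hX hY
  simp only [om_eq_nab1 hD hθ]
  exact ContMDiff.sub (SmoothTwo.nab1 hD hθ X Y hX hY) (SmoothTwo.nab1 hD hθ Y X hY hX)

theorem SmoothTwo.gm [T2Space M] {D : Conn m M} (hD : IsAffine D) {θ : (x : M) → Cotan m x}
    (hθ : SmoothForm θ) : SmoothTwo (gm θ) := by
  intro X Y hX hY
  simp only [gm_apply]
  exact ContMDiff.add (SmoothTwo.om hD hθ X Y hX hY) (ContMDiff.mul (hθ X hX) (hθ Y hY))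

/-- The vector `α♯` with `(dθ + θ ⊗ θ)(α♯, ·) = α`. -/
def sharp (θ : (x : M) → Cotan m x) (x : M) (α : Tan m x →ₗ[ℝ] ℝ) : Tan m x :=
  ∑ i, (∑ j, α (frame x j) * (gram θ x)⁻¹ j i) • frame x i

/-- The endomorphism `A` with `(dθ + θ ⊗ θ)(A u, v) = T(u, v)`. -/
def raise (θ : (x : M) → Cotan m x) (x : M) (T : Tan m x →ₗ[ℝ] Tan m x →ₗ[ℝ] ℝ) :
    Tan m x →ₗ[ℝ] Tan m x where
  toFun u := sharp θ x (T u)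
  map_add' u v := by
    simp only [sharp, map_add, LinearMap.add_apply, add_mul, Finset.sum_add_distrib, add_smul]
  map_smul' c u := by
    simp only [sharp, map_smul, LinearMap.smul_apply, smul_eq_mul, mul_assoc, ← Finset.mul_sum,
      mul_smul, ← Finset.smul_sum, RingHom.id_apply]

@[simp] theorem raise_apply (θ : (x : M) → Cotan m x) (x : M)
    (T : Tan m x →ₗ[ℝ] Tan m x →ₗ[ℝ] ℝ) (u : Tan m x) : raise θ x T u = sharp θ x (T u) := rfl

theorem bilin_expand {x : M} (T : Tan m x →ₗ[ℝ] Tan m x →ₗ[ℝ] ℝ) (u v : Tan m x) :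
    T u v = ∑ i, ∑ j, coframe x i u * coframe x j v * T (frame x i) (frame x j) := by
  conv_lhs => rw [← frame_sum x u, ← frame_sum x v]
  simp only [map_sum, map_smul, LinearMap.sum_apply, LinearMap.smul_apply, smul_eq_mul,
    Finset.mul_sum]
  rw [Finset.sum_comm]
  exact Finset.sum_congr rfl fun i _ => Finset.sum_congr rfl fun j _ => by ring

theorem sum_coframe_mul {x : M} (L : Tan m x →ₗ[ℝ] ℝ) (v : Tan m x) :
    ∑ i, coframe x i v * L (frame x i) = L v := by
  conv_rhs => rw [← frame_sum x v]
  simp only [map_sum, map_smul, smul_eq_mul]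

theorem omegaUp_eq (θ : (x : M) → Cotan m x) {x : M} (α β : Cotan m x) :
    omegaUp θ x α β = α (reeb θ x) * β (reeb θ x) - β (sharp θ x α.toLinearMap) := by
  unfold omegaUp sharp
  congr 1
  simp only [map_sum, map_smul, smul_eq_mul, Finset.sum_mul]
  rw [Finset.sum_comm]
  exact Finset.sum_congr rfl fun i _ => Finset.sum_congr rfl fun j _ => by
    rw [ContinuousLinearMap.coe_coe]; ring

/-- Contraction with `ω^{ab}` is evaluation at one vector, and for a contact form that vector lies
in the kernel (`IsContactForm.horizontal_mem`). This is how quantities meaningful only on `H` are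
tested. -/
theorem omegaUp_sum (θ : (x : M) → Cotan m x) {x : M} (α : Cotan m x) (L : Tan m x →ₗ[ℝ] ℝ) :
    ∑ i, omegaUp θ x α (coframe x i) * L (frame x i)
      = L (α (reeb θ x) • reeb θ x - sharp θ x α.toLinearMap) := by
  simp only [omegaUp_eq, sub_mul, Finset.sum_sub_distrib, mul_assoc, ← Finset.mul_sum,
    sum_coframe_mul, map_sub, map_smul, smul_eq_mul]

theorem tr_raise (θ : (x : M) → Cotan m x) {x : M} (T : Tan m x →ₗ[ℝ] Tan m x →ₗ[ℝ] ℝ) :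
    tr (raise θ x T) = ∑ i, T (sharp θ x (coframe x i).toLinearMap) (frame x i) := by
  rw [tr_apply]
  simp only [raise_apply, sharp, map_sum, map_smul, LinearMap.sum_apply, LinearMap.smul_apply,
    smul_eq_mul, ContinuousLinearMap.coe_coe, coframe_frame, ite_mul, mul_ite, one_mul, zero_mul,
    mul_one, mul_zero, Finset.sum_ite_eq, Finset.mem_univ, if_true]
  rw [Finset.sum_comm]
  exact Finset.sum_congr rfl fun i _ => Finset.sum_congr rfl fun j _ => mul_comm _ _

/-- Rewrites the contraction in `λ` through the trace of an endomorphism, whose smoothness is known.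
-/
theorem omegaUp_contract (θ : (x : M) → Cotan m x) {x : M} (T : Tan m x →ₗ[ℝ] Tan m x →ₗ[ℝ] ℝ) :
    ∑ i, ∑ j, omegaUp θ x (coframe x i) (coframe x j) * T (frame x j) (frame x i)
      = T (reeb θ x) (reeb θ x) - tr (raise θ x T) := by
  have h : ∀ i, ∑ j, omegaUp θ x (coframe x i) (coframe x j) * T (frame x j) (frame x i)
      = coframe x i (reeb θ x) * T (reeb θ x) (frame x i)
        - T (sharp θ x (coframe x i).toLinearMap) (frame x i) := fun i =>
    (omegaUp_sum θ (coframe x i) (T.flip (frame x i))).trans (by simp)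
  rw [Finset.sum_congr rfl fun i _ => h i, Finset.sum_sub_distrib, sum_coframe_mul, tr_raise]

/-! ### Determinants -/

theorem contMDiffAt_det {n : ℕ} {A : M → Matrix (Fin n) (Fin n) ℝ} {x : M}
    (hA : ∀ i j, ContMDiffAt (𝓡 (2 * m + 1)) 𝓘(ℝ, ℝ) ∞ (fun y => A y i j) x) :
    ContMDiffAt (𝓡 (2 * m + 1)) 𝓘(ℝ, ℝ) ∞ (fun y => (A y).det) x := by
  simp only [Matrix.det_apply']
  exact contMDiffAt_finsetSum fun σ _ => contMDiffAt_const.mul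
    (contMDiffAt_finsetProd fun i _ => hA (σ i) i)

theorem diffFnAt_prod {ι : Type*} [DecidableEq ι] (s : Finset ι) {f : ι → M → ℝ} {x : M}
    (hf : ∀ i, DiffFnAt m (f i) x) :
    DiffFnAt m (fun y => ∏ i ∈ s, f i y) x ∧ ∀ u : Tan m x, dfun (fun y => ∏ i ∈ s, f i y) x u
      = ∑ i ∈ s, dfun (f i) x u * ∏ j ∈ s.erase i, f j x := by
  induction s using Finset.induction_on with
  | empty => exact ⟨by simpa using mdifferentiableAt_const, fun u => by simp [dfun_const]⟩
  | insert a s ha ih =>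
    simp only [Finset.prod_insert ha]
    refine ⟨DiffFnAt.mul (hf a) ih.1, fun u => ?_⟩
    rw [dfun_mul (hf a) ih.1, ih.2, Finset.sum_insert ha, Finset.erase_insert ha, Finset.mul_sum,
      add_comm]
    congr 1
    refine Finset.sum_congr rfl fun i hi => ?_
    have hia : a ≠ i := fun h => ha (h ▸ hi)
    rw [Finset.erase_insert_of_ne hia, Finset.prod_insert (by simp [ha])]
    ring

/-- Jacobi's formula: differentiate the permutation expansion one column at a time; each diagonal
entry on the right is, by Cramer, the determinant with one column replaced by its derivative. -/
theorem dfun_det {n : ℕ} {A : M → Matrix (Fin n) (Fin n) ℝ} {x : M}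
    (hA : ∀ i j, DiffFnAt m (fun y => A y i j) x) (u : Tan m x) :
    dfun (fun y => (A y).det) x u
      = ((A x).adjugate * Matrix.of fun i j => dfun (fun y => A y i j) x u).trace := by
  simp only [Matrix.det_apply']
  rw [dfun_sum _ fun σ _ => DiffFnAt.mul mdifferentiableAt_const
    (diffFnAt_prod Finset.univ fun i => hA (σ i) i).1]
  have h : ∀ k, ((A x).adjugate * Matrix.of fun i j => dfun (fun y => A y i j) x u) k k
      = ∑ σ : Equiv.Perm (Fin n), ((Equiv.Perm.sign σ : ℤ) : ℝ) *
        (dfun (fun y => A y (σ k) k) x u * ∏ j ∈ Finset.univ.erase k, A x (σ j) j) := fun k => by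
    have h1 : ((A x).adjugate * Matrix.of fun i j => dfun (fun y => A y i j) x u) k k
        = (A x).cramer (fun i => dfun (fun y => A y i k) x u) k := by
      rw [Matrix.cramer_eq_adjugate_mulVec]
      rfl
    rw [h1, Matrix.cramer_apply, Matrix.det_apply']
    refine Finset.sum_congr rfl fun σ _ => ?_
    rw [← Finset.mul_prod_erase Finset.univ _ (Finset.mem_univ k), Matrix.updateCol_self]
    congr 2
    exact Finset.prod_congr rfl fun j hj => Matrix.updateCol_ne (Finset.ne_of_mem_erase hj)
  refine Eq.trans ?_ (((Finset.sum_congr rfl fun k _ => h k).trans Finset.sum_comm).symm)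
  refine Finset.sum_congr rfl fun σ _ => ?_
  rw [dfun_const_mul (diffFnAt_prod Finset.univ fun i => hA (σ i) i).1,
    (diffFnAt_prod Finset.univ fun i => hA (σ i) i).2, Finset.mul_sum]

/-- The matrix of `dθ + θ ⊗ θ` in the coordinate frame of the chart at `x`. -/
def gramAt (θ : (x : M) → Cotan m x) (x y : M) : Matrix (Fin (2 * m + 1)) (Fin (2 * m + 1)) ℝ :=
  Matrix.of fun i j => gm θ y (fieldAt (frame x i) y) (fieldAt (frame x j) y)

theorem gramAt_apply (θ : (x : M) → Cotan m x) (x y : M) (i j : Fin (2 * m + 1)) :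
    gramAt θ x y i j = gm θ y (fieldAt (frame x i) y) (fieldAt (frame x j) y) := rfl

/-- If `A` is skew up to a rank one square and nondegenerate, its determinant is positive. -/
theorem det_pos_of_nonneg {n : ℕ} (A : Matrix (Fin n) (Fin n) ℝ)
    (h : ∀ v : Fin n → ℝ, 0 ≤ v ⬝ᵥ A.mulVec v) (h0 : A.det ≠ 0) : 0 < A.det := by
  -- The segment from `A` to the identity stays nonsingular, as the quadratic form is positive
  -- definite for `s > 0`; the determinant cannot change sign along it.
  have hne : ∀ s ∈ Set.Icc (0 : ℝ) 1, ((1 - s) • A + s • 1).det ≠ 0 := by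
    intro s hs hdet
    rcases hs.1.eq_or_lt with rfl | hs0
    · simp at hdet
      exact h0 hdet
    obtain ⟨v, hv, hv0⟩ := Matrix.exists_mulVec_eq_zero_iff.2 hdet
    have h1 : (1 - s) * (v ⬝ᵥ A.mulVec v) + s * (v ⬝ᵥ v) = 0 := by
      have := congrArg (fun w => v ⬝ᵥ w) hv0
      simpa [Matrix.add_mulVec, Matrix.smul_mulVec, dotProduct_add] using this
    have h2 : 0 < v ⬝ᵥ v := by
      refine lt_of_le_of_ne (Finset.sum_nonneg fun i _ => mul_self_nonneg _) fun h3 => hv ?_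
      exact dotProduct_self_eq_zero.1 h3.symm
    have h3 := mul_nonneg (sub_nonneg.2 hs.2) (h v)
    have h4 := mul_pos hs0 h2
    linarith
  have hcont : ContinuousOn (fun s : ℝ => ((1 - s) • A + s • 1).det) (Set.Icc 0 1) := by
    refine Continuous.continuousOn (Continuous.matrix_det ?_)
    fun_prop
  by_contra hneg
  have h0' : ((1 - (0 : ℝ)) • A + (0 : ℝ) • 1).det = A.det := by simp
  have h1' : ((1 - (1 : ℝ)) • A + (1 : ℝ) • 1).det = 1 := by simp
  have hmem : (0 : ℝ) ∈ Set.Icc ((1 - (0 : ℝ)) • A + (0 : ℝ) • 1).det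
      ((1 - (1 : ℝ)) • A + (1 : ℝ) • 1).det := by
    rw [h0', h1']
    exact ⟨not_lt.1 hneg, zero_le_one⟩
  obtain ⟨s, hs, hs0⟩ := intermediate_value_Icc zero_le_one hcont hmem
  exact hne s hs hs0

/-! ### Nondegeneracy of `dθ + θ ⊗ θ` and the Reeb field -/

section

variable [T2Space M] {H : (x : M) → Submodule ℝ (Tan m x)} {θ : (x : M) → Cotan m x}
  (hθ : IsContactForm H θ)
include hθ

theorem IsContactForm.smoothForm : SmoothForm θ := smoothForm_iff.2 hθ.smooth

/-- Testing against `u` itself removes the skew part and gives `θ(u)² = 0`; then `u ∈ H`, where `dθ`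
is nondegenerate. -/
theorem IsContactForm.gm_nondegenerate {x : M} {u : Tan m x} (h : ∀ v, gm θ x u v = 0) : u = 0 := by
  have h1 := h u
  rw [gm_apply, om_self, zero_add, mul_self_eq_zero] at h1
  refine hθ.nondegenerate x u ((hθ.ker x u).2 h1) fun v _ => ?_
  have h2 := h v
  rwa [gm_apply, h1, zero_mul, add_zero, ← extDer_eq hθ.smoothForm] at h2

theorem IsContactForm.gram_apply (x : M) (i j : Fin (2 * m + 1)) :
    gram θ x i j = gm θ x (frame x i) (frame x j) := by
  rw [gm_apply, ← extDer_eq hθ.smoothForm]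
  rfl

theorem IsContactForm.det_gram_ne_zero (x : M) : (gram θ x).det ≠ 0 := by
  intro h
  obtain ⟨c, hc, h1⟩ := Matrix.exists_vecMul_eq_zero_iff.2 h
  refine hc ?_
  have h2 : (∑ i, c i • frame x i : Tan m x) = 0 := by
    refine hθ.gm_nondegenerate fun v => ?_
    rw [← frame_sum x v]
    simp only [map_sum, map_smul, LinearMap.sum_apply, LinearMap.smul_apply, smul_eq_mul]
    refine Finset.sum_eq_zero fun j _ => ?_
    have h3 := congrFun h1 j
    simp only [Matrix.vecMul, dotProduct, hθ.gram_apply, Pi.zero_apply] at h3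
    rw [h3, mul_zero]
  funext k
  have h3 := congrArg (coframe x k) h2
  simpa [map_sum, coframe_frame] using h3

theorem IsContactForm.gram_mul_inv (x : M) : gram θ x * (gram θ x)⁻¹ = 1 :=
  Matrix.mul_nonsing_inv _ (isUnit_iff_ne_zero.2 (hθ.det_gram_ne_zero x))

theorem IsContactForm.inv_mul_gram (x : M) : (gram θ x)⁻¹ * gram θ x = 1 :=
  Matrix.nonsing_inv_mul _ (isUnit_iff_ne_zero.2 (hθ.det_gram_ne_zero x))

theorem IsContactForm.gm_sharp {x : M} (α : Tan m x →ₗ[ℝ] ℝ) (v : Tan m x) :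
    gm θ x (sharp θ x α) v = α v := by
  suffices h : gm θ x (sharp θ x α) = α by rw [h]
  refine linear_ext_frame fun k => ?_
  simp only [sharp, map_sum, map_smul, LinearMap.sum_apply, LinearMap.smul_apply, smul_eq_mul,
    Finset.sum_mul]
  rw [Finset.sum_comm]
  have h : ∀ j, ∑ i, α (frame x j) * (gram θ x)⁻¹ j i * gm θ x (frame x i) (frame x k)
      = α (frame x j) * (1 : Matrix (Fin (2 * m + 1)) (Fin (2 * m + 1)) ℝ) j k := fun j => by
    rw [← hθ.inv_mul_gram x, Matrix.mul_apply, Finset.mul_sum]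
    exact Finset.sum_congr rfl fun i _ => by rw [hθ.gram_apply, mul_assoc]
  rw [Finset.sum_congr rfl fun j _ => h j]
  simp [Matrix.one_apply]

theorem IsContactForm.gm_ext {x : M} {u u' : Tan m x} (h : ∀ v, gm θ x u v = gm θ x u' v) :
    u = u' :=
  sub_eq_zero.1 (hθ.gm_nondegenerate fun v => by
    rw [map_sub, LinearMap.sub_apply, h, sub_self])

theorem IsContactForm.gm_reeb_right (x : M) (v : Tan m x) : gm θ x v (reeb θ x) = θ x v := by
  suffices h : (gm θ x).flip (reeb θ x) = (θ x).toLinearMap from congrArg (fun L => L v) h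
  refine linear_ext_frame fun k => ?_
  simp only [reeb, map_sum, map_smul, LinearMap.sum_apply, LinearMap.smul_apply, smul_eq_mul,
    Finset.sum_mul, LinearMap.flip_apply]
  rw [Finset.sum_comm]
  have h : ∀ j, ∑ i, (gram θ x)⁻¹ i j * θ x (frame x j) * gm θ x (frame x k) (frame x i)
      = θ x (frame x j) * (1 : Matrix (Fin (2 * m + 1)) (Fin (2 * m + 1)) ℝ) k j := fun j => by
    rw [← hθ.gram_mul_inv x, Matrix.mul_apply, Finset.mul_sum]
    exact Finset.sum_congr rfl fun i _ => by rw [hθ.gram_apply]; ring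
  rw [Finset.sum_congr rfl fun j _ => h j]
  simp [Matrix.one_apply]

/-- Evaluating `(ω + θ ⊗ θ)(·, t) = θ` at `t` gives `θ(t)² = θ(t)`. If `θ(t) = 0` then `t ∈ H` and
`ω(·, t) = θ` vanishes on `H`, so `t = 0` and hence `θ = 0`. -/
theorem IsContactForm.theta_reeb (x : M) : θ x (reeb θ x) = 1 := by
  have h1 := hθ.gm_reeb_right x (reeb θ x)
  rw [gm_apply, om_self, zero_add] at h1
  by_contra hne
  have h0 : θ x (reeb θ x) = 0 := by
    have h2 : θ x (reeb θ x) * (θ x (reeb θ x) - 1) = 0 := by rw [mul_sub, h1, mul_one, sub_self]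
    exact (mul_eq_zero.1 h2).resolve_right (sub_ne_zero.2 hne)
  have h3 : ∀ v, om θ x v (reeb θ x) = θ x v := fun v => by
    have h := hθ.gm_reeb_right x v
    rwa [gm_apply, h0, mul_zero, add_zero] at h
  have h4 : reeb θ x = 0 := by
    refine hθ.nondegenerate x _ ((hθ.ker x _).2 h0) fun v hv => ?_
    rw [extDer_eq hθ.smoothForm, om_skew, h3, (hθ.ker x v).1 hv, neg_zero]
  refine hθ.ne_zero x ?_
  ext v
  rw [← h3, h4, map_zero]
  rfl

theorem IsContactForm.om_reeb (x : M) (v : Tan m x) : om θ x v (reeb θ x) = 0 := by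
  have h := hθ.gm_reeb_right x v
  rwa [gm_apply, hθ.theta_reeb, mul_one, add_eq_right] at h

theorem IsContactForm.om_reeb_left (x : M) (v : Tan m x) : om θ x (reeb θ x) v = 0 := by
  rw [om_skew, hθ.om_reeb, neg_zero]

theorem IsContactForm.gm_reeb_left (x : M) (v : Tan m x) : gm θ x (reeb θ x) v = θ x v := by
  rw [gm_apply, hθ.om_reeb_left, hθ.theta_reeb, one_mul, zero_add]

theorem IsContactForm.theta_sharp {x : M} (α : Tan m x →ₗ[ℝ] ℝ) :
    θ x (sharp θ x α) = α (reeb θ x) := by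
  rw [← hθ.gm_reeb_right, hθ.gm_sharp]

theorem IsContactForm.om_sharp {x : M} (α : Tan m x →ₗ[ℝ] ℝ) (v : Tan m x) :
    om θ x (sharp θ x α) v = α v - α (reeb θ x) * θ x v := by
  have h := hθ.gm_sharp α v
  rw [gm_apply, hθ.theta_sharp] at h
  linarith

theorem IsContactForm.sharp_gm (x : M) (u : Tan m x) : sharp θ x (gm θ x u) = u :=
  hθ.gm_ext fun v => hθ.gm_sharp _ v

/-- The quadratic form of the matrix is `θ(v)² ≥ 0`. Positivity of the determinant is what makes the
real power in `scale` smooth and nonzero. -/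
theorem IsContactForm.det_gram_pos (x : M) : 0 < (gram θ x).det := by
  refine det_pos_of_nonneg _ (fun v => ?_) (hθ.det_gram_ne_zero x)
  have h : v ⬝ᵥ (gram θ x).mulVec v
      = gm θ x (∑ i, v i • frame x i) (∑ i, v i • frame x i) := by
    simp only [Matrix.mulVec, dotProduct, hθ.gram_apply, map_sum, map_smul, LinearMap.sum_apply,
      LinearMap.smul_apply, smul_eq_mul, Finset.mul_sum]
    rw [Finset.sum_comm]
    exact Finset.sum_congr rfl fun i _ => Finset.sum_congr rfl fun j _ => by ring
  rw [h, gm_apply, om_self, zero_add]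
  exact mul_self_nonneg _

theorem IsContactForm.gramAt_self (x : M) : gramAt θ x x = gram θ x := by
  ext i j
  rw [gramAt_apply, fieldAt_self, fieldAt_self, hθ.gram_apply]

/-! ### Smooth raising of indices and the derivative of the determinant -/

section

variable {D : Conn m M} (hD : IsAffine D)
include hD

theorem IsContactForm.contMDiff_gramAt (x : M) (i j : Fin (2 * m + 1)) :
    SmoothFn m (fun y => gramAt θ x y i j) :=
  SmoothTwo.gm hD hθ.smoothForm _ _ (smoothVF_fieldAt _) (smoothVF_fieldAt _)

theorem IsContactForm.contMDiff_det_gramAt (x : M) : SmoothFn m (fun y => (gramAt θ x y).det) :=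
  fun y => contMDiffAt_det fun i j => hθ.contMDiff_gramAt hD x i j y

theorem IsContactForm.det_gramAt_pos (x : M) : ∀ᶠ y in 𝓝 x, 0 < (gramAt θ x y).det := by
  have h : 0 < (gramAt θ x x).det := by rw [hθ.gramAt_self]; exact hθ.det_gram_pos x
  exact (hθ.contMDiff_det_gramAt hD x).continuous.continuousAt.eventually (lt_mem_nhds h)

/-- A vector field is smooth as soon as its contractions with `dθ + θ ⊗ θ` are. -/
theorem IsContactForm.smoothVF_of_gm {X : (x : M) → Tan m x}
    (hX : ∀ Y : (x : M) → Tan m x, SmoothVF Y → SmoothFn m (fun y => gm θ y (X y) (Y y))) :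
    SmoothVF X := by
  intro x
  refine smoothVFAt_of_coef fun i => ?_
  let b : M → Fin (2 * m + 1) → ℝ := fun y j => gm θ y (X y) (fieldAt (frame x j) y)
  have hb : ∀ j, SmoothFn m (fun y => b y j) := fun j => hX _ (smoothVF_fieldAt _)
  -- Cramer's rule writes a coordinate component of `X` as a quotient of smooth functions.
  have h1 : ContMDiffAt (𝓡 (2 * m + 1)) 𝓘(ℝ, ℝ) ∞
      (fun y => ((gramAt θ x y).transpose.updateCol i (b y)).det / (gramAt θ x y).det) x := by
    refine ContMDiffAt.div₀ (contMDiffAt_det fun j k => ?_) (hθ.contMDiff_det_gramAt hD x x)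
      (hθ.det_gramAt_pos hD x).self_of_nhds.ne'
    simp only [Matrix.updateCol_apply, Matrix.transpose_apply]
    split_ifs with hk
    · exact hb j x
    · exact hθ.contMDiff_gramAt hD x k j x
  refine h1.congr_of_eventuallyEq ?_
  filter_upwards [hθ.det_gramAt_pos hD x, coef_sum_eventually (m := m) x] with y hy1 hy2
  have hb' : b y = (gramAt θ x y).transpose.mulVec fun k => coef x k y (X y) := by
    funext j
    simp only [b, Matrix.mulVec, dotProduct, Matrix.transpose_apply, gramAt_apply]
    conv_lhs => rw [← hy2 (X y)]
    simp only [map_sum, map_smul, LinearMap.sum_apply, LinearMap.smul_apply, smul_eq_mul]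
    exact Finset.sum_congr rfl fun k _ => mul_comm _ _
  rw [← Matrix.cramer_apply, Matrix.cramer_eq_adjugate_mulVec, hb', Matrix.mulVec_mulVec,
    Matrix.adjugate_mul, Matrix.smul_mulVec, Matrix.one_mulVec, Matrix.det_transpose,
    Pi.smul_apply, smul_eq_mul, mul_div_cancel_left₀ _ hy1.ne']

theorem IsContactForm.smoothVF_reeb : SmoothVF (reeb θ) :=
  hθ.smoothVF_of_gm hD fun Y hY => by
    simp only [hθ.gm_reeb_left]
    exact hθ.smoothForm Y hY

theorem IsContactForm.smoothEnd_raise {T : (x : M) → Tan m x →ₗ[ℝ] Tan m x →ₗ[ℝ] ℝ}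
    (hT : SmoothTwo T) : SmoothEnd (fun y => raise θ y (T y)) := fun X hX =>
  hθ.smoothVF_of_gm hD fun Y hY => by
    simp only [raise_apply, hθ.gm_sharp]
    exact hT X Y hX hY

theorem IsContactForm.smoothVF_sharp {α : (x : M) → Cotan m x} (hα : SmoothForm α) :
    SmoothVF (fun y => sharp θ y (α y).toLinearMap) :=
  hθ.smoothVF_of_gm hD fun Y hY => by
    simp only [hθ.gm_sharp]
    exact hα Y hY

/-- Jacobi's formula for the determinant of `dθ + θ ⊗ θ` in a coordinate frame. -/
theorem IsContactForm.dfun_det_gramAt (x : M) : ∀ᶠ y in 𝓝 x, ∀ u : Tan m y,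
    dfun (fun z => (gramAt θ x z).det) y u = (gramAt θ x y).det *
      (tr (raise θ y (nab2 D (gm θ) y u))
        + 2 * ∑ i, coef x i y (D (fieldAt (frame x i)) y u)) := by
  filter_upwards [coef_sum_eventually (m := m) x] with y hy u
  rw [dfun_det fun i j => (hθ.contMDiff_gramAt hD x i j).diff y]
  set G := gramAt θ x y with hG
  let B : Matrix (Fin (2 * m + 1)) (Fin (2 * m + 1)) ℝ := Matrix.of fun i k =>
    coef x k y (raise θ y (nab2 D (gm θ) y u) (fieldAt (frame x i) y))
  let C : Matrix (Fin (2 * m + 1)) (Fin (2 * m + 1)) ℝ := Matrix.of fun i k =>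
    coef x k y (D (fieldAt (frame x i)) y u)
  have hl : ∀ (v : Tan m y) (j : Fin (2 * m + 1)), gm θ y v (fieldAt (frame x j) y)
      = ∑ k, coef x k y v * G k j := fun v j => by
    conv_lhs => rw [← hy v]
    simp only [map_sum, map_smul, LinearMap.sum_apply, LinearMap.smul_apply, smul_eq_mul]
    rfl
  have hr : ∀ (v : Tan m y) (j : Fin (2 * m + 1)), gm θ y (fieldAt (frame x j) y) v
      = ∑ k, G j k * coef x k y v := fun v j => by
    conv_lhs => rw [← hy v]
    simp only [map_sum, map_smul, smul_eq_mul]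
    exact Finset.sum_congr rfl fun k _ => mul_comm _ _
  -- The derivative of `G` is the raised covariant derivative acting on `G` plus one Christoffel
  -- term for each slot; the latter two account for the factor 2.
  have hd : (Matrix.of fun i j => dfun (fun z => gramAt θ x z i j) y u)
      = B * G + C * G + G * C.transpose := by
    ext i j
    have h1 := nab2_spec D (SmoothTwo.gm hD hθ.smoothForm)
      ((smoothVF_fieldAt (frame x i)).diff y) (smoothVF_fieldAt (frame x j)) u
    have h2 : nab2 D (gm θ) y u (fieldAt (frame x i) y) (fieldAt (frame x j) y)
        = gm θ y (raise θ y (nab2 D (gm θ) y u) (fieldAt (frame x i) y))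
          (fieldAt (frame x j) y) := by
      rw [raise_apply, hθ.gm_sharp]
    rw [h2, hl, hl, hr] at h1
    exact h1
  rw [hd, Matrix.mul_add, Matrix.mul_add, Matrix.trace_add, Matrix.trace_add,
    Matrix.trace_mul_comm, Matrix.trace_mul_comm _ (C * G), ← Matrix.mul_assoc, Matrix.mul_assoc,
    Matrix.mul_assoc, Matrix.mul_adjugate, Matrix.adjugate_mul, tr_eq_coef_sum hy]
  simp only [Matrix.mul_smul, Matrix.smul_mul, Matrix.mul_one, Matrix.one_mul, Matrix.trace_smul,
    Matrix.trace_transpose, smul_eq_mul]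
  change G.det * B.trace + G.det * C.trace + G.det * C.trace = G.det * (B.trace + 2 * C.trace)
  ring

end

end

end

section

variable {m : ℕ} {M : Type*} [TopologicalSpace M] [ChartedSpace (Model m) M]
  [IsManifold (𝓡 (2 * m + 1)) ∞ M]

/-! ### Scales -/

theorem christoffel_apply (D : Conn m M) (x : M) (u v : Tan m x) :
    christoffel D x u v = D (fieldAt v) x u := by
  rw [← conn_extVec]
  rfl

theorem christoffelTrace_eq (D : Conn m M) (x : M) (u : Tan m x) :
    christoffelTrace D x u = ∑ i, coframe x i (D (fieldAt (frame x i)) x u) := by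
  simp only [christoffelTrace, christoffel_apply]

/-- `frame` as a basis. -/
def frameBasis (x : M) : Module.Basis (Fin (2 * m + 1)) ℝ (Tan m x) :=
  (EuclideanSpace.basisFun (Fin (2 * m + 1)) ℝ).toBasis

theorem coe_frameBasis (x : M) : ⇑(frameBasis (m := m) x) = frame x := by
  funext i
  exact EuclideanSpace.basisFun_apply _ _ i

theorem topForm_apply (x : M) (vol : TopForm m x) (E : Fin (2 * m + 1) → Tan m x) :
    vol E = vol (frame x) * (Matrix.of fun i j => coframe x i (E j)).det := by
  have h := congrArg (fun f => f E) (vol.eq_smul_basis_det (frameBasis (m := m) x))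
  rw [coe_frameBasis] at h
  refine h.trans ?_
  rw [AlternatingMap.smul_apply, Module.Basis.det_apply, smul_eq_mul]
  rfl

theorem topForm_frame_ne_zero {x : M} {vol : TopForm m x} (h : vol ≠ 0) : vol (frame x) ≠ 0 := by
  intro h0
  refine h ?_
  ext E
  rw [topForm_apply, h0, zero_mul]
  rfl

theorem exists_topForm_ne_zero (x : M) : ∃ vol : TopForm m x, vol ≠ 0 :=
  ⟨(frameBasis (m := m) x).det, fun h => by
    have h1 := congrArg (fun f => f (frameBasis (m := m) x)) h
    simp [Module.Basis.det_self] at h1⟩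

theorem scale_apply (θ : (x : M) → Cotan m x) (x : M) (vol : TopForm m x)
    (α : Fin 0 → Cotan m x) (v : Fin 0 → Tan m x) : scale θ x vol α v
      = ((vol (frame x)) ^ 2 / (((m.factorial : ℝ)) ^ 2 * (gram θ x).det)) ^ (1 / (2 * m + 2) : ℝ) :=
  rfl

theorem dfun_comp {f : M → ℝ} {ψ : ℝ → ℝ} {ψ' : ℝ} {x : M} (hψ : HasDerivAt ψ ψ' (f x))
    (hf : DiffFnAt m f x) (u : Tan m x) : dfun (fun y => ψ (f y)) x u = ψ' * dfun f x u := by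
  have h := (hψ.hasFDerivAt.hasMFDerivAt.comp x hf.hasMFDerivAt).mfderiv
  have h1 := congrArg (fun L => L u) h
  refine h1.trans ?_
  exact mul_comm (dfun f x u) ψ'

section

variable [T2Space M] {H : (x : M) → Submodule ℝ (Tan m x)} {θ : (x : M) → Cotan m x}
  (hθ : IsContactForm H θ)
include hθ

theorem IsContactForm.scale_pos {x : M} {vol : TopForm m x} (h : vol ≠ 0)
    (α : Fin 0 → Cotan m x) (v : Fin 0 → Tan m x) : 0 < scale θ x vol α v := by
  have h1 := topForm_frame_ne_zero h
  have h2 := hθ.det_gram_pos x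
  rw [scale_apply]
  positivity

theorem IsContactForm.scale_smul {x : M} (vol : TopForm m x) (c : ℝ)
    (α : Fin 0 → Cotan m x) (v : Fin 0 → Tan m x) :
    scale θ x (c • vol) α v = |c| ^ (2 / (2 * m + 2) : ℝ) * scale θ x vol α v := by
  have h2 := hθ.det_gram_pos x
  rw [scale_apply, scale_apply, AlternatingMap.smul_apply, smul_eq_mul, mul_pow, mul_div_assoc,
    Real.mul_rpow (sq_nonneg c) (by positivity), ← sq_abs c, ← Real.rpow_natCast |c| 2,
    ← Real.rpow_mul (abs_nonneg c)]
  congr 2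
  push_cast
  ring

theorem IsContactForm.gramAt_eq (x y : M) : gramAt θ x y
    = (Matrix.of fun i j => coframe y i (fieldAt (frame x j) y)).transpose * gram θ y *
      (Matrix.of fun i j => coframe y i (fieldAt (frame x j) y)) := by
  ext i j
  rw [gramAt_apply, bilin_expand]
  simp only [Matrix.mul_apply, Matrix.transpose_apply, Matrix.of_apply, hθ.gram_apply,
    Finset.sum_mul]
  rw [Finset.sum_comm]
  exact Finset.sum_congr rfl fun k _ => Finset.sum_congr rfl fun l _ => by ring

variable {D : Conn m M} (hD : IsAffine D)
include hD

/-- Passing to the coordinate frame multiplies both `vol(frame)²` and the determinant by `(det B)²`.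
So along a chart-constant volume form the scale is a constant times a power of the determinant in
the coordinate frame. -/
theorem IsContactForm.scale_extTop (x : M) : ∀ᶠ y in 𝓝 x, ∀ (vol : TopForm m x)
    (α : Fin 0 → Cotan m y) (v : Fin 0 → Tan m y), scale θ y (extTop vol y) α v
      = ((vol (frame x)) ^ 2 / ((m.factorial : ℝ)) ^ 2) ^ (1 / (2 * m + 2) : ℝ)
        * (gramAt θ x y).det ^ (-(1 / (2 * m + 2)) : ℝ) := by
  have he : ∀ᶠ y in 𝓝 x, ∀ i : Fin (2 * m + 1), fieldAt (frame x i) y = extVec (frame x i) y :=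
    Filter.eventually_all.2 fun i => fieldAt_eventuallyEq _
  filter_upwards [hθ.det_gramAt_pos hD x, he, dom_mem_nhds (mem_dom (m := m) x)] with y h1 h2 h3
    vol α v
  set B : Matrix (Fin (2 * m + 1)) (Fin (2 * m + 1)) ℝ :=
    Matrix.of fun i j => coframe y i (fieldAt (frame x j) y) with hB
  have hdet : (gramAt θ x y).det = B.det ^ 2 * (gram θ y).det := by
    rw [hθ.gramAt_eq, Matrix.det_mul, Matrix.det_mul, Matrix.det_transpose]
    ring
  have hvol : vol (frame x) = extTop vol y (frame y) * B.det := by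
    rw [hB, ← topForm_apply y (extTop vol y) fun j => fieldAt (frame x j) y]
    change vol (frame x) = vol fun j => transport x y (fieldAt (frame x j) y)
    congr 1
    funext j
    rw [h2, transport_extVec h3]
  have hB0 : B.det ≠ 0 := fun h => by
    rw [hdet, h] at h1
    simp at h1
  have hg := hθ.det_gram_pos y
  rw [scale_apply, Real.rpow_neg h1.le, ← Real.inv_rpow h1.le,
    ← Real.mul_rpow (by positivity) (by positivity), hvol, hdet]
  congr 1
  field_simp

theorem IsContactForm.contMDiffAt_scale {x : M} (vol : TopForm m x)
    (α : (y : M) → Fin 0 → Cotan m y) (v : (y : M) → Fin 0 → Tan m y) :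
    ContMDiffAt (𝓡 (2 * m + 1)) 𝓘(ℝ, ℝ) ∞ (fun y => scale θ y (extTop vol y) (α y) (v y)) x := by
  have h1 : ContMDiffAt 𝓘(ℝ, ℝ) 𝓘(ℝ, ℝ) ∞ (fun d : ℝ => d ^ (-(1 / (2 * m + 2)) : ℝ))
      (gramAt θ x x).det := by
    rw [contMDiffAt_iff_contDiffAt]
    exact Real.contDiffAt_rpow_const_of_ne (hθ.det_gramAt_pos hD x).self_of_nhds.ne'
  refine ContMDiffAt.congr_of_eventuallyEq (f := fun y =>
    ((vol (frame x)) ^ 2 / ((m.factorial : ℝ)) ^ 2) ^ (1 / (2 * m + 2) : ℝ)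
        * (gramAt θ x y).det ^ (-(1 / (2 * m + 2)) : ℝ))
    (contMDiffAt_const.mul (h1.comp x (hθ.contMDiff_det_gramAt hD x x))) ?_
  filter_upwards [hθ.scale_extTop hD x] with y hy
  exact hy vol _ _

theorem IsContactForm.extTop_self {x : M} (vol : TopForm m x) : extTop vol x = vol := by
  ext E
  change vol (fun i => transport x x (E i)) = vol E
  simp only [transport_self]

/-- By Jacobi's formula the power `−1/(2m+2)` of the determinant produces a trace of `∇(dθ + θ ⊗ θ)`
and a Christoffel trace; the latter is cancelled by the weight term of `nabla`. -/
theorem IsContactForm.nabla_scale {x : M} (vol : TopForm m x)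
    (α : Fin 0 → Cotan m x) (u : Fin 1 → Tan m x) :
    nabla D 2 (scale θ) x vol α u = -(1 / (2 * m + 2)) *
      tr (raise θ x (nab2 D (gm θ) x (u 0))) * scale θ x vol ![] ![] := by
  have hd := (hθ.contMDiff_det_gramAt hD x).diff x
  have hpos := (hθ.det_gramAt_pos hD x).self_of_nhds
  set p : ℝ := 1 / (2 * m + 2) with hp
  set K : ℝ := ((vol (frame x)) ^ 2 / ((m.factorial : ℝ)) ^ 2) ^ p with hK
  have h1 : HasDerivAt (fun d : ℝ => K * d ^ (-p)) (K * (-p * (gramAt θ x x).det ^ (-p - 1)))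
      (gramAt θ x x).det := (Real.hasDerivAt_rpow_const (Or.inl hpos.ne')).const_mul K
  have h2 : (fun y => scale θ y (extTop vol y) (fun i => extCov (α i) y)
      (fun j => extVec (u j.succ) y)) =ᶠ[𝓝 x] fun y => K * (gramAt θ x y).det ^ (-p) := by
    filter_upwards [hθ.scale_extTop hD x] with y hy
    exact hy vol _ _
  have h3 : scale θ x vol ![] ![] = K * (gramAt θ x x).det ^ (-p) := by
    rw [← (hθ.scale_extTop hD x).self_of_nhds vol ![] ![], hθ.extTop_self hD]
  have h4 : (gramAt θ x x).det ^ (-p - 1) * (gramAt θ x x).det = (gramAt θ x x).det ^ (-p) := by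
    rw [← Real.rpow_add_one hpos.ne', sub_add_cancel]
  have h5 := (hθ.dfun_det_gramAt hD x).self_of_nhds (u 0)
  simp only [coef_self] at h5
  unfold nabla
  simp only [Finset.univ_eq_empty, Finset.sum_empty, add_zero, sub_zero]
  rw [dfun_congr h2, dfun_comp (f := fun y => (gramAt θ x y).det) h1 hd, h5, christoffelTrace_eq]
  change _ + _ * scale θ x vol ![] ![] = _
  rw [h3, ← h4]
  have h6 : (2 : ℝ) / (2 * m + 2) = 2 * p := by rw [hp]; ring
  rw [h6]
  ring

/-- A torsion-free connection preserving a scale has symmetric Ricci tensor. -/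
theorem IsContactForm.ric_symm (h : ∀ (x : M) (vol : TopForm m x), vol ≠ 0 → ∀ u : Tan m x,
    nabla D 2 (scale θ) x vol ![] ![u] = 0) (x : M) (u v : Tan m x) :
    Ric D x u v = Ric D x v u := by
  have htr : ∀ (x : M) (u : Tan m x), tr (raise θ x (nab2 D (gm θ) x u)) = 0 := fun x u => by
    obtain ⟨vol, hvol⟩ := exists_topForm_ne_zero (m := m) x
    have h1 := h x vol hvol u
    rw [hθ.nabla_scale hD] at h1
    have h2 := (hθ.scale_pos hvol ![] ![]).ne'
    have h3 : -(1 / (2 * m + 2) : ℝ) ≠ 0 := by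
      have : (0 : ℝ) < 2 * m + 2 := by positivity
      exact neg_ne_zero.2 (one_div_ne_zero this.ne')
    exact ((mul_eq_zero.1 h1).resolve_right h2 |> mul_eq_zero.1).resolve_left h3
  -- Since `∇τ = 0`, the differential of `log det G` is twice the Christoffel trace `F`. Symmetry of
  -- second derivatives makes the derivative of `F` symmetric, which says `tr R = 0`, and this trace
  -- is the skew part of the Ricci tensor.
  let f : M → ℝ := fun z => (gramAt θ x z).det
  have hf : SmoothFn m f := hθ.contMDiff_det_gramAt hD x
  let F : Tan m x → M → ℝ := fun v y =>
    ∑ i, coef x i y (D (fieldAt (frame x i)) y (fieldAt v y))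
  have hZ : ∀ (v : Tan m x) (i : Fin (2 * m + 1)), SmoothVF (fun y =>
    D (fieldAt (frame x i)) y (fieldAt v y)) := fun v i =>
      (smoothVF_fieldAt _).conn hD (smoothVF_fieldAt v)
  have hFd : ∀ v, DiffFnAt m (F v) x := fun v => DiffFnAt.sum _ fun i _ =>
    mdifferentiableAt_coef (mem_dom x) ((hZ v i).diff x) i
  have h1 : ∀ v : Tan m x, (fun y => dfun f y (fieldAt v y)) =ᶠ[𝓝 x]
      fun y => 2 * (f y * F v y) := fun v => by
    filter_upwards [hθ.dfun_det_gramAt hD x] with y hy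
    rw [hy, htr, zero_add]
    ring
  have h2 := dfun_dfun_comm hf u v
  have h3 : ∀ v : Tan m x, dfun f x v = 2 * (f x * F v x) := fun v => by
    have := (h1 v).self_of_nhds
    beta_reduce at this
    rwa [fieldAt_self] at this
  rw [dfun_congr (h1 v), dfun_congr (h1 u), dfun_const_mul (DiffFnAt.mul (hf.diff x) (hFd v)),
    dfun_const_mul (DiffFnAt.mul (hf.diff x) (hFd u)), dfun_mul (hf.diff x) (hFd v),
    dfun_mul (hf.diff x) (hFd u), h3, h3] at h2
  have hpos : 0 < f x := (hθ.det_gramAt_pos hD x).self_of_nhds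
  have h4 : dfun (F v) x u = dfun (F u) x v := by
    refine mul_left_cancel₀ hpos.ne' ?_
    linarith
  have h5 : ∀ u v : Tan m x, dfun (F v) x u
      = ∑ i, coframe x i (D (fun y => D (fieldAt (frame x i)) y (fieldAt v y)) x u)
        - ∑ i, ∑ k, coframe x k (D (fieldAt (frame x i)) x v)
          * coframe x i (D (fieldAt (frame x k)) x u) := fun u v => by
    rw [dfun_sum _ fun i _ => mdifferentiableAt_coef (mem_dom x) ((hZ v i).diff x) i,
      ← Finset.sum_sub_distrib]
    refine Finset.sum_congr rfl fun i _ => ?_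
    rw [dfun_coef D i ((hZ v i).diff x), fieldAt_self]
  have h6 : tr (Rm D x u v) = 0 := by
    rw [h5 u v, h5 v u] at h4
    -- The quadratic Christoffel terms are a trace of a product of two endomorphisms, hence
    -- symmetric in `u` and `v`.
    have h7 : ∑ i, ∑ k, coframe x k (D (fieldAt (frame x i)) x v)
        * coframe x i (D (fieldAt (frame x k)) x u)
        = ∑ i, ∑ k, coframe x k (D (fieldAt (frame x i)) x u)
        * coframe x i (D (fieldAt (frame x k)) x v) := by
      rw [Finset.sum_comm]
      exact Finset.sum_congr rfl fun i _ => Finset.sum_congr rfl fun k _ => mul_comm _ _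
    rw [h7] at h4
    have h8 := sub_left_injective h4
    simp only [tr_apply, Rm_fieldAt hD, map_sub, Finset.sum_sub_distrib]
    exact sub_eq_zero.2 h8
  rw [tr_Rm hD] at h6
  linarith

/-- A density sees the connection only through the Christoffel trace, which changes by the trace of
`S`. -/
theorem IsContactForm.nabla_scale_change {D' : Conn m M}
    {S : (x : M) → Tan m x →ₗ[ℝ] Tan m x →ₗ[ℝ] Tan m x} (h : IsChange D D' S) {x : M}
    (vol : TopForm m x) (u : Tan m x) :
    nabla D' 2 (scale θ) x vol ![] ![u] = nabla D 2 (scale θ) x vol ![] ![u]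
      + 1 / (m + 1) * tr ((S x).flip u) * scale θ x vol ![] ![] := by
  have h1 : christoffelTrace D' x u = christoffelTrace D x u + tr ((S x).flip u) := by
    rw [christoffelTrace_eq, christoffelTrace_eq, tr_apply, ← Finset.sum_add_distrib]
    refine Finset.sum_congr rfl fun i _ => ?_
    rw [h _ _ (diffVFAt_fieldAt _), fieldAt_self, map_add]
    rfl
  have h2 : (2 : ℝ) / (2 * m + 2) = 1 / (m + 1) := by
    have : (m : ℝ) + 1 ≠ 0 := by positivity
    field_simp
  unfold nabla
  simp only [Finset.univ_eq_empty, Finset.sum_empty, add_zero, sub_zero, h2]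
  change _ + _ * christoffelTrace D' x u * scale θ x vol ![] ![]
    = _ + _ * christoffelTrace D x u * scale θ x vol ![] ![] + _
  rw [h1]
  change dfun _ x u + _ = dfun _ x u + _ + _
  ring

/-- The weight is carried by `τ` alone, so the density term goes into `∇τ` and the form is
differentiated without weight. -/
theorem IsContactForm.nabla_scale_mul_one {η : (x : M) → Cotan m x} (hη : SmoothForm η) {x : M}
    (vol : TopForm m x) (u v : Tan m x) :
    nabla D 2 (fun x vol α (v : Fin 1 → Tan m x) => scale θ x vol α ![] * η x (v 0)) x vol ![] ![u, v]
      = nabla D 2 (scale θ) x vol ![] ![u] * η x v + scale θ x vol ![] ![] * nab1 D η x u v := by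
  have h1 : DiffFnAt m (fun y => scale θ y (extTop vol y) ![] ![]) x :=
    (hθ.contMDiffAt_scale hD vol (fun _ => ![]) (fun _ => ![])).mdifferentiableAt (by simp)
  have h2 : DiffFnAt m (fun y => η y (extVec v y)) x :=
    (smoothForm_iff.1 hη x v).mdifferentiableAt (by simp)
  have h3 := nab1_spec D hη (mdifferentiableAt_extVec v) u
  rw [extVec_self] at h3
  have h4 : christoffel D x u v = D (extVec v) x u := rfl
  unfold nabla
  simp only [Finset.univ_eq_empty, Finset.sum_empty, add_zero, sub_zero, Finset.univ_unique,
    Finset.sum_singleton]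
  change dfun (fun y => scale θ y (extTop vol y) ![] ![] * η y (extVec v y)) x u
    - scale θ x vol ![] ![] * η x (christoffel D x u v)
    + 2 / (2 * m + 2) * christoffelTrace D x u * (scale θ x vol ![] ![] * η x v)
    = (dfun (fun y => scale θ y (extTop vol y) ![] ![]) x u
      + 2 / (2 * m + 2) * christoffelTrace D x u * scale θ x vol ![] ![]) * η x v + _
  rw [dfun_mul h1 h2, h3, h4, extVec_self, hθ.extTop_self hD]
  ring

theorem IsContactForm.nabla_scale_mul_two {T : (x : M) → Tan m x →ₗ[ℝ] Tan m x →ₗ[ℝ] ℝ}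
    (hT : SmoothTwo T) {x : M} (vol : TopForm m x) (u v w : Tan m x) :
    nabla D 2 (fun x vol α (v : Fin 2 → Tan m x) => scale θ x vol α ![] * T x (v 0) (v 1))
        x vol ![] ![u, v, w]
      = nabla D 2 (scale θ) x vol ![] ![u] * T x v w
        + scale θ x vol ![] ![] * nab2 D T x u v w := by
  have h1 : DiffFnAt m (fun y => scale θ y (extTop vol y) ![] ![]) x :=
    (hθ.contMDiffAt_scale hD vol (fun _ => ![]) (fun _ => ![])).mdifferentiableAt (by simp)
  have h0 : (fun y => T y (extVec v y) (extVec w y))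
      =ᶠ[𝓝 x] (fun y => T y (fieldAt v y) (fieldAt w y)) := by
    filter_upwards [fieldAt_eventuallyEq v, fieldAt_eventuallyEq w] with y hy hy'
    rw [hy, hy']
  have h2 : DiffFnAt m (fun y => T y (extVec v y) (extVec w y)) x :=
    ((hT _ _ (smoothVF_fieldAt v) (smoothVF_fieldAt w)).diff x).congr_of_eventuallyEq h0
  have h3 := nab2_spec D hT (diffVFAt_fieldAt v) (smoothVF_fieldAt w) u
  rw [← dfun_congr h0, fieldAt_self, fieldAt_self, ← christoffel_apply, ← christoffel_apply] at h3
  unfold nabla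
  simp only [Finset.univ_eq_empty, Finset.sum_empty, add_zero, sub_zero, Fin.sum_univ_two]
  change dfun (fun y => scale θ y (extTop vol y) ![] ![] * T y (extVec v y) (extVec w y)) x u
    - (scale θ x vol ![] ![] * T x (christoffel D x u v) w
      + scale θ x vol ![] ![] * T x v (christoffel D x u w))
    + 2 / (2 * m + 2) * christoffelTrace D x u * (scale θ x vol ![] ![] * T x v w)
    = (dfun (fun y => scale θ y (extTop vol y) ![] ![]) x u
      + 2 / (2 * m + 2) * christoffelTrace D x u * scale θ x vol ![] ![]) * T x v w + _
  rw [dfun_mul h1 h2, h3, extVec_self, extVec_self, hθ.extTop_self hD]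
  ring

theorem IsContactForm.nu_eq {x : M} (a b c : Tan m x) :
    nu D θ x a b c = nab2 D (om θ) x c a b := by
  have hT := SmoothTwo.om hD hθ.smoothForm
  have h0 : (fun y => extDer θ y (extVec a y) (extVec b y))
      =ᶠ[𝓝 x] (fun y => om θ y (fieldAt a y) (fieldAt b y)) := by
    filter_upwards [fieldAt_eventuallyEq a, fieldAt_eventuallyEq b] with y hy hy'
    rw [hy, hy', extDer_eq hθ.smoothForm]
  have h3 := nab2_spec D hT (diffVFAt_fieldAt a) (smoothVF_fieldAt b) c
  rw [← dfun_congr h0, fieldAt_self, fieldAt_self, ← christoffel_apply, ← christoffel_apply] at h3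
  unfold nu nabla
  simp only [Finset.univ_eq_empty, Finset.sum_empty, add_zero, Fin.sum_univ_two, zero_div,
    zero_mul]
  change dfun (fun y => extDer θ y (extVec a y) (extVec b y)) x c
    - (extDer θ x (christoffel D x c a) b + extDer θ x a (christoffel D x c b)) = _
  rw [h3, extDer_eq hθ.smoothForm, extDer_eq hθ.smoothForm]
  ring

theorem IsContactForm.isWeightedTensor_scale_mul {s : ℕ}
    {F : (x : M) → MultilinearMap ℝ (fun _ : Fin s => Tan m x) ℝ}
    (hF : ∀ X : Fin s → (x : M) → Tan m x, (∀ i, SmoothVF (X i)) →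
      SmoothFn m (fun y => F y fun i => X i y)) :
    IsWeightedTensor 2 (fun x vol α (v : Fin s → Tan m x) => scale θ x vol α ![] * F x v :
      WField m M 0 s) := by
  refine ⟨fun x vol c _ _ α v => ?_, fun x vol _ => ?_, fun x vol _ α v => ?_⟩
  · rw [hθ.scale_smul, mul_assoc]
  · refine ⟨MultilinearMap.constOfIsEmpty ℝ _ (scale θ x vol ![] ![] • F x), fun α v => ?_⟩
    rfl
  · refine (hθ.contMDiffAt_scale hD vol _ (fun _ => ![])).mul ?_
    refine (hF (fun i => fieldAt (v i)) (fun i => smoothVF_fieldAt _) x).congr_of_eventuallyEq ?_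
    have he : ∀ᶠ y in 𝓝 x, ∀ i : Fin s, fieldAt (v i) y = extVec (v i) y :=
      Filter.eventually_all.2 fun i => fieldAt_eventuallyEq _
    filter_upwards [he] with y hy
    simp only [hy]

end

end

section

variable {m : ℕ} {M : Type*} [TopologicalSpace M] [ChartedSpace (Model m) M]
  [IsManifold (𝓡 (2 * m + 1)) ∞ M]

/-! ### Vanishing torsion -/

/-- `λ`, as a linear form. -/
def lamL (D : Conn m M) (θ : (x : M) → Cotan m x) (x : M) : Tan m x →ₗ[ℝ] ℝ :=
  ∑ i, ∑ j, omegaUp θ x (coframe x i) (coframe x j) • nab2 D (om θ) x (frame x i) (frame x j)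

/-- `ν°`, as a trilinear form. -/
def nuFreeL (D : Conn m M) (θ : (x : M) → Cotan m x) (x : M) :
    Tan m x →ₗ[ℝ] Tan m x →ₗ[ℝ] Tan m x →ₗ[ℝ] ℝ :=
  LinearMap.mk₂ ℝ (fun a b => ((nab2 D (om θ) x).flip a).flip b + (1 / (2 * m + 1 : ℝ)) •
      ((lamL D θ x b • om θ x a - lamL D θ x a • om θ x b) + (2 * om θ x a b) • lamL D θ x))
    (fun a a' b => by
      ext c
      simp only [map_add, LinearMap.add_apply, LinearMap.smul_apply, LinearMap.sub_apply,
        LinearMap.flip_apply, smul_eq_mul]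
      ring)
    (fun r a b => by
      ext c
      simp only [map_smul, LinearMap.add_apply, LinearMap.smul_apply, LinearMap.sub_apply,
        LinearMap.flip_apply, smul_eq_mul]
      ring)
    (fun a b b' => by
      ext c
      simp only [map_add, LinearMap.add_apply, LinearMap.smul_apply, LinearMap.sub_apply,
        LinearMap.flip_apply, smul_eq_mul]
      ring)
    (fun r a b => by
      ext c
      simp only [map_smul, LinearMap.add_apply, LinearMap.smul_apply, LinearMap.sub_apply,
        LinearMap.flip_apply, smul_eq_mul]
      ring)

theorem nuFreeL_apply (D : Conn m M) (θ : (x : M) → Cotan m x) (x : M) (a b c : Tan m x) :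
    nuFreeL D θ x a b c = nab2 D (om θ) x c a b + (1 / (2 * m + 1 : ℝ)) *
      ((lamL D θ x b * om θ x a c - lamL D θ x a * om θ x b c)
        + 2 * om θ x a b * lamL D θ x c) := by
  simp only [nuFreeL, LinearMap.mk₂_apply, LinearMap.add_apply, LinearMap.smul_apply,
    LinearMap.sub_apply, LinearMap.flip_apply, smul_eq_mul]

section

variable [T2Space M] {H : (x : M) → Submodule ℝ (Tan m x)} {θ : (x : M) → Cotan m x}
  (hθ : IsContactForm H θ)
include hθ

theorem IsContactForm.horizontal_mem {x : M} (α : Cotan m x) :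
    α (reeb θ x) • reeb θ x - sharp θ x α.toLinearMap ∈ H x := by
  rw [hθ.ker, map_sub, map_smul, hθ.theta_reeb, hθ.theta_sharp, smul_eq_mul, mul_one]
  exact sub_self _

variable {D : Conn m M} (hD : IsAffine D)
include hD

theorem IsContactForm.lam_eq {x : M} (b : Tan m x) : lam D θ x b = lamL D θ x b := by
  simp only [lam, lamL, LinearMap.sum_apply, LinearMap.smul_apply, smul_eq_mul, hθ.nu_eq hD]

theorem IsContactForm.nuFree_eq {x : M} (a b c : Tan m x) :
    nuFree D θ x a b c = nuFreeL D θ x a b c := by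
  rw [nuFreeL_apply, nuFree, hθ.lam_eq hD, hθ.lam_eq hD, hθ.lam_eq hD, hθ.nu_eq hD,
    extDer_eq hθ.smoothForm, extDer_eq hθ.smoothForm, extDer_eq hθ.smoothForm]
  ring

theorem IsContactForm.torsionT_eq {x : M} (γ : Cotan m x) (a b : Tan m x) :
    torsionT D θ x γ a b
      = -2 * nuFreeL D θ x a b (γ (reeb θ x) • reeb θ x - sharp θ x γ.toLinearMap) := by
  rw [← omegaUp_sum]
  simp only [torsionT, hθ.nuFree_eq hD]

/-- If the torsion vanishes, then `ν°` vanishes on `H`. -/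
theorem IsContactForm.nuFreeL_eq_zero {x : M}
    (h : ∀ γ, ∀ a ∈ H x, ∀ b ∈ H x, torsionT D θ x γ a b = 0) {a b c : Tan m x}
    (ha : a ∈ H x) (hb : b ∈ H x) (hc : c ∈ H x) : nuFreeL D θ x a b c = 0 := by
  -- Every `c ∈ H` is reached by raising: for `γ = (dθ + θ ⊗ θ)(c, ·)` the contraction evaluates
  -- `ν°` at `−c`.
  have h1 := h (toCotan (gm θ x c)) a ha b hb
  have h2 : (toCotan (gm θ x c)).toLinearMap = gm θ x c := by
    ext v
    exact toCotan_apply _ v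
  rw [hθ.torsionT_eq hD, h2, hθ.sharp_gm, toCotan_apply, hθ.gm_reeb_right, (hθ.ker x c).1 hc,
    zero_smul, zero_sub, map_neg] at h1
  linarith

/-- Raising with `ω^{ab}` evaluates `ν°` at vectors of `H` in all three slots, so the values of the
torsion off `H` never enter. -/
theorem IsContactForm.torsionUp_eq_zero
    (h : ∀ x, ∀ γ, ∀ a ∈ H x, ∀ b ∈ H x, torsionT D θ x γ a b = 0) : torsionUp D θ = 0 := by
  funext x vol α v
  have e : ∀ i j, leviUp θ x vol (α 0) (coframe x i) * leviUp θ x vol (α 1) (coframe x j)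
      * torsionT D θ x (α 2) (frame x i) (frame x j)
      = (scale θ x vol ![] ![])⁻¹ ^ 2 * (-2) * (omegaUp θ x (α 0) (coframe x i)
        * (omegaUp θ x (α 1) (coframe x j) * (nuFreeL D θ x (frame x i)).flip
          ((α 2) (reeb θ x) • reeb θ x - sharp θ x (α 2).toLinearMap) (frame x j))) := fun i j => by
    rw [hθ.torsionT_eq hD, leviUp, leviUp, LinearMap.flip_apply]
    ring
  have e2 : ∀ i, (nuFreeL D θ x (frame x i)).flip
          ((α 2) (reeb θ x) • reeb θ x - sharp θ x (α 2).toLinearMap)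
          ((α 1) (reeb θ x) • reeb θ x - sharp θ x (α 1).toLinearMap)
      = ((nuFreeL D θ x).flip ((α 1) (reeb θ x) • reeb θ x - sharp θ x (α 1).toLinearMap)).flip
          ((α 2) (reeb θ x) • reeb θ x - sharp θ x (α 2).toLinearMap) (frame x i) := fun i => rfl
  simp only [torsionUp, e, ← Finset.mul_sum]
  simp only [omegaUp_sum, e2]
  rw [LinearMap.flip_apply, LinearMap.flip_apply, hθ.nuFreeL_eq_zero hD (h x)
    (hθ.horizontal_mem _) (hθ.horizontal_mem _) (hθ.horizontal_mem _), mul_zero]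
  rfl

end

theorem nabla_zero {r s : ℕ} (D : Conn m M) (w : ℝ) : nabla D w (0 : WField m M r s) = 0 := by
  funext x vol α v
  simp only [nabla, Pi.zero_apply, dfun_const, Finset.sum_const_zero, mul_zero, add_zero, sub_zero]

/-- Each term of `E` is linear in `T^{abc}` and its derivatives. -/
theorem tensorE_eq_zero {D : Conn m M} {θ : (x : M) → Cotan m x} (h : torsionUp D θ = 0)
    (x : M) (vol : TopForm m x) (a b c : Tan m x) : tensorE D θ x vol a b c = 0 := by
  have hU : tensorU D θ = 0 := by
    funext x vol α v
    simp [tensorU, h, nabla_zero]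
  have hV : tensorV D θ = 0 := by
    funext x vol α v
    simp [tensorV, h, nabla_zero]
  have hW : tensorW D θ = 0 := by
    funext x vol α v
    simp [tensorW, h, hV, nabla_zero]
  simp [tensorE, h, hU, hV, hW]

/-! ### Change of contact form -/

theorem det_id_add_smulRight {x : M} (α : Cotan m x) (Z : Tan m x) :
    (Matrix.of fun i j => coframe x i (frame x j + α (frame x j) • Z)).det = 1 + α Z := by
  have h : (Matrix.of fun i j => coframe x i (frame x j + α (frame x j) • Z))
      = 1 + Matrix.replicateCol Unit (fun i => coframe x i Z)
        * Matrix.replicateRow Unit (fun j => α (frame x j)) := by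
    ext i j
    simp only [Matrix.of_apply, map_add, map_smul, coframe_frame, smul_eq_mul, Matrix.add_apply,
      Matrix.one_apply, Matrix.mul_apply, Matrix.replicateCol_apply, Matrix.replicateRow_apply,
      Finset.univ_unique, Finset.sum_singleton]
    ring
  rw [h, Matrix.det_one_add_replicateCol_mul_replicateRow]
  congr 1
  exact (Finset.sum_congr rfl fun i _ => mul_comm _ _).trans (sum_coframe_mul α.toLinearMap Z)

section

variable [T2Space M] {H : (x : M) → Submodule ℝ (Tan m x)} {θ : (x : M) → Cotan m x}
  (hθ : IsContactForm H θ) {f : M → ℝ} (hf : SmoothFn m f)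
include hθ hf

theorem IsContactForm.om_smul (hfθ : IsContactForm H (fun x => f x • θ x)) (x : M)
    (u v : Tan m x) :
    om (fun x => f x • θ x) x u v = f x * om θ x u v + (dfun f x u * θ x v - dfun f x v * θ x u) := by
  have h : ∀ u v : Tan m x, coordDer (fun x => f x • θ x) x u v
      = f x * coordDer θ x u v + dfun f x u * θ x v := fun u v => by
    rw [coordDer_apply hfθ.smoothForm, coordDer_apply hθ.smoothForm]
    have h1 := dfun_mul (hf.diff x) ((hθ.smoothForm _ (smoothVF_fieldAt v)).diff x) u
    rw [fieldAt_self] at h1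
    exact h1
  simp only [om, LinearMap.sub_apply, LinearMap.flip_apply, h]
  ring

/-- Let `X ∈ H` satisfy `ω(X, ·) = df` on `H`. The form for `fθ` is `f` times the form for `θ` after
the rank one changes `u ↦ u + θ(u) Z1` and `v ↦ v + θ(v) Z2`. Their determinants are `1` and `f`;
with `f^(2m+1)` from the scalar this gives the exponent. -/
theorem IsContactForm.det_gram_smul (hfθ : IsContactForm H (fun x => f x • θ x))
    (hpos : ∀ x, 0 < f x) (x : M) :
    (gram (fun x => f x • θ x) x).det = f x ^ (2 * m + 2) * (gram θ x).det := by
  set β : Tan m x →ₗ[ℝ] ℝ := dlin f x - dfun f x (reeb θ x) • (θ x).toLinearMap with hβ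
  have hβt : β (reeb θ x) = 0 := by
    simp [hβ, hθ.theta_reeb]
  set X : Tan m x := sharp θ x β with hX
  have hXθ : θ x X = 0 := by rw [hX, hθ.theta_sharp, hβt]
  have hXω : ∀ v, om θ x X v = β v := fun v => by rw [hX, hθ.om_sharp, hβt, zero_mul, sub_zero]
  have hβv : ∀ v, β v = dfun f x v - dfun f x (reeb θ x) * θ x v := fun v => by simp [hβ]
  have hXf : dfun f x X = 0 := by
    have h := hXω X
    rw [om_self, hβv, hXθ] at h
    linarith
  have h0 := (hpos x).ne'
  set Z1 : Tan m x := (-(f x)⁻¹) • X with hZ1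
  set Z2 : Tan m x := (f x - 1) • reeb θ x - (f x)⁻¹ • X with hZ2
  have hg : ∀ u v : Tan m x, gm (fun x => f x • θ x) x u v
      = f x * gm θ x (u + θ x u • Z1) (v + θ x v • Z2) := fun u v => by
    simp only [gm_apply, hθ.om_smul hf hfθ, hZ1, hZ2, map_add, map_sub, map_smul,
      LinearMap.add_apply, LinearMap.smul_apply, smul_eq_mul, hXθ, hXω, hθ.om_reeb,
      hθ.theta_reeb, om_skew θ x u X, hβv, hXf, _root_.smul_apply]
    field_simp
    ring
  have hgram : gram (fun x => f x • θ x) x = f x •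
      ((Matrix.of fun i j => coframe x i (frame x j + θ x (frame x j) • Z1)).transpose
        * gram θ x * (Matrix.of fun i j => coframe x i (frame x j + θ x (frame x j) • Z2))) := by
    ext i j
    rw [hfθ.gram_apply, hg, bilin_expand, Matrix.smul_apply, smul_eq_mul]
    congr 1
    simp only [Matrix.mul_apply, Matrix.transpose_apply, Matrix.of_apply, hθ.gram_apply,
      Finset.sum_mul]
    rw [Finset.sum_comm]
    exact Finset.sum_congr rfl fun k _ => Finset.sum_congr rfl fun l _ => by ring
  rw [hgram, Matrix.det_smul, Matrix.det_mul, Matrix.det_mul, Matrix.det_transpose,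
    det_id_add_smulRight, det_id_add_smulRight, Fintype.card_fin, hZ1, hZ2, map_smul, map_sub,
    map_smul, map_smul, hXθ, hθ.theta_reeb]
  simp only [smul_eq_mul]
  ring

/-- The exponent `1/(2m+2)` undoes `f^(2m+2)`; thus `τ` is multiplied by `f⁻¹`, which is why `τθ` is
independent of `θ`. -/
theorem IsContactForm.scale_change (hfθ : IsContactForm H (fun x => f x • θ x))
    (hpos : ∀ x, 0 < f x) :
    scale (fun x => f x • θ x) = fun x vol α v => (f x)⁻¹ * scale θ x vol α v := by
  funext x vol α v
  have h0 := hpos x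
  have h1 := hθ.det_gram_pos x
  have h2 : (2 * m + 2 : ℝ) ≠ 0 := by positivity
  have h3 : ((f x)⁻¹ : ℝ) = ((f x)⁻¹ ^ (2 * m + 2)) ^ (1 / (2 * m + 2) : ℝ) := by
    rw [← Real.rpow_natCast, ← Real.rpow_mul (by positivity)]
    push_cast
    rw [mul_one_div_cancel h2, Real.rpow_one]
  rw [scale_apply, scale_apply, hθ.det_gram_smul hf hfθ hpos, h3,
    ← Real.mul_rpow (by positivity) (by positivity)]
  congr 1
  have h4 : (f x)⁻¹ ^ (2 * m + 2) * f x ^ (2 * m + 2) = 1 := by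
    rw [← mul_pow, inv_mul_cancel₀ h0.ne', one_pow]
  have h5 : f x ^ (2 * m + 2) ≠ 0 := pow_ne_zero _ h0.ne'
  rw [inv_pow]
  field_simp

theorem IsContactForm.weightedForm_smul (hfθ : IsContactForm H (fun x => f x • θ x))
    (hpos : ∀ x, 0 < f x) : weightedForm (fun x => f x • θ x) = weightedForm θ := by
  funext x vol α v
  have h0 := (hpos x).ne'
  simp only [weightedForm, hθ.scale_change hf hfθ hpos, _root_.smul_apply, smul_eq_mul]
  field_simp

omit hf in
theorem IsContactForm.nabla_fun_mul_scale {h : M → ℝ} (hh : SmoothFn m h) {D : Conn m M}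
    (hD : IsAffine D) {x : M} (vol : TopForm m x) (u : Tan m x) :
    nabla D 2 (fun x vol α (v : Fin 0 → Tan m x) => h x * scale θ x vol α v) x vol ![] ![u]
      = dfun h x u * scale θ x vol ![] ![] + h x * nabla D 2 (scale θ) x vol ![] ![u] := by
  have h1 : DiffFnAt m (fun y => scale θ y (extTop vol y) ![] ![]) x :=
    (hθ.contMDiffAt_scale hD vol (fun _ => ![]) (fun _ => ![])).mdifferentiableAt (by simp)
  unfold nabla
  simp only [Finset.univ_eq_empty, Finset.sum_empty, add_zero, sub_zero]
  change dfun (fun y => h y * scale θ y (extTop vol y) ![] ![]) x u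
    + 2 / (2 * m + 2) * christoffelTrace D x u * (h x * scale θ x vol ![] ![])
    = _ + h x * (dfun (fun y => scale θ y (extTop vol y) ![] ![]) x u
      + 2 / (2 * m + 2) * christoffelTrace D x u * scale θ x vol ![] ![])
  rw [dfun_mul (hh.diff x) h1, hθ.extTop_self hD]
  ring

end

theorem ContactStructure.k_eq [T2Space M] (C : ContactStructure m M) {θ : (x : M) → Cotan m x}
    (hθ : θ ∈ C.positive) : C.k = weightedForm θ := by
  have h0 := C.nonempty.some_mem
  obtain ⟨f, hf, hpos, rfl⟩ := (C.mem_iff _ h0 θ).1 hθ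
  exact ((C.contact _ h0).weightedForm_smul hf (C.contact _ hθ) hpos).symm

end

section

variable {m : ℕ} {M : Type*} [TopologicalSpace M] [ChartedSpace (Model m) M]

/-! ### Differentiation along curves -/

theorem hasDerivAt_along {f : M → ℝ} {γ : ℝ → M} {t : ℝ} (hf : DiffFnAt m f (γ t))
    (hγ : MDifferentiableAt 𝓘(ℝ, ℝ) (𝓡 (2 * m + 1)) γ t) :
    HasDerivAt (fun s => f (γ s)) (dfun f (γ t) (velocity (m := m) γ t)) t := by
  have h := hf.hasMFDerivAt.comp t hγ.hasMFDerivAt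
  let L : ℝ →L[ℝ] ℝ := (mfderiv (𝓡 (2 * m + 1)) 𝓘(ℝ, ℝ) f (γ t)).comp
    (mfderiv 𝓘(ℝ, ℝ) (𝓡 (2 * m + 1)) γ t)
  have h1 : HasFDerivAt (fun s => f (γ s)) L t := hasMFDerivAt_iff_hasFDerivAt.1 h
  exact h1.hasDerivAt

variable [IsManifold (𝓡 (2 * m + 1)) ∞ M]

/-- By `conn_expand`, the derivative in the direction of the velocity uses only values and
derivatives of components along `γ`. Hence the geodesic condition does not depend on the field that
extends the velocity. -/
theorem conn_along (D : Conn m M) {γ : ℝ → M} {t : ℝ}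
    (hγ : MDifferentiableAt 𝓘(ℝ, ℝ) (𝓡 (2 * m + 1)) γ t) {X Y : (x : M) → Tan m x}
    (hX : DiffVFAt X (γ t)) (hY : DiffVFAt Y (γ t)) (h : ∀ᶠ s in 𝓝 t, X (γ s) = Y (γ s)) :
    D X (γ t) (velocity γ t) = D Y (γ t) (velocity γ t) := by
  rw [conn_expand D hX, conn_expand D hY, h.self_of_nhds]
  refine Finset.sum_congr rfl fun i _ => ?_
  have h1 := hasDerivAt_along (mdifferentiableAt_coef (mem_dom _) hX i) hγ
  have h2 := hasDerivAt_along (mdifferentiableAt_coef (mem_dom _) hY i) hγ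
  have h3 : (fun s => coef (γ t) i (γ s) (Y (γ s))) =ᶠ[𝓝 t]
      fun s => coef (γ t) i (γ s) (X (γ s)) := by
    filter_upwards [h] with s hs
    rw [hs]
  rw [(h1.congr_of_eventuallyEq h3).unique h2]

theorem exists_smoothFn_eventuallyEq [T2Space M] {g : M → ℝ} {x : M}
    (hg : ∀ᶠ y in 𝓝 x, ContMDiffAt (𝓡 (2 * m + 1)) 𝓘(ℝ, ℝ) ∞ g y) :
    ∃ f : M → ℝ, SmoothFn m f ∧ f =ᶠ[𝓝 x] g := by
  obtain ⟨φ, -, hφ⟩ := (SmoothBumpFunction.nhds_basis_tsupport (I := 𝓡 (2 * m + 1)) x).mem_iff.1 hg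
  refine ⟨fun y => φ y • g y, contMDiff_of_tsupport fun y hy => ?_, ?_⟩
  · exact φ.contMDiffAt.smul (hφ (tsupport_smul_subset_left _ _ hy))
  · filter_upwards [φ.eventuallyEq_one] with y hy
    rw [hy, Pi.one_apply, one_smul]

/-- As `g ∘ γ` is locally invertible, `b ∘ (g ∘ γ)⁻¹ ∘ g` extends `b` off the curve, and a bump
function makes it global. It supplies the components of the global field extending a velocity that
the definition of a geodesic demands. -/
theorem exists_smoothFn_along [T2Space M] {γ : ℝ → M} {t : ℝ} (hγ : ContinuousAt γ t) {g : M → ℝ}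
    (hg : ∀ᶠ y in 𝓝 (γ t), ContMDiffAt (𝓡 (2 * m + 1)) 𝓘(ℝ, ℝ) ∞ g y)
    (hc : ∀ᶠ s in 𝓝 t, ContDiffAt ℝ ∞ (fun s => g (γ s)) s)
    (hd : deriv (fun s => g (γ s)) t ≠ 0) {b : ℝ → ℝ} (hb : ∀ᶠ s in 𝓝 t, ContDiffAt ℝ ∞ b s) :
    ∃ f : M → ℝ, SmoothFn m f ∧ ∀ᶠ s in 𝓝 t, f (γ s) = b s := by
  set c : ℝ → ℝ := fun s => g (γ s) with hcdef
  have hct := hc.self_of_nhds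
  have hn : (∞ : WithTop ℕ∞) ≠ 0 := by simp
  have hD : ∀ s, ContDiffAt ℝ ∞ c s → HasDerivAt c (deriv c s) s := fun s hs =>
    (hs.differentiableAt (by simp)).hasDerivAt
  let e := hct.toOpenPartialHomeomorph c ((hD t hct).hasFDerivAt_equiv hd) hn
  have he : ∀ s, e s = c s := fun s => rfl
  have hts : t ∈ e.source := hct.mem_toOpenPartialHomeomorph_source _ hn
  have htt : c t ∈ e.target := e.map_source hts
  have het : e.symm (c t) = t := e.left_inv hts
  have hcont : Filter.Tendsto e.symm (𝓝 (c t)) (𝓝 t) := by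
    have := (e.continuousAt_symm htt).tendsto
    rwa [het] at this
  -- The inverse must be smooth on a neighbourhood, so the derivative must be nonzero near `t` and
  -- not only at `t`.
  have hd' : ∀ᶠ s in 𝓝 t, deriv c s ≠ 0 := by
    have h1 : ContinuousAt (fun s => fderiv ℝ c s 1) t :=
      (hct.fderiv_right (m := 0) (by simp)).continuousAt.clm_apply continuousAt_const
    exact h1.eventually_ne hd
  have hsymm : ∀ᶠ r in 𝓝 (c t), ContDiffAt ℝ ∞ (fun r => b (e.symm r)) r := by
    filter_upwards [hcont.eventually hc, hcont.eventually hb, hcont.eventually hd',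
      e.open_target.mem_nhds htt] with r h1 h2 h3 h4
    exact h2.comp r (e.contDiffAt_symm_deriv h3 h4 (hD _ h1) h1)
  have hgc : ContinuousAt g (γ t) := hg.self_of_nhds.continuousAt
  obtain ⟨f, hf, hfe⟩ := exists_smoothFn_eventuallyEq (m := m) (x := γ t)
    (g := fun y => b (e.symm (g y))) (by
      filter_upwards [hg, hgc.eventually hsymm] with y h1 h2
      exact (contMDiffAt_iff_contDiffAt.2 h2).comp y h1)
  refine ⟨f, hf, ?_⟩
  filter_upwards [hγ.eventually hfe, e.open_source.mem_nhds hts] with s h1 h2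
  rw [h1]
  exact congrArg b (e.left_inv h2)

/-! ### Geodesics -/

theorem IsGeodesicOn.mdifferentiableAt {D : Conn m M} {J : Set ℝ} {γ : ℝ → M}
    (h : IsGeodesicOn D J γ) {t : ℝ} (ht : t ∈ J) :
    MDifferentiableAt 𝓘(ℝ, ℝ) (𝓡 (2 * m + 1)) γ t :=
  (h.2.2.1.contMDiffAt (h.1.mem_nhds ht)).mdifferentiableAt (by simp)

/-- Two connections whose difference on the velocity of a curve is tangent to the curve. -/
theorem IsGeodesicOn.of_change {D D' : Conn m M}
    {S : (x : M) → Tan m x →ₗ[ℝ] Tan m x →ₗ[ℝ] Tan m x} (hS : IsChange D D' S) {J : Set ℝ}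
    {γ : ℝ → M} (h : IsGeodesicOn D J γ) (hc : ∀ t ∈ J, ∃ c : ℝ,
      S (γ t) (velocity γ t) (velocity γ t) = c • velocity (m := m) γ t) :
    IsGeodesicOn D' J γ := by
  refine ⟨h.1, h.2.1, h.2.2.1, fun t ht => ⟨(h.2.2.2 t ht).1, ?_⟩⟩
  obtain ⟨X, hX, hXγ, c, hXc⟩ := (h.2.2.2 t ht).2
  obtain ⟨c', hc'⟩ := hc t ht
  refine ⟨X, hX, hXγ, c + c', ?_⟩
  rw [hS X _ (SmoothVF.diff hX _), hXc, hXγ.self_of_nhds, hc', add_smul]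

theorem IsChange.symm {D D' : Conn m M} {S : (x : M) → Tan m x →ₗ[ℝ] Tan m x →ₗ[ℝ] Tan m x}
    (h : IsChange D D' S) : IsChange D' D (fun x => -S x) := fun X x hX u => by
  rw [h X x hX u, LinearMap.neg_apply, LinearMap.neg_apply, add_neg_cancel_right]

theorem IsProjectiveChange.isGeodesicOn_iff {D D' : Conn m M} {Υ : (x : M) → Cotan m x}
    (h : IsProjectiveChange D D' Υ) (J : Set ℝ) (γ : ℝ → M) :
    IsGeodesicOn D' J γ ↔ IsGeodesicOn D J γ := by
  refine ⟨fun hg => hg.of_change h.isChange.symm fun t _ => ⟨-(2 * Υ (γ t) (velocity γ t)), ?_⟩,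
    fun hg => hg.of_change h.isChange fun t _ => ⟨2 * Υ (γ t) (velocity γ t), ?_⟩⟩
  · rw [LinearMap.neg_apply, LinearMap.neg_apply, symProd_apply, idEnd_apply]
    module
  · rw [symProd_apply, idEnd_apply]
    module

/-- The derivative of `θ(γ')` along a geodesic. -/
theorem IsGeodesicOn.hasDerivAt_form [T2Space M] {D : Conn m M} {θ : (x : M) → Cotan m x}
    (hθ : SmoothForm θ) {γ : ℝ → M} {t : ℝ}
    (hγ : MDifferentiableAt 𝓘(ℝ, ℝ) (𝓡 (2 * m + 1)) γ t) {X : (x : M) → Tan m x} (hX : SmoothVF X)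
    (hXγ : ∀ᶠ s in 𝓝 t, X (γ s) = velocity γ s) :
    HasDerivAt (fun s => θ (γ s) (velocity γ s)) (nab1 D θ (γ t) (velocity γ t) (velocity γ t)
      + θ (γ t) (D X (γ t) (velocity γ t))) t := by
  have h1 := hasDerivAt_along ((hθ X hX).diff (γ t)) hγ
  rw [nab1_spec D hθ (hX.diff _), hXγ.self_of_nhds] at h1
  refine h1.congr_of_eventuallyEq ?_
  filter_upwards [hXγ] with s hs
  rw [hs]

/-- If `∇θ` is skew, geodesics tangent to the kernel of `θ` at one time are so at all times. -/
theorem isCompatible_of_skew [T2Space M] {C : ContactStructure m M} {θ : (x : M) → Cotan m x}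
    (hθ : IsContactForm C.H θ) {D : Conn m M} (hD : IsAffine D)
    (h : ∀ x u, nab1 D θ x u u = 0) : IsCompatible C D := by
  intro J γ hg
  let f : ℝ → ℝ := fun s => θ (γ s) (velocity γ s)
  have hlocal : ∀ t ∈ J, ContinuousAt f t ∧ (f t = 0 → ∀ᶠ s in 𝓝 t, f s = 0) := by
    intro t ht
    obtain ⟨hne, X, hX, hXγ, -⟩ := hg.2.2.2 t ht
    change SmoothVF X at hX
    have hf := IsGeodesicOn.hasDerivAt_form (D := D) hθ.smoothForm (hg.mdifferentiableAt ht) hX hXγ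
    refine ⟨hf.continuousAt, fun hft => ?_⟩
    -- The factor `c` in `∇_{γ'} γ' = c γ'` is given only pointwise. A nonzero velocity component
    -- recovers it near `t` as the continuous quotient `A / B`.
    obtain ⟨i, hi⟩ : ∃ i, coframe (γ t) i (velocity γ t) ≠ 0 := by
      by_contra hcon
      push Not at hcon
      exact hne (coframe_ext fun i => by rw [hcon i, map_zero])
    set x := γ t with hx
    have hγ := (hg.mdifferentiableAt ht).continuousAt
    let Y : (y : M) → Tan m y := fun y => D X y (X y)
    have hY : SmoothVF Y := hX.conn hD hX
    let A : ℝ → ℝ := fun s => coef x i (γ s) (Y (γ s))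
    let B : ℝ → ℝ := fun s => coef x i (γ s) (X (γ s))
    have hA : ContinuousAt A t := ContinuousAt.comp (g := fun y => coef x i y (Y y)) (f := γ)
      (contMDiffAt_coef (mem_dom x) (hY x) i).continuousAt hγ
    have hB : ContinuousAt B t := ContinuousAt.comp (g := fun y => coef x i y (X y)) (f := γ)
      (contMDiffAt_coef (mem_dom x) (hX x) i).continuousAt hγ
    have hB0 : B t ≠ 0 := by
      change coef x i (γ t) (X (γ t)) ≠ 0
      rw [hXγ.self_of_nhds, ← hx, coef_self]
      exact hi
    have hAB : ∀ᶠ s in 𝓝 t, |A s / B s| < |A t / B t| + 1 :=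
      (hA.div hB hB0).abs.eventually_lt continuousAt_const (lt_add_one _)
    -- As `∇θ(γ', γ') = 0`, the function `f = θ(γ')` solves the linear equation `f' = (A/B) f`, as
    -- does zero.
    refine ODE_solution_unique_of_eventually (v := fun s z => A s / B s * z)
      (s := fun _ => Set.univ) (K := Real.toNNReal (|A t / B t| + 1)) (g := fun _ => 0) ?_ ?_ ?_ hft
    · filter_upwards [hAB] with s hs
      refine (LipschitzWith.of_dist_le_mul fun z w => ?_).lipschitzOnWith
      rw [Real.coe_toNNReal _ (by positivity), Real.dist_eq, Real.dist_eq, ← mul_sub, abs_mul]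
      exact mul_le_mul_of_nonneg_right hs.le (abs_nonneg _)
    · filter_upwards [hXγ.eventually_nhds, hB.eventually_ne hB0, hg.1.mem_nhds ht] with s h1 h2 h3
      refine ⟨?_, trivial⟩
      obtain ⟨-, Z, hZ, hZγ, c, hc⟩ := hg.2.2.2 s h3
      have hd := IsGeodesicOn.hasDerivAt_form (D := D) hθ.smoothForm (hg.mdifferentiableAt h3) hX h1
      have h4 : Y (γ s) = c • velocity γ s := by
        rw [← hc, ← conn_along D (X := X) (hg.mdifferentiableAt h3) (hX.diff _) (SmoothVF.diff hZ _)
          (by filter_upwards [h1, hZγ] with r hr1 hr2; rw [hr1, hr2])]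
        change D X (γ s) (X (γ s)) = _
        rw [h1.self_of_nhds]
      have h5 : D X (γ s) (velocity γ s) = c • velocity γ s := by
        rw [← h4, ← h1.self_of_nhds]
      have h6 : A s = c * B s := by
        change coef x i (γ s) (Y (γ s)) = c * coef x i (γ s) (X (γ s))
        rw [h4, map_smul, smul_eq_mul, h1.self_of_nhds]
      rw [h, h5, zero_add, map_smul, smul_eq_mul] at hd
      rw [h6, mul_div_cancel_right₀ _ h2]
      exact hd
    · exact Filter.Eventually.of_forall fun s => ⟨by simpa using hasDerivAt_const s (0 : ℝ), trivial⟩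
  by_cases hex : ∃ t ∈ J, f t = 0
  · left
    obtain ⟨t, ht, hft⟩ := hex
    -- The interval is connected and covered by two disjoint open sets: where `f` vanishes locally
    -- and where it does not vanish.
    have hU : IsOpen {s | ∀ᶠ r in 𝓝 s, f r = 0} := isOpen_setOfPred_eventually_nhds
    have hV : IsOpen {s | s ∈ J ∧ f s ≠ 0} := isOpen_iff_mem_nhds.2 fun s hs => by
      filter_upwards [hg.1.mem_nhds hs.1, (hlocal s hs.1).1.eventually_ne hs.2] with r h1 h2
      exact ⟨h1, h2⟩
    have hsub := hg.2.1.isPreconnected.subset_left_of_subset_union hU hV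
      (Set.disjoint_left.2 fun s h1 h2 => h2.2 (Filter.Eventually.self_of_nhds (p := fun r => f r = 0) h1))
      (fun s hs => (em (f s = 0)).imp (fun h => (hlocal s hs).2 h) fun h => ⟨hs, h⟩)
      ⟨t, ht, (hlocal t ht).2 hft⟩
    exact fun s hs => (hθ.ker _ _).2 (Filter.Eventually.self_of_nhds (p := fun r => f r = 0) (hsub hs))
  · right
    exact fun s hs hmem => hex ⟨s, hs, (hθ.ker _ _).1 hmem⟩

end

section

variable {m : ℕ} {M : Type*} [TopologicalSpace M] [ChartedSpace (Model m) M]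
  [IsManifold (𝓡 (2 * m + 1)) ∞ M]

/-! ### Existence of geodesics -/

/-- Christoffel symbols in the chart at `x`. -/
def gammaSymbol (D : Conn m M) (x : M) (i j k : Fin (2 * m + 1)) (p : Model m) : ℝ :=
  coef x k ((extChartAt (𝓡 (2 * m + 1)) x).symm p)
    (D (fieldAt (frame x i)) ((extChartAt (𝓡 (2 * m + 1)) x).symm p)
      (fieldAt (frame x j) ((extChartAt (𝓡 (2 * m + 1)) x).symm p)))

/-- The geodesic spray in the chart at `x`. -/
def spray (D : Conn m M) (x : M) (z : Model m × Model m) : Model m × Model m :=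
  (z.2, -∑ k, (∑ i, ∑ j, z.2 i * z.2 j * gammaSymbol D x i j k z.1) •
    (EuclideanSpace.single k (1 : ℝ) : Model m))

theorem contDiffOn_gammaSymbol [T2Space M] {D : Conn m M} (hD : IsAffine D) (x : M)
    (i j k : Fin (2 * m + 1)) :
    ContDiffOn ℝ ∞ (gammaSymbol D x i j k) (extChartAt (𝓡 (2 * m + 1)) x).target := by
  have h1 : ContMDiffOn (𝓡 (2 * m + 1)) 𝓘(ℝ, ℝ) ∞ (fun y => coef x k y
      (D (fieldAt (frame x i)) y (fieldAt (frame x j) y))) (dom m x) := fun y hy =>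
    (contMDiffAt_coef hy ((smoothVF_fieldAt (frame x i)).conn hD (smoothVF_fieldAt (frame x j)) y)
      k).contMDiffWithinAt
  have h2 := h1.comp (contMDiffOn_extChartAt_symm (I := 𝓡 (2 * m + 1)) (n := ∞) x) (fun p hp => by
    have := (extChartAt (𝓡 (2 * m + 1)) x).map_target hp
    rwa [extChartAt_source] at this)
  exact contMDiffOn_iff_contDiffOn.1 h2

theorem contDiffOn_spray [T2Space M] {D : Conn m M} (hD : IsAffine D) (x : M) :
    ContDiffOn ℝ ∞ (spray D x) ((extChartAt (𝓡 (2 * m + 1)) x).target ×ˢ Set.univ) := by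
  have hc : ∀ i, ContDiffOn ℝ ∞ (fun z : Model m × Model m => z.2 i)
      ((extChartAt (𝓡 (2 * m + 1)) x).target ×ˢ Set.univ) := fun i =>
    ((EuclideanSpace.proj (𝕜 := ℝ) i : Model m →L[ℝ] ℝ).contDiff.comp contDiff_snd).contDiffOn
  refine contDiffOn_snd.prodMk (ContDiffOn.neg (ContDiffOn.sum fun k _ => ContDiffOn.smul
    (ContDiffOn.sum fun i _ => ContDiffOn.sum fun j _ => ((hc i).mul (hc j)).mul ?_)
    contDiffOn_const))
  exact (contDiffOn_gammaSymbol hD x i j k).comp contDiffOn_fst fun z hz => hz.1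

theorem spray_snd (D : Conn m M) (x : M) (z : Model m × Model m) (k : Fin (2 * m + 1)) :
    (spray D x z).2 k = -∑ i, ∑ j, z.2 i * z.2 j * gammaSymbol D x i j k z.1 := by
  have h : ∀ (a : Fin (2 * m + 1) → ℝ),
      (∑ l, a l • (EuclideanSpace.single l (1 : ℝ) : Model m)) k = a k := fun a => by
    simp [Pi.single_apply]
  change -((∑ l, _ • (EuclideanSpace.single l (1 : ℝ) : Model m)) k) = _
  rw [h]

/-- The geodesic equation in a chart. -/
theorem exists_spray_curve [T2Space M] {D : Conn m M} (hD : IsAffine D) {x : M} {v : Model m}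
    (hv : v ≠ 0) {N : Set M} (hN : N ∈ 𝓝 x) :
    ∃ δ > (0 : ℝ), ∃ c b : ℝ → Model m, c 0 = extChartAt (𝓡 (2 * m + 1)) x x ∧ b 0 = v ∧
      ∀ t ∈ Set.Ioo (-δ) δ, ContDiffAt ℝ ∞ c t ∧ ContDiffAt ℝ ∞ b t ∧ b t ≠ 0 ∧
        c t ∈ (extChartAt (𝓡 (2 * m + 1)) x).target ∧
        (extChartAt (𝓡 (2 * m + 1)) x).symm (c t) ∈ N ∧ HasDerivAt c (b t) t ∧
        HasDerivAt b (spray D x (c t, b t)).2 t := by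
  set φ := extChartAt (𝓡 (2 * m + 1)) x with hφ
  have hopen : IsOpen φ.target := isOpen_extChartAt_target (I := 𝓡 (2 * m + 1)) x
  have hO : IsOpen (φ.target ×ˢ (Set.univ : Set (Model m))) := hopen.prod isOpen_univ
  have hxt : φ x ∈ φ.target := mem_extChartAt_target x
  have hF := contDiffOn_spray hD x
  have hF1 : ContDiffAt ℝ 1 (spray D x) (φ x, v) :=
    (hF.contDiffAt (hO.mem_nhds ⟨hxt, trivial⟩)).of_le (by simp)
  obtain ⟨α, hα0, ε, hε, hα⟩ :=
    hF1.exists_forall_mem_closedBall_exists_eq_forall_mem_Ioo_hasDerivAt₀ 0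
  have hcont : ContinuousAt α 0 := (hα 0 ⟨by linarith, by linarith⟩).continuousAt
  have hsymm : ContinuousAt φ.symm (φ x) := continuousAt_extChartAt_symm x
  have h1 : ∀ᶠ z in 𝓝 (α 0), z.1 ∈ φ.target ∧ φ.symm z.1 ∈ N ∧ z.2 ≠ 0 := by
    rw [hα0]
    have h2 : ∀ᶠ p in 𝓝 (φ x), p ∈ φ.target ∧ φ.symm p ∈ N := by
      refine Filter.Eventually.and (hopen.mem_nhds hxt) (hsymm.eventually ?_)
      rwa [extChartAt_to_inv x]
    filter_upwards [continuousAt_fst.eventually h2, continuousAt_snd.eventually_ne hv] with z h3 h4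
    exact ⟨h3.1, h3.2, h4⟩
  obtain ⟨δ', hδ', hball⟩ := Metric.eventually_nhds_iff_ball.1 (hcont.eventually h1)
  set δ := min (δ' / 2) (ε / 2) with hδ
  have hδ0 : 0 < δ := lt_min (by linarith) (by linarith)
  have hmem : ∀ t ∈ Set.Icc (-δ) δ, t ∈ Set.Ioo (0 - ε) (0 + ε) ∧ t ∈ Metric.ball (0 : ℝ) δ' := by
    intro t ht
    have h3 : δ ≤ δ' / 2 := min_le_left _ _
    have h4 : δ ≤ ε / 2 := min_le_right _ _
    refine ⟨⟨by linarith [ht.1], by linarith [ht.2]⟩, ?_⟩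
    rw [Real.ball_eq_Ioo]
    exact ⟨by linarith [ht.1], by linarith [ht.2]⟩
  -- The local solution inherits smoothness from the smooth spray.
  have hsm : ContDiffOn ℝ ∞ α (Set.Icc (-δ) δ) := by
    refine ODE.contDiffOn_enat_Icc_of_hasDerivWithinAt (n := ⊤) (f := fun _ z => spray D x z)
      (u := φ.target ×ˢ Set.univ) (hF.comp contDiffOn_snd fun z hz => hz.2)
      (fun t ht => (hα t (hmem t ht).1).hasDerivWithinAt)
      (fun t ht => ⟨(hball t (hmem t ht).2).1, trivial⟩)
  refine ⟨δ, hδ0, fun t => (α t).1, fun t => (α t).2, congrArg Prod.fst hα0, congrArg Prod.snd hα0, fun t ht => ?_⟩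
  have ht' := Set.Ioo_subset_Icc_self ht
  have h2 : ContDiffAt ℝ ∞ α t := hsm.contDiffAt (Icc_mem_nhds ht.1 ht.2)
  obtain ⟨h3, h4, h5⟩ := hball t (hmem t ht').2
  have h6 := hα t (hmem t ht').1
  exact ⟨contDiffAt_fst.comp t h2, contDiffAt_snd.comp t h2, h5, h3, h4,
    h6.fst, h6.snd⟩

theorem velocity_chart_symm {x : M} {c : ℝ → Model m} {b : Tan m x} {t : ℝ}
    (ht : c t ∈ (extChartAt (𝓡 (2 * m + 1)) x).target) (hc : HasDerivAt c (b : Model m) t) :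
    velocity (fun s => (extChartAt (𝓡 (2 * m + 1)) x).symm (c s)) t
      = extVec b ((extChartAt (𝓡 (2 * m + 1)) x).symm (c t)) := by
  have h1 : MDifferentiableAt 𝓘(ℝ, Model m) (𝓡 (2 * m + 1))
      (extChartAt (𝓡 (2 * m + 1)) x).symm (c t) :=
    ((contMDiffOn_extChartAt_symm (I := 𝓡 (2 * m + 1)) (n := ∞) x).contMDiffAt
      ((isOpen_extChartAt_target (I := 𝓡 (2 * m + 1)) x).mem_nhds ht)).mdifferentiableAt (by simp)
  have h2 := (h1.hasMFDerivAt.comp t hc.hasFDerivAt.hasMFDerivAt).mfderiv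
  have h3 : (extChartAt (𝓡 (2 * m + 1)) x).symm (c t) ∈ dom m x := by
    have := (extChartAt (𝓡 (2 * m + 1)) x).map_target ht
    rwa [extChartAt_source] at this
  rw [extVec_eq_mfderiv h3, (extChartAt (𝓡 (2 * m + 1)) x).right_inv ht]
  refine (congrArg (fun L => L (1 : ℝ)) h2).trans ?_
  change mfderiv 𝓘(ℝ, Model m) (𝓡 (2 * m + 1)) (extChartAt (𝓡 (2 * m + 1)) x).symm (c t)
    ((1 : ℝ) • (b : Model m)) = _
  rw [one_smul]

/-- The chart solution of the spray equation gives the curve. The remaining work is a global smooth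
field extending its velocity near each time; its components are extended off the curve by means of a
coordinate that moves along it. -/
theorem exists_geodesic [T2Space M] {D : Conn m M} (hD : IsAffine D) (x : M) {v : Tan m x}
    (hv : v ≠ 0) : ∃ J γ, IsGeodesicOn D J γ ∧ (0 : ℝ) ∈ J ∧ γ 0 = x ∧
      (velocity (m := m) γ 0 : Model m) = (v : Model m) := by
  have hN : ∀ᶠ y in 𝓝 x, y ∈ dom m x ∧
      ∀ i : Fin (2 * m + 1), fieldAt (frame x i) y = extVec (frame x i) y :=
    Filter.Eventually.and (dom_mem_nhds (mem_dom (m := m) x))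
      (Filter.eventually_all.2 fun i => fieldAt_eventuallyEq _)
  obtain ⟨δ, hδ, c, b, hc0, hb0, h⟩ := exists_spray_curve hD (v := (v : Model m)) hv hN
  set φ := extChartAt (𝓡 (2 * m + 1)) x with hφ
  set γ : ℝ → M := fun s => φ.symm (c s) with hγ
  have hJ : IsOpen (Set.Ioo (-δ) δ) := isOpen_Ioo
  have hsm : ∀ t ∈ Set.Ioo (-δ) δ, ContMDiffAt 𝓘(ℝ, ℝ) (𝓡 (2 * m + 1)) ∞ γ t := fun t ht => by
    obtain ⟨h1, -, -, h4, -⟩ := h t ht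
    exact ((contMDiffOn_extChartAt_symm (I := 𝓡 (2 * m + 1)) (n := ∞) x).contMDiffAt
      ((isOpen_extChartAt_target (I := 𝓡 (2 * m + 1)) x).mem_nhds h4)).comp t
        (contMDiffAt_iff_contDiffAt.2 h1)
  have hvel : ∀ t ∈ Set.Ioo (-δ) δ, velocity γ t = ∑ i, b t i • fieldAt (frame x i) (γ t) :=
    fun t ht => by
    obtain ⟨-, -, -, h4, h5, h6, -⟩ := h t ht
    refine (velocity_chart_symm h4 h6).trans ((extVec_sum (x := x) (y := γ t) (b t)).trans ?_)
    exact Finset.sum_congr rfl fun i _ => congrArg (fun w => b t i • w) (h5.2 i).symm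
  have hcoef : ∀ t ∈ Set.Ioo (-δ) δ, ∀ w : Tan m (γ t),
      ∑ k, coef x k (γ t) w • fieldAt (frame x k) (γ t) = w := fun t ht w => by
    obtain ⟨-, -, -, -, h5, -⟩ := h t ht
    conv_rhs => rw [← coef_sum h5.1 w]
    exact Finset.sum_congr rfl fun i _ => congrArg _ (h5.2 i)
  have h00 : (0 : ℝ) ∈ Set.Ioo (-δ) δ := ⟨by linarith, hδ⟩
  have hγ0 : γ 0 = x := by
    change φ.symm (c 0) = x
    rw [hc0, extChartAt_to_inv]
  refine ⟨Set.Ioo (-δ) δ, γ, ⟨hJ, Set.ordConnected_Ioo, fun t ht => (hsm t ht).contMDiffWithinAt,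
    fun t ht => ⟨?_, ?_⟩⟩, h00, hγ0, ?_⟩
  · obtain ⟨-, -, h3, h4, h5, h6, -⟩ := h t ht
    intro h0
    refine h3 ?_
    have h7 : extVec (x := x) (b t) (γ t) = 0 := (velocity_chart_symm h4 h6).symm.trans h0
    have h8 := transport_extVec h5.1 (b t)
    rw [h7, map_zero] at h8
    exact h8.symm
  · obtain ⟨h1, h2, h3, h4, h5, h6, h7⟩ := h t ht
    -- The coordinate `k` has nonzero speed at `t` and plays the role of the parameter in
    -- `exists_smoothFn_along`.
    obtain ⟨k, hk⟩ : ∃ k, b t k ≠ 0 := by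
      by_contra hcon
      push Not at hcon
      exact h3 (PiLp.ext hcon)
    have hcγ : ∀ s ∈ Set.Ioo (-δ) δ, φ (γ s) = c s := fun s hs => φ.right_inv (h s hs).2.2.2.1
    have hev : ∀ᶠ s in 𝓝 t, s ∈ Set.Ioo (-δ) δ := hJ.mem_nhds ht
    have hproj : ∀ {e : ℝ → Model m} {s : ℝ} (i : Fin (2 * m + 1)), ContDiffAt ℝ ∞ e s →
        ContDiffAt ℝ ∞ (fun r => e r i) s := fun {e s} i he =>
      (EuclideanSpace.proj (𝕜 := ℝ) i : Model m →L[ℝ] ℝ).contDiff.contDiffAt.comp s he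
    have hprojd : ∀ {e : ℝ → Model m} {e' : Model m} {s : ℝ} (i : Fin (2 * m + 1)),
        HasDerivAt e e' s → HasDerivAt (fun r => e r i) (e' i) s := fun {e e' s} i he =>
      (EuclideanSpace.proj (𝕜 := ℝ) i : Model m →L[ℝ] ℝ).hasFDerivAt.comp_hasDerivAt s he
    have hgc : (fun s => φ (γ s) k) =ᶠ[𝓝 t] fun s => c s k := by
      filter_upwards [hev] with s hs
      rw [hcγ s hs]
    have key : ∀ i, ∃ f : M → ℝ, SmoothFn m f ∧ ∀ᶠ s in 𝓝 t, f (γ s) = b s i := fun i => by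
      refine exists_smoothFn_along (hsm t ht).continuousAt (g := fun y => φ y k) ?_ ?_ ?_ ?_
      · filter_upwards [dom_mem_nhds h5.1] with y hy
        exact (EuclideanSpace.proj (𝕜 := ℝ) k : Model m →L[ℝ] ℝ).contMDiff.contMDiffAt.comp y
          (contMDiffAt_chart hy)
      · filter_upwards [hgc.eventually_nhds, hev] with s hs1 hs2
        exact (hproj k (h s hs2).1).congr_of_eventuallyEq hs1
      · rw [hgc.deriv_eq, (hprojd k h6).deriv]
        exact hk
      · filter_upwards [hev] with s hs
        exact hproj i (h s hs).2.1
    choose f hf hfb using key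
    have hE : ∀ i : Fin (2 * m + 1), SmoothVF (m := m) (fieldAt (frame x i)) := fun i => smoothVF_fieldAt _
    have hX : SmoothVF (fun y => ∑ i : Fin (2 * m + 1), f i y • fieldAt (frame x i) y) :=
      SmoothVF.sum fun i _ => SmoothVF.smul (hf i) (hE i)
    have hXγ : ∀ᶠ s in 𝓝 t, ∑ i : Fin (2 * m + 1), f i (γ s) • fieldAt (frame x i) (γ s) = velocity γ s := by
      filter_upwards [Filter.eventually_all.2 hfb, hev] with s hs1 hs2
      rw [hvel s hs2]
      simp only [hs1]
    -- The spray gives an affine parametrisation, so the factor of proportionality is zero.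
    refine ⟨_, hX, hXγ, 0, ?_⟩
    have hfd : ∀ i, dfun (f i) (γ t) (velocity (m := m) γ t) = (spray D x (c t, b t)).2 i := fun i => by
      have e1 := hasDerivAt_along (m := m) ((hf i).diff (γ t))
        ((hsm t ht).mdifferentiableAt (by simp))
      exact (e1.congr_of_eventuallyEq (f₁ := fun s => b s i) (by
        filter_upwards [hfb i] with s hs
        rw [hs])).unique (hprojd i h7)
    rw [conn_sum D _ fun i _ => DiffVFAt.smul ((hf i).diff _) ((hE i).diff _), zero_smul]
    have hterm : ∀ i : Fin (2 * m + 1), D (fun y => f i y • fieldAt (frame x i) y) (γ t) (velocity γ t)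
        = ∑ k, (∑ j, b t i * b t j * gammaSymbol D x i j k (c t)) • fieldAt (frame x k) (γ t)
          + (-∑ j, ∑ l, b t j * b t l * gammaSymbol D x j l i (c t)) •
            fieldAt (frame x i) (γ t) := fun i => by
      rw [conn_smul D ((hf i).diff _) ((hE i).diff _), hfd, spray_snd, (hfb i).self_of_nhds]
      congr 1
      have e2 : D (fieldAt (frame x i)) (γ t) (velocity γ t)
          = ∑ j, b t j • D (fieldAt (frame x i)) (γ t) (fieldAt (frame x j) (γ t)) := by
        rw [hvel t ht, map_sum]
        simp only [map_smul]
      rw [e2]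
      have e3 : ∀ j, D (fieldAt (frame x i)) (γ t) (fieldAt (frame x j) (γ t))
          = ∑ k, gammaSymbol D x i j k (c t) • fieldAt (frame x k) (γ t) := fun j =>
        (hcoef t ht _).symm
      simp only [e3, Finset.smul_sum, Finset.sum_smul, smul_smul]
      rw [Finset.sum_comm]
      exact Finset.sum_congr rfl fun k _ => Finset.sum_congr rfl fun j _ => by rw [mul_assoc]
    rw [Finset.sum_congr rfl fun i _ => hterm i, Finset.sum_add_distrib, Finset.sum_comm]
    simp only [← Finset.sum_smul, neg_smul, Finset.sum_neg_distrib]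
    exact add_neg_cancel _
  · obtain ⟨-, -, -, h4, -, h6, -⟩ := h 0 h00
    have h7 := velocity_chart_symm h4 h6
    have h8 : ∀ y : M, y = x → (extVec (x := x) (b 0) y : Model m) = b 0 := by
      rintro y rfl
      exact extVec_self _
    exact (h7.trans (h8 _ hγ0)).trans hb0

end

section

variable {m : ℕ} {M : Type*} [TopologicalSpace M] [ChartedSpace (Model m) M]
  [IsManifold (𝓡 (2 * m + 1)) ∞ M]

/-! ### Consequences of the existence of geodesics -/

/-- The geodesic starting in the direction `v` stays tangent to `H`. Differentiating `θ(γ') = 0`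
leaves `∇θ(v, v)`, because `θ` kills an acceleration proportional to the velocity. -/
theorem IsCompatible.nab1_self [T2Space M] {C : ContactStructure m M} {θ : (x : M) → Cotan m x}
    (hθ : IsContactForm C.H θ) {D : Conn m M} (hD : IsAffine D) (h : IsCompatible C D) {x : M}
    {v : Tan m x} (hv : v ∈ C.H x) : nab1 D θ x v v = 0 := by
  rcases eq_or_ne v 0 with rfl | hv0
  · simp
  obtain ⟨J, γ, hg, h0, rfl, hvel⟩ := exists_geodesic hD x hv0
  replace hvel : velocity γ 0 = v := hvel
  have hJ : ∀ t ∈ J, velocity γ t ∈ C.H (γ t) := (h J γ hg).resolve_right fun hcon =>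
    hcon 0 h0 (by rwa [hvel])
  obtain ⟨-, X, hX, hXγ, c, hc⟩ := hg.2.2.2 0 h0
  have hd := IsGeodesicOn.hasDerivAt_form (D := D) hθ.smoothForm (hg.mdifferentiableAt h0) hX hXγ
  have h1 : (fun s => θ (γ s) (velocity γ s)) =ᶠ[𝓝 0] fun _ => (0 : ℝ) := by
    filter_upwards [hg.1.mem_nhds h0] with s hs
    exact (hθ.ker _ _).1 (hJ s hs)
  have h2 := hd.unique ((hasDerivAt_const (0 : ℝ) (0 : ℝ)).congr_of_eventuallyEq h1)
  have h3 : θ (γ 0) (velocity γ 0) = 0 := h1.self_of_nhds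
  rw [hc, map_smul, h3, smul_zero, add_zero, hvel] at h2
  exact h2

/-- The difference of two connections. -/
def connDiff (D D' : Conn m M) (x : M) : Tan m x →ₗ[ℝ] Tan m x →ₗ[ℝ] Tan m x :=
  ∑ i, (coframe x i).toLinearMap.smulRight
    ((D' (fieldAt (frame x i)) x).toLinearMap - (D (fieldAt (frame x i)) x).toLinearMap)

theorem isChange_connDiff (D D' : Conn m M) : IsChange D D' (connDiff D D') := by
  intro X x hX u
  rw [conn_expand D hX, conn_expand D' hX]
  simp only [connDiff, LinearMap.sum_apply, LinearMap.smulRight_apply, LinearMap.smul_apply,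
    LinearMap.sub_apply, ← Finset.sum_add_distrib]
  refine Finset.sum_congr rfl fun i _ => ?_
  simp only [ContinuousLinearMap.coe_coe]
  module

/-- A symmetric bilinear map with `S(v,v)` proportional to `v` is `σ ∨ id`. -/
theorem symmetric_eq_of_self_proportional {x : M} {S : Tan m x →ₗ[ℝ] Tan m x →ₗ[ℝ] Tan m x}
    (hsymm : ∀ u v, S u v = S v u) (h : ∀ v, ∃ c : ℝ, S v v = c • v) (u v : Tan m x) :
    S u v = (1 / (2 * m + 2) : ℝ) • (tr (S u) • v + tr (S v) • u) := by
  -- Proportionality is the cubic identity `S(v,v) ∧ v = 0`. It is polarised to three arguments, and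
  -- one of them is then contracted to extract the traces.
  have hP : ∀ (i j : Fin (2 * m + 1)) (v : Tan m x),
      coframe x i (S v v) * coframe x j v = coframe x j (S v v) * coframe x i v := fun i j v => by
    obtain ⟨c, hc⟩ := h v
    rw [hc, map_smul, map_smul, smul_eq_mul, smul_eq_mul]
    ring
  have hpol : ∀ (i j : Fin (2 * m + 1)) (u v w : Tan m x),
      coframe x i (S u v) * coframe x j w + coframe x i (S v w) * coframe x j u
        + coframe x i (S u w) * coframe x j v
      = coframe x j (S u v) * coframe x i w + coframe x j (S v w) * coframe x i u
        + coframe x j (S u w) * coframe x i v := fun i j u v w => by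
    have h1 := hP i j (u + v + w)
    have h2 := hP i j (u + v)
    have h3 := hP i j (u + w)
    have h4 := hP i j (v + w)
    have h5 := hP i j u
    have h6 := hP i j v
    have h7 := hP i j w
    simp only [map_add, LinearMap.add_apply, hsymm v u, hsymm w u, hsymm w v] at h1 h2 h3 h4
    linarith
  refine coframe_ext fun j => ?_
  have hs : ∑ i, (coframe x i (S u v) * coframe x j (frame x i)
      + coframe x i (S v (frame x i)) * coframe x j u
        + coframe x i (S u (frame x i)) * coframe x j v)
      = ∑ i, (coframe x j (S u v) * coframe x i (frame x i)
        + coframe x j (S v (frame x i)) * coframe x i u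
        + coframe x j (S u (frame x i)) * coframe x i v) :=
    Finset.sum_congr rfl fun i _ => hpol i j u v (frame x i)
  have e1 : ∑ i, coframe x i (S u v) * coframe x j (frame x i) = coframe x j (S u v) :=
    sum_coframe_mul (coframe x j).toLinearMap _
  have e2 : ∀ a b : Tan m x, ∑ i, coframe x j (S a (frame x i)) * coframe x i b
      = coframe x j (S a b) := fun a b =>
    (Finset.sum_congr rfl fun i _ => mul_comm _ _).trans
      (sum_coframe_mul ((coframe x j).toLinearMap ∘ₗ S a) b)
  have e3 : ∑ i, coframe x i (frame x i) = (2 * m + 1 : ℝ) := tr_id x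
  simp only [Finset.sum_add_distrib, ← Finset.sum_mul, ← Finset.mul_sum] at hs
  rw [e1, e2, e2, e3, ← tr_apply, ← tr_apply, hsymm v u] at hs
  rw [map_smul, map_add, map_smul, map_smul]
  simp only [smul_eq_mul]
  have h0 : (2 * m + 2 : ℝ) ≠ 0 := by positivity
  field_simp
  linarith

/-- A common geodesic in each direction shows that the difference tensor sends `(v, v)` to a
multiple of `v`; so it is `Υ ∨ id`, with `Υ` a multiple of its trace and hence smooth. -/
theorem exists_projectiveChange [T2Space M] {D D' : Conn m M} (hD : IsAffine D)
    (h : D' ∈ projectiveClass D) : ∃ Υ, IsProjectiveChange D D' Υ := by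
  have hD' : IsAffine D' := h.1
  have hS := isChange_connDiff D D'
  set S := connDiff D D' with hSdef
  have hspec : ∀ (X Y : (x : M) → Tan m x) (x : M), SmoothVF X →
      S x (X x) (Y x) = D' X x (Y x) - D X x (Y x) := fun X Y x hX => by
    rw [hS X x (hX.diff x), add_sub_cancel_left]
  have hsymm : ∀ (x : M) (u v : Tan m x), S x u v = S x v u := fun x u v => by
    have h1 := hspec (fieldAt u) (fieldAt v) x (smoothVF_fieldAt u)
    have h2 := hspec (fieldAt v) (fieldAt u) x (smoothVF_fieldAt v)
    simp only [fieldAt_self] at h1 h2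
    rw [h1, h2, conn_fieldAt_comm hD', conn_fieldAt_comm hD]
  have hprop : ∀ (x : M) (v : Tan m x), ∃ c : ℝ, S x v v = c • v := by
    intro x v
    rcases eq_or_ne v 0 with rfl | hv0
    · exact ⟨0, by simp⟩
    obtain ⟨J, γ, hg, h0, rfl, hvel⟩ := exists_geodesic hD x hv0
    replace hvel : velocity γ 0 = v := hvel
    obtain ⟨-, X, hX, hXγ, c, hc⟩ := hg.2.2.2 0 h0
    obtain ⟨-, Y, hY, hYγ, c', hc'⟩ := ((h.2 J γ).2 hg).2.2.2 0 h0
    refine ⟨c' - c, ?_⟩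
    rw [conn_along D' (Y := X) (hg.mdifferentiableAt h0) (SmoothVF.diff hY _) (SmoothVF.diff hX _)
      (by filter_upwards [hXγ, hYγ] with s h1 h2; rw [h1, h2]),
      hS X _ (SmoothVF.diff hX _), hc, hXγ.self_of_nhds, hvel] at hc'
    rw [sub_smul, ← hc', add_sub_cancel_left]
  have hσ : ∀ x, ∀ u v : Tan m x, S x u v
      = (1 / (2 * m + 2) : ℝ) • (tr (S x u) • v + tr (S x v) • u) := fun x =>
    symmetric_eq_of_self_proportional (hsymm x) (hprop x)
  let Υ : (x : M) → Cotan m x := fun x => toCotan ((1 / (2 * m + 2) : ℝ) • (tr ∘ₗ S x))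
  have hΥ : ∀ (x : M) (u : Tan m x), Υ x u = 1 / (2 * m + 2) * tr (S x u) := fun x u => by
    simp [Υ]
  refine ⟨Υ, smoothForm_iff.1 fun X hX => ?_, fun X x hX u => ?_⟩
  · simp only [hΥ]
    refine contMDiff_const.mul (smoothFn_tr (A := fun y => S y (X y)) fun Y hY => ?_)
    simp only [hspec X Y _ hX]
    exact (hX.conn hD' hY).sub (hX.conn hD hY)
  · rw [hS X x hX, hσ, hΥ, hΥ]
    module

/-- The change of `∇_u u` is `2 Υ(u) u`, from which `Υ(u)` is read off. Uniqueness is what makes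
independently chosen `Υ` add up under composition. -/
theorem IsProjectiveChange.unique [T2Space M] {D D' : Conn m M} {Υ Υ' : (x : M) → Cotan m x}
    (h : IsProjectiveChange D D' Υ) (h' : IsProjectiveChange D D' Υ') : Υ = Υ' := by
  funext x
  ext u
  have h1 := h.2 _ x (diffVFAt_fieldAt u) u
  rw [h'.2 _ x (diffVFAt_fieldAt u) u, add_assoc, add_assoc, add_right_inj, fieldAt_self,
    ← two_smul ℝ, ← two_smul ℝ, smul_right_inj two_ne_zero] at h1
  rcases eq_or_ne u 0 with rfl | hu
  · simp
  · exact (smul_left_injective ℝ hu h1).symm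

theorem IsProjectiveChange.trans {D D' D'' : Conn m M} {Υ Υ' : (x : M) → Cotan m x}
    (h : IsProjectiveChange D D' Υ) (h' : IsProjectiveChange D' D'' Υ') :
    IsProjectiveChange D D'' (fun x => Υ x + Υ' x) := by
  refine ⟨fun x v => (h.1 x v).add (h'.1 x v), fun X x hX u => ?_⟩
  rw [h'.2 X x hX, h.2 X x hX, _root_.add_apply, _root_.add_apply]
  module

theorem IsProjectiveChange.projectiveClass_eq {D D' : Conn m M}
    {Υ : (x : M) → Cotan m x} (h : IsProjectiveChange D D' Υ) :
    projectiveClass D' = projectiveClass D := by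
  ext D''
  simp only [projectiveClass, Set.mem_ofPred_eq, h.isGeodesicOn_iff]

end

section

variable {m : ℕ} {M : Type*} [TopologicalSpace M] [ChartedSpace (Model m) M]
  [IsManifold (𝓡 (2 * m + 1)) ∞ M]

/-! ### Connections adapted to a contact form -/

theorem smoothFn_nab2 [T2Space M] {D : Conn m M} (hD : IsAffine D)
    {T : (x : M) → Tan m x →ₗ[ℝ] Tan m x →ₗ[ℝ] ℝ} (hT : SmoothTwo T)
    {U X Y : (x : M) → Tan m x} (hU : SmoothVF U) (hX : SmoothVF X) (hY : SmoothVF Y) :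
    SmoothFn m (fun y => nab2 D T y (U y) (X y) (Y y)) := by
  have h : (fun y => nab2 D T y (U y) (X y) (Y y)) = fun y => dfun (fun z => T z (X z) (Y z)) y (U y)
      - T y (D X y (U y)) (Y y) - T y (X y) (D Y y (U y)) := by
    funext y
    rw [nab2_spec D hT (hX.diff y) hY]
    ring
  rw [h]
  exact ContMDiff.sub (ContMDiff.sub (smoothFn_dfun (hT X Y hX hY) hU)
    (hT _ Y (hX.conn hD hU) hY)) (hT X _ hX (hY.conn hD hU))

theorem smoothEnd_smulRight {α : (x : M) → Cotan m x} (hα : SmoothForm α) {X : (x : M) → Tan m x}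
    (hX : SmoothVF X) : SmoothEnd (fun y => (α y).toLinearMap.smulRight (X y)) := fun Y hY =>
  hX.smul (hα Y hY)

theorem SmoothEnd.add {A B : (x : M) → Tan m x →ₗ[ℝ] Tan m x} (hA : SmoothEnd A)
    (hB : SmoothEnd B) : SmoothEnd (fun y => A y + B y) := fun X hX => (hA X hX).add (hB X hX)

theorem SmoothEnd.const_smul {A : (x : M) → Tan m x →ₗ[ℝ] Tan m x} (hA : SmoothEnd A) (c : ℝ) :
    SmoothEnd (fun y => c • A y) := fun X hX => (hA X hX).smul contMDiff_const

theorem SmoothBilin.add {S S' : (x : M) → Tan m x →ₗ[ℝ] Tan m x →ₗ[ℝ] Tan m x}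
    (hS : SmoothBilin S) (hS' : SmoothBilin S') : SmoothBilin (fun y => S y + S' y) :=
  fun X Y hX hY => (hS X Y hX hY).add (hS' X Y hX hY)

theorem IsChange.trans {D D' D'' : Conn m M}
    {S S' : (x : M) → Tan m x →ₗ[ℝ] Tan m x →ₗ[ℝ] Tan m x} (h : IsChange D D' S)
    (h' : IsChange D' D'' S') : IsChange D D'' (fun x => S x + S' x) := fun X x hX u => by
  rw [h' X x hX, h X x hX, LinearMap.add_apply, LinearMap.add_apply, add_assoc]

/-- The projection to the kernel of `θ` along the Reeb field. -/
def hor (θ : (x : M) → Cotan m x) (x : M) : Tan m x →ₗ[ℝ] Tan m x :=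
  LinearMap.id + (-1 : ℝ) • (θ x).toLinearMap.smulRight (reeb θ x)

theorem hor_apply (θ : (x : M) → Cotan m x) (x : M) (v : Tan m x) :
    hor θ x v = v - θ x v • reeb θ x := by
  simp [hor, sub_eq_add_neg]

/-- A torsion-free connection for which the Reeb field and `dθ` are parallel and `∇θ = ½ dθ`. -/
structure IsAdapted (θ : (x : M) → Cotan m x) (D : Conn m M) : Prop where
  affine : IsAffine D
  conn_reeb : ∀ x u, D (reeb θ) x u = 0
  nab1_eq : ∀ x u v, nab1 D θ x u v = 1 / 2 * om θ x u v
  nab2_om : ∀ x u v w, nab2 D (om θ) x u v w = 0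

/-! ### Construction of the adapted connection from vanishing torsion -/

section

variable [T2Space M] {H : (x : M) → Submodule ℝ (Tan m x)} {θ : (x : M) → Cotan m x}
  (hθ : IsContactForm H θ) {D : Conn m M} (hD : IsAffine D)
include hθ hD

theorem IsContactForm.smoothForm_lamL : SmoothForm (fun x => toCotan (lamL D θ x)) := by
  intro X hX
  have h : (fun y => toCotan (lamL D θ y) (X y)) = fun y =>
      nab2 D (om θ) y (reeb θ y) (reeb θ y) (X y)
        - tr (raise θ y ((nab2 D (om θ) y).flip.compr₂ (LinearMap.applyₗ (X y)))) := by
    funext y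
    have h1 := omegaUp_contract θ ((nab2 D (om θ) y).flip.compr₂ (LinearMap.applyₗ (X y)))
    simp only [LinearMap.compr₂_apply, LinearMap.flip_apply, LinearMap.applyₗ_apply_apply] at h1
    rw [toCotan_apply, ← h1]
    simp only [lamL, LinearMap.sum_apply, LinearMap.smul_apply, smul_eq_mul]
  have hom := SmoothTwo.om hD hθ.smoothForm
  have ht := hθ.smoothVF_reeb hD
  rw [h]
  refine ContMDiff.sub (smoothFn_nab2 hD hom ht ht hX) (smoothFn_tr (A := fun y =>
    raise θ y ((nab2 D (om θ) y).flip.compr₂ (LinearMap.applyₗ (X y))))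
    (hθ.smoothEnd_raise hD fun Y Z hY hZ => ?_))
  exact smoothFn_nab2 hD hom hZ hY hX

theorem IsContactForm.smoothEnd_hor : SmoothEnd (hor θ) :=
  SmoothEnd.add (A := fun _ => LinearMap.id) (fun _ hX => hX)
    ((smoothEnd_smulRight hθ.smoothForm (hθ.smoothVF_reeb hD)).const_smul (-1))

omit hD in
theorem IsContactForm.hor_mem (x : M) (v : Tan m x) : hor θ x v ∈ H x := by
  rw [hθ.ker, hor_apply, map_sub, map_smul, hθ.theta_reeb, smul_eq_mul, mul_one, sub_self]

omit hθ hD in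
theorem hor_of_theta_eq_zero {x : M} {v : Tan m x} (hv : θ x v = 0) : hor θ x v = v := by
  rw [hor_apply, hv, zero_smul, sub_zero]

theorem IsContactForm.nab1_reeb (x : M) (u : Tan m x) :
    nab1 D θ x u (reeb θ x) = -θ x (D (reeb θ) x u) := by
  have h := nab1_spec D hθ.smoothForm ((hθ.smoothVF_reeb hD).diff x) u
  simp only [hθ.theta_reeb, dfun_const] at h
  linarith

theorem IsContactForm.nab1_reeb_left (x : M) (v : Tan m x) :
    nab1 D θ x (reeb θ x) v = -θ x (D (reeb θ) x v) := by
  have h := om_eq_nab1 hD hθ.smoothForm x (reeb θ x) v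
  rw [hθ.om_reeb_left, hθ.nab1_reeb hD] at h
  linarith

/-- If `∇θ = ½ dθ`, the closedness of `dθ`. -/
theorem IsContactForm.nab2_om_cyclic (h : ∀ x u v, nab1 D θ x u v = 1 / 2 * om θ x u v) (x : M)
    (u v w : Tan m x) : nab2 D (om θ) x u v w + nab2 D (om θ) x v w u + nab2 D (om θ) x w u v = 0 ∧
      θ x (Rm D x u v w) = 1 / 2 * nab2 D (om θ) x w u v := by
  have hom := SmoothTwo.om hD hθ.smoothForm
  have h1 : ∀ u v w : Tan m x, nab2 D (nab1 D θ) x u v w = 1 / 2 * nab2 D (om θ) x u v w :=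
    fun u v w => by
    have e1 := nab2_spec D (SmoothTwo.nab1 hD hθ.smoothForm) (diffVFAt_fieldAt v)
      (smoothVF_fieldAt w) u
    have e2 := nab2_spec D hom (diffVFAt_fieldAt v) (smoothVF_fieldAt w) u
    simp only [h, fieldAt_self] at e1 e2
    rw [dfun_const_mul ((hom _ _ (smoothVF_fieldAt v) (smoothVF_fieldAt w)).diff x), e2] at e1
    linarith
  have hskew : ∀ u v w : Tan m x, nab2 D (om θ) x u v w = -nab2 D (om θ) x u w v := fun u v w => by
    have e1 := nab2_spec D hom (diffVFAt_fieldAt w) (smoothVF_fieldAt v) u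
    have e2 := nab2_spec D hom (diffVFAt_fieldAt v) (smoothVF_fieldAt w) u
    have e3 : (fun y => om θ y (fieldAt v y) (fieldAt w y))
        = fun y => (-1) * om θ y (fieldAt w y) (fieldAt v y) := by
      funext y
      rw [om_skew]
      ring
    rw [e3, dfun_const_mul ((hom _ _ (smoothVF_fieldAt w) (smoothVF_fieldAt v)).diff x), e1,
      om_skew θ x (D (fieldAt v) x u), om_skew θ x (fieldAt v x)] at e2
    simp only [fieldAt_self] at e2
    linarith
  -- The Ricci identity for `θ`, with `∇∇θ = ½ ∇ω`.
  have hR : ∀ u v w : Tan m x, θ x (Rm D x u v w)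
      = -(1 / 2) * (nab2 D (om θ) x u v w + nab2 D (om θ) x v w u) := fun u v w => by
    have e := ricci_identity hD hθ.smoothForm u v w
    rw [h1, h1, hskew v u w] at e
    linarith
  -- Summed cyclically, the left side is zero and the right side is minus the cyclic sum of `∇ω`.
  have hB := congrArg (θ x) (bianchi hD u v w)
  rw [map_add, map_add, map_zero, hR, hR, hR] at hB
  have hcyc : nab2 D (om θ) x u v w + nab2 D (om θ) x v w u + nab2 D (om θ) x w u v = 0 := by
    linarith
  exact ⟨hcyc, by rw [hR]; linarith⟩

/-- When `ν° = 0`, `∇ω` on `H` is pure trace and a change `Υ ∨ id` with `Υ = −λ/(2m+1)` cancels it.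
The second summand `θ ∨ B`, invisible on `H`, makes the Reeb field `t` parallel. The other
components of `∇ω` then vanish: those with `t` in a slot of `ω` because `ω(t, ·) = 0`, and `∇_t ω`
by closedness. -/
theorem IsContactForm.exists_adapted (hskew : ∀ x, ∀ v ∈ H x, nab1 D θ x v v = 0)
    (hν : ∀ x, ∀ a ∈ H x, ∀ b ∈ H x, ∀ c ∈ H x, nuFreeL D θ x a b c = 0) :
    ∃ (D₁ : Conn m M) (S : (x : M) → Tan m x →ₗ[ℝ] Tan m x →ₗ[ℝ] Tan m x), IsAdapted θ D₁ ∧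
      IsChange D D₁ S ∧ ∀ x, ∀ v ∈ H x, ∃ c : ℝ, S x v v = c • v := by
  have ht := hθ.smoothVF_reeb hD
  have hom := SmoothTwo.om hD hθ.smoothForm
  let Υ : (x : M) → Cotan m x := fun x =>
    (-(1 / (2 * m + 1)) : ℝ) • toCotan (lamL D θ x ∘ₗ hor θ x)
  have hΥ : ∀ (x : M) (v : Tan m x), Υ x v = -(1 / (2 * m + 1)) * lamL D θ x (hor θ x v) :=
    fun x v => by simp [Υ]
  have hΥs : SmoothForm Υ := fun X hX => by
    simp only [hΥ]
    have := hθ.smoothForm_lamL hD _ (hθ.smoothEnd_hor hD X hX)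
    simp only [toCotan_apply] at this
    exact contMDiff_const.mul this
  -- The requirement is `B(u) + θ(u) B(t) = −∇_u t`; the half prevents the value at `u = t` from
  -- being counted twice.
  let B : (x : M) → Tan m x →ₗ[ℝ] Tan m x := fun x => (-1 : ℝ) • nabV D (reeb θ) x
    + (1 / 2 : ℝ) • (θ x).toLinearMap.smulRight (D (reeb θ) x (reeb θ x))
  have hB : ∀ (x : M) (v : Tan m x), B x v
      = (-1 : ℝ) • D (reeb θ) x v + (1 / 2 : ℝ) • θ x v • D (reeb θ) x (reeb θ x) :=
    fun x v => rfl
  have hBs : SmoothEnd B := ((smoothEnd_nabV hD ht).const_smul (-1)).add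
    ((smoothEnd_smulRight hθ.smoothForm (ht.conn hD ht)).const_smul (1 / 2))
  -- With `hor` in place of the identity, and `Υ(t) = 0`, the first summand does not disturb the
  -- Reeb field.
  let S : (x : M) → Tan m x →ₗ[ℝ] Tan m x →ₗ[ℝ] Tan m x := fun x =>
    symProd Υ (hor θ) x + symProd θ B x
  have hSs : SmoothBilin S := (smoothBilin_symProd hΥs (hθ.smoothEnd_hor hD)).add
    (smoothBilin_symProd hθ.smoothForm hBs)
  have hSapp : ∀ x (u v : Tan m x), S x u v = Υ x u • hor θ x v + Υ x v • hor θ x u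
      + (θ x u • B x v + θ x v • B x u) := fun x u v => rfl
  have hSsymm : ∀ x (u v : Tan m x), S x u v = S x v u := fun x u v => by
    rw [hSapp, hSapp]
    module
  have hD1 := isAffine_connAdd hD hSsymm hSs
  have hch := isChange_connAdd D S
  set D₁ := connAdd D S with hD₁
  have hort : ∀ x, hor θ x (reeb θ x) = 0 := fun x => by
    rw [hor_apply, hθ.theta_reeb, one_smul, sub_self]
  have hΥt : ∀ x, Υ x (reeb θ x) = 0 := fun x => by rw [hΥ, hort, map_zero, mul_zero]
  have hreeb : ∀ x u, D₁ (reeb θ) x u = 0 := fun x u => by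
    rw [hch _ x (ht.diff x), hSapp, hΥt, hort, hθ.theta_reeb, hB, hB, hθ.theta_reeb]
    module
  have hnab1 : ∀ x u v, nab1 D₁ θ x u v = 1 / 2 * om θ x u v := fun x u v => by
    have hsym : ∀ u v : Tan m x, nab1 D₁ θ x u v + nab1 D₁ θ x v u = 0 := by
      have h1 : ∀ v ∈ H x, nab1 D₁ θ x v v = 0 := fun v hv => by
        rw [hch.nab1_eq hθ.smoothForm, hskew x v hv, hSapp, (hθ.ker x v).1 hv,
          hor_of_theta_eq_zero ((hθ.ker x v).1 hv)]
        simp [(hθ.ker x v).1 hv]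
      have h2 : ∀ v, nab1 D₁ θ x v (reeb θ x) = 0 := fun v => by
        rw [hθ.nab1_reeb hD1, hreeb, map_zero, neg_zero]
      have h3 : ∀ v, nab1 D₁ θ x (reeb θ x) v = 0 := fun v => by
        rw [hθ.nab1_reeb_left hD1, hreeb, map_zero, neg_zero]
      have h4 : ∀ v, nab1 D₁ θ x v v = 0 := fun v => by
        have h5 := h1 _ (hθ.hor_mem x v)
        simp only [hor_apply, map_sub, map_smul, LinearMap.sub_apply, LinearMap.smul_apply, h2,
          h3, smul_zero, sub_zero] at h5
        exact h5
      intro u v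
      have h5 := h4 (u + v)
      simp only [map_add, LinearMap.add_apply, h4] at h5
      linarith
    have h1 := om_eq_nab1 hD1 hθ.smoothForm x u v
    have h2 := hsym u v
    linarith
  refine ⟨D₁, S, ⟨hD1, hreeb, hnab1, ?_⟩, hch, ?_⟩
  · intro x
    have hr : ∀ u v : Tan m x, nab2 D₁ (om θ) x u v (reeb θ x) = 0 := fun u v => by
      have e := nab2_spec D₁ hom (diffVFAt_fieldAt v) (hθ.smoothVF_reeb hD) u
      simp only [hθ.om_reeb, dfun_const, hreeb, map_zero, fieldAt_self] at e
      linarith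
    have hl : ∀ u v : Tan m x, nab2 D₁ (om θ) x u (reeb θ x) v = 0 := fun u v => by
      have e := nab2_spec D₁ hom ((hθ.smoothVF_reeb hD).diff x) (smoothVF_fieldAt v) u
      simp only [hθ.om_reeb_left, dfun_const, hreeb, map_zero, fieldAt_self,
        LinearMap.zero_apply] at e
      linarith
    have hf : ∀ u v : Tan m x, nab2 D₁ (om θ) x (reeb θ x) u v = 0 := fun u v => by
      have e := (hθ.nab2_om_cyclic hD1 hnab1 x (reeb θ x) u v).1
      rw [hr, hl] at e
      linarith
    have hH : ∀ c ∈ H x, ∀ a ∈ H x, ∀ b ∈ H x, nab2 D₁ (om θ) x c a b = 0 := by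
      intro c hc a ha b hb
      have hc' := (hθ.ker x c).1 hc
      have ha' := (hθ.ker x a).1 ha
      have hb' := (hθ.ker x b).1 hb
      have e := hν x a ha b hb c hc
      rw [nuFreeL_apply] at e
      rw [hch.nab2_eq hom, hSapp, hSapp, hc', ha', hb', hΥ, hΥ, hΥ, hor_of_theta_eq_zero hc',
        hor_of_theta_eq_zero ha', hor_of_theta_eq_zero hb']
      simp only [zero_smul, add_zero, map_add, map_smul, LinearMap.add_apply,
        LinearMap.smul_apply, smul_eq_mul]
      rw [om_skew θ x c b]
      linarith
    intro c a b
    have e := hH _ (hθ.hor_mem x c) _ (hθ.hor_mem x a) _ (hθ.hor_mem x b)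
    simp only [hor_apply, map_sub, map_smul, LinearMap.sub_apply, LinearMap.smul_apply, hr, hl, hf,
      smul_zero, sub_zero] at e
    exact e
  · intro x v hv
    have hv' := (hθ.ker x v).1 hv
    exact ⟨2 * Υ x v, by rw [hSapp, hv', hor_of_theta_eq_zero hv']; module⟩

end

end

section

variable {m : ℕ} {M : Type*} [TopologicalSpace M] [ChartedSpace (Model m) M]
  [IsManifold (𝓡 (2 * m + 1)) ∞ M]

/-! ### Connections with `∇θ = ½ dθ` -/

/-- The divergence of a field of endomorphisms. -/
def divE (D : Conn m M) (A : (x : M) → Tan m x →ₗ[ℝ] Tan m x) (x : M) : Tan m x →ₗ[ℝ] ℝ :=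
  tr ∘ₗ (nabE D A x).flip

theorem divE_apply (D : Conn m M) (A : (x : M) → Tan m x →ₗ[ℝ] Tan m x) (x : M) (b : Tan m x) :
    divE D A x b = tr ((nabE D A x).flip b) := rfl

section

variable [T2Space M] {H : (x : M) → Submodule ℝ (Tan m x)} {θ : (x : M) → Cotan m x}
  (hθ : IsContactForm H θ)
include hθ

theorem IsContactForm.raise_eq_of_gm {x : M} {T : Tan m x →ₗ[ℝ] Tan m x →ₗ[ℝ] ℝ}
    {A : Tan m x →ₗ[ℝ] Tan m x} (h : ∀ v w, gm θ x (A v) w = T v w) : raise θ x T = A := by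
  ext1 v
  exact hθ.gm_ext fun w => by rw [raise_apply, hθ.gm_sharp, h]

/-- The trace of a symmetric horizontal bilinear form vanishes. -/
theorem IsContactForm.tr_raise_symm {x : M} {T : Tan m x →ₗ[ℝ] Tan m x →ₗ[ℝ] ℝ}
    (hT : ∀ u v, T u v = T v u) (ht : ∀ u, T u (reeb θ x) = 0) : tr (raise θ x T) = 0 := by
  have h0 : ∀ u, θ x (raise θ x T u) = 0 := fun u => by
    rw [raise_apply, hθ.theta_sharp, ht]
  -- The raised form lies in the symplectic Lie algebra of `H`; moving it across `ω` changes the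
  -- sign of its trace.
  have h1 : tr (raise θ x T) = -tr (raise θ x T) := by
    conv_lhs => rw [tr_raise]
    rw [tr_apply, ← Finset.sum_neg_distrib]
    refine Finset.sum_congr rfl fun i _ => ?_
    have h2 := hθ.gm_sharp (T (frame x i)) (sharp θ x (coframe x i).toLinearMap)
    have h3 := hθ.gm_sharp (coframe x i).toLinearMap (raise θ x T (frame x i))
    rw [← raise_apply] at h2
    rw [gm_apply, h0, zero_mul, add_zero] at h2
    rw [gm_apply, h0, mul_zero, add_zero, ContinuousLinearMap.coe_coe] at h3
    rw [hT, ← h2, om_skew, h3]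
  linarith

variable {D : Conn m M} (hD : IsAffine D)
include hD

theorem IsContactForm.nab2_gm (x : M) (u v w : Tan m x) : nab2 D (gm θ) x u v w
    = nab2 D (om θ) x u v w + nab1 D θ x u v * θ x w + θ x v * nab1 D θ x u w := by
  have hv := smoothVF_fieldAt v
  have hw := smoothVF_fieldAt w
  have hom := SmoothTwo.om hD hθ.smoothForm
  have e := nab2_spec D (SmoothTwo.gm hD hθ.smoothForm) (hv.diff x) hw u
  have e1 := nab2_spec D hom (hv.diff x) hw u
  have e2 := nab1_spec D hθ.smoothForm (hv.diff x) u
  have e3 := nab1_spec D hθ.smoothForm (hw.diff x) u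
  simp only [gm_apply] at e
  rw [dfun_add ((hom _ _ hv hw).diff x)
    (((hθ.smoothForm _ hv).diff x).mul ((hθ.smoothForm _ hw).diff x)),
    dfun_mul ((hθ.smoothForm _ hv).diff x) ((hθ.smoothForm _ hw).diff x), e1, e2, e3] at e
  simp only [fieldAt_self] at e
  linarith

section

variable (h : ∀ x u v, nab1 D θ x u v = 1 / 2 * om θ x u v)
include h

/-- The derivative of `θ ⊗ θ` contributes two rank one endomorphisms, each of trace `½ ω(u, t) = 0`.
-/
theorem IsContactForm.tr_raise_nab2_gm (x : M) (u : Tan m x) :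
    tr (raise θ x (nab2 D (gm θ) x u)) = tr (raise θ x (nab2 D (om θ) x u)) := by
  have e : raise θ x (nab2 D (gm θ) x u) = raise θ x (nab2 D (om θ) x u)
      + ((1 / 2 : ℝ) • om θ x u).smulRight (reeb θ x)
      + (θ x).toLinearMap.smulRight (sharp θ x ((1 / 2 : ℝ) • om θ x u)) := by
    refine hθ.raise_eq_of_gm fun v w => ?_
    rw [hθ.nab2_gm hD, h, h]
    simp only [LinearMap.add_apply, LinearMap.smulRight_apply, map_add, map_smul, raise_apply,
      hθ.gm_sharp, hθ.gm_reeb_left, LinearMap.smul_apply, smul_eq_mul,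
      ContinuousLinearMap.coe_coe]
  rw [e, map_add, map_add, tr_smulRight, tr_smulRight, ContinuousLinearMap.coe_coe, hθ.theta_sharp,
    LinearMap.smul_apply, hθ.om_reeb, smul_zero, add_zero, add_zero]

/-- The contact form contracted with the Weyl tensor of a connection with symmetric Ricci tensor. -/
theorem IsContactForm.theta_weyl (hm : 1 ≤ m) (hR : ∀ x u v, Ric D x u v = Ric D x v u) (x : M)
    (a b c : Tan m x) : schouten D x a b = 1 / (2 * m) * Ric D x a b ∧
      θ x (weyl D x a b c) = 1 / 2 * nab2 D (om θ) x c a b - schouten D x b c * θ x a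
        + schouten D x a c * θ x b := by
  have h0 : (m : ℝ) ≠ 0 := by positivity
  have h1 : (2 * m + 2 : ℝ) ≠ 0 := by positivity
  have h2 : ∀ a b, schouten D x a b = 1 / (2 * m) * Ric D x a b := fun a b => by
    rw [schouten, ricci_eq hD, ricci_eq hD, hR x b a]
    field_simp
    ring
  refine ⟨h2 a b, ?_⟩
  rw [weyl, curvature_eq hD, map_sub, map_add, map_sub, map_smul, map_smul, map_smul,
    (hθ.nab2_om_cyclic hD h x a b c).2, h2 b a, h2 a b, hR x b a]
  simp only [smul_eq_mul]
  ring

variable {A : (x : M) → Tan m x →ₗ[ℝ] Tan m x} (hA : SmoothEnd A)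
  (hθA : ∀ x u, θ x (A x u) = 0) (htr : ∀ x, tr (A x) = 0)
include hA hθA

/-- Differentiate `θ(A v) = 0` and use `∇θ = ½ω`. -/
theorem IsContactForm.theta_nabE (x : M) (u v : Tan m x) :
    θ x (nabE D A x u v) = -(1 / 2) * om θ x u (A x v) := by
  have hv := smoothVF_fieldAt v
  have e1 := nab1_spec D hθ.smoothForm ((hA _ hv).diff x) u
  rw [nabE_spec D hA hv, map_add, h] at e1
  simp only [hθA, dfun_const, fieldAt_self] at e1
  linarith

include htr

/-- The curvature change for `θ ∨ A` is traced. With `A` horizontal and trace-free and `θ(b) = 0`,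
the quadratic terms in `A` and the trace of `∇_b A` drop out; what remains comes from `∇θ = ½ω` and
from the divergence of `A`. -/
theorem IsContactForm.Ric_symProd {D' : Conn m M} (hD' : IsAffine D')
    (hch : IsChange D D' (symProd θ A)) {x : M} {b : Tan m x} (hb : θ x b = 0) (d : Tan m x) :
    Ric D' x b d = Ric D x b d + 1 / 2 * om θ x (A x b) d + 1 / 2 * om θ x (A x d) b
      + θ x d * divE D A x b := by
  have hSS : ∀ w v u : Tan m x, symProd θ A x (symProd θ A x w v) u
      = θ x u • (θ x w • A x (A x v) + θ x v • A x (A x w)) := fun w v u => by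
    have h0 : θ x (symProd θ A x w v) = 0 := by
      rw [symProd_apply, map_add, map_smul, map_smul, hθA, hθA, smul_zero, smul_zero, add_zero]
    rw [symProd_apply, h0, symProd_apply, map_add, map_smul, map_smul, zero_smul, zero_add]
  have e : ((Rm D' x).flip b).flip d = ((Rm D x).flip b).flip d + θ x d • (nabE D A x).flip b
      + ((1 / 2 : ℝ) • (om θ x).flip d).smulRight (A x b)
      + ((1 / 2 : ℝ) • (om θ x).flip b).smulRight (A x d)
      + (θ x).toLinearMap.smulRight (θ x d • A x (A x b))
      - (θ x d • nabE D A x b + (1 / 2 * om θ x b d) • A x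
        + (θ x).toLinearMap.smulRight (nabE D A x b d)
        + ((1 / 2 : ℝ) • om θ x b).smulRight (A x d)) := by
    ext1 u
    simp only [LinearMap.flip_apply, LinearMap.add_apply, LinearMap.sub_apply,
      LinearMap.smulRight_apply, LinearMap.smul_apply, ContinuousLinearMap.coe_coe]
    rw [IsChange.Rm_eq hD hD' hθ.smoothForm hA hch]
    rw [hSS, hSS]
    simp only [h, hb]
    module
  have h1 : tr (nabE D A x b) = 0 := by
    rw [← dfun_tr D hA]
    simp only [htr, dfun_const]
  rw [Ric_apply, e]
  simp only [map_sub, map_add, map_smul, tr_smulRight, htr, h1, ContinuousLinearMap.coe_coe, hθA,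
    hθ.theta_nabE hD h hA hθA, LinearMap.smul_apply, LinearMap.flip_apply, smul_eq_mul]
  rw [Ric_apply, divE_apply]
  ring

/-- With one slot fixed at `u`, the trace of `θ ∨ A` is `θ(A u) + θ(u) tr A = 0`. -/
theorem IsContactForm.nabla_scale_symProd {D' : Conn m M} (hch : IsChange D D' (symProd θ A))
    (x : M) (vol : TopForm m x) (u : Tan m x) :
    nabla D' 2 (scale θ) x vol ![] ![u] = nabla D 2 (scale θ) x vol ![] ![u] := by
  have e : (symProd θ A x).flip u = (θ x).toLinearMap.smulRight (A x u) + θ x u • A x := by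
    ext1 v
    rfl
  rw [hθ.nabla_scale_change hD hch, e, map_add, map_smul, tr_smulRight, htr,
    ContinuousLinearMap.coe_coe, hθA]
  simp

omit htr in
theorem IsContactForm.nab1_symProd {D' : Conn m M} (hch : IsChange D D' (symProd θ A))
    (x : M) (u v : Tan m x) : nab1 D' θ x u v = 1 / 2 * om θ x u v := by
  rw [hch.nab1_eq hθ.smoothForm, symProd_apply, map_add, map_smul, map_smul, hθA, hθA, h]
  simp

end

theorem IsContactForm.divE_add_smulRight (h : ∀ x u v, nab1 D θ x u v = 1 / 2 * om θ x u v)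
    {A : (x : M) → Tan m x →ₗ[ℝ] Tan m x}
    (hA : SmoothEnd A) {a : (x : M) → Tan m x} (ha : SmoothVF a) {x : M} {b : Tan m x}
    (hb : θ x b = 0) : divE D (fun y => A y + (θ y).toLinearMap.smulRight (a y)) x b
      = divE D A x b + 1 / 2 * om θ x (a x) b := by
  have hB := hA.add (smoothEnd_smulRight hθ.smoothForm ha)
  have e : (nabE D (fun y => A y + (θ y).toLinearMap.smulRight (a y)) x).flip b
      = (nabE D A x).flip b + ((1 / 2 : ℝ) • (om θ x).flip b).smulRight (a x) := by
    ext1 u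
    have hv := smoothVF_fieldAt b
    have e1 := nabE_spec D hB hv u (x := x)
    simp only [LinearMap.add_apply, LinearMap.smulRight_apply, ContinuousLinearMap.coe_coe] at e1
    have s1 := ha.smul (hθ.smoothForm _ hv)
    rw [conn_add D ((hA _ hv).diff x) (s1.diff x), nabE_spec D hA hv,
      conn_smul D ((hθ.smoothForm _ hv).diff x) (ha.diff x),
      nab1_spec D hθ.smoothForm (hv.diff x), h] at e1
    simp only [fieldAt_self, hb] at e1
    simp only [LinearMap.flip_apply, LinearMap.add_apply, LinearMap.smulRight_apply,
      LinearMap.smul_apply]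
    rw [← sub_eq_zero] at e1 ⊢
    rw [← neg_eq_zero, ← e1]
    simp only [smul_eq_mul]
    module
  rw [divE_apply, e, map_add, tr_smulRight, divE_apply, LinearMap.smul_apply,
    LinearMap.flip_apply, smul_eq_mul]

end

/-! ### Correcting an adapted connection so that `θ` annihilates the Weyl curvature -/

section

variable [T2Space M] {H : (x : M) → Submodule ℝ (Tan m x)} {θ : (x : M) → Cotan m x}
  (hθ : IsContactForm H θ) {D : Conn m M} (hA : IsAdapted θ D)
include hθ hA

theorem IsAdapted.nabla_scale_eq_zero (x : M) (vol : TopForm m x) (u : Tan m x) :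
    nabla D 2 (scale θ) x vol ![] ![u] = 0 := by
  have e : raise θ x (nab2 D (om θ) x u) = 0 := by
    refine hθ.raise_eq_of_gm fun v w => ?_
    rw [hA.nab2_om, LinearMap.zero_apply, map_zero, LinearMap.zero_apply]
  rw [hθ.nabla_scale hA.affine]
  simp only [Matrix.cons_val_zero]
  rw [hθ.tr_raise_nab2_gm hA.affine hA.nab1_eq, e, map_zero, mul_zero, zero_mul]

theorem IsAdapted.ric_comm (x : M) (u v : Tan m x) : Ric D x u v = Ric D x v u :=
  hθ.ric_symm hA.affine (fun x vol _ u => hA.nabla_scale_eq_zero hθ x vol u) x u v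

/-- A parallel Reeb field is annihilated by the curvature. -/
theorem IsAdapted.ric_reeb (x : M) (u : Tan m x) : Ric D x u (reeb θ x) = 0 := by
  have ht := hθ.smoothVF_reeb hA.affine
  have e : ((Rm D x).flip u).flip (reeb θ x) = 0 := by
    ext1 v
    have h := Rm_spec hA.affine (smoothVF_fieldAt v) (smoothVF_fieldAt u) ht x
    simp only [hA.conn_reeb, conn_zero, fieldAt_self, sub_zero] at h
    exact h
  rw [Ric_apply, e, map_zero]

/-- The adapted connection can be corrected so that the contraction of the Weyl tensor with `θ`
vanishes. -/
theorem IsAdapted.exists_theta_weyl_eq_zero (hm : 1 ≤ m) :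
    ∃ (D' : Conn m M) (A : (x : M) → Tan m x →ₗ[ℝ] Tan m x), IsAffine D' ∧
      IsChange D D' (symProd θ A) ∧ (∀ x u v, nab1 D' θ x u v = 1 / 2 * om θ x u v) ∧
      (∀ (x : M) (vol : TopForm m x) (u : Tan m x), nabla D' 2 (scale θ) x vol ![] ![u] = 0) ∧
      ∀ x a b c, θ x (weyl D' x a b c) = 0 := by
  have hD := hA.affine
  have hm1 : (m + 1 : ℝ) ≠ 0 := by positivity
  have hm2 : (2 * m + 1 : ℝ) ≠ 0 := by positivity
  have hm0 : (m : ℝ) ≠ 0 := by positivity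
  -- With `ω(A u, v) = −α(u, v)`, the shift of `∇ω` calls for a new Schouten tensor `½α` on `H`,
  -- that is, a new Ricci tensor `mα`. The change lowers the Ricci tensor on `H` by `α`, so the old
  -- one must be `(m+1)α`.
  let α : (x : M) → Tan m x →ₗ[ℝ] Tan m x →ₗ[ℝ] ℝ := fun x => (1 / (m + 1) : ℝ) • Ric D x
  have hα : ∀ x u v, α x u v = 1 / (m + 1) * Ric D x u v := fun _ _ _ => rfl
  have hαs : SmoothTwo α := fun X Y hX hY =>
    contMDiff_const.mul (smoothTwo_Ric hD X Y hX hY)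
  have hαc : ∀ x u v, α x u v = α x v u := fun x u v => by
    rw [hα, hα, hA.ric_comm hθ]
  have hαt : ∀ x u, α x u (reeb θ x) = 0 := fun x u => by
    rw [hα, hA.ric_reeb hθ, mul_zero]
  let A₀ : (x : M) → Tan m x →ₗ[ℝ] Tan m x := fun x => (-1 : ℝ) • raise θ x (α x)
  have hA₀ : SmoothEnd A₀ := (hθ.smoothEnd_raise hD hαs).const_smul (-1)
  have hA₀θ : ∀ x u, θ x (A₀ x u) = 0 := fun x u => by
    simp only [A₀, LinearMap.smul_apply, map_smul, raise_apply, hθ.theta_sharp, hαt, smul_zero]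
  have hA₀om : ∀ x u v, om θ x (A₀ x u) v = -α x u v := fun x u v => by
    simp only [A₀, LinearMap.smul_apply, map_smul, raise_apply, hθ.om_sharp, hαt, smul_eq_mul]
    ring
  have hA₀tr : ∀ x, tr (A₀ x) = 0 := fun x => by
    change tr ((-1 : ℝ) • raise θ x (α x)) = 0
    rw [map_smul, hθ.tr_raise_symm (hαc x) (hαt x), smul_zero]
  clear_value A₀ α
  -- The second unknown settles the components `P(b, t)`, which must equal `β(b)`, so the new
  -- `Ric(b, t)` must be `2mβ(b)`. The divergence of `A` gives `div A₀ − ½β`, and the term `½ ω(A t,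
  -- b)` another `−½β`; hence `div A₀ = (2m+1)β` on `H`.
  let β : (x : M) → Cotan m x := fun x =>
    (1 / (2 * m + 1) : ℝ) • toCotan (divE D A₀ x ∘ₗ hor θ x)
  have hβ : ∀ (x : M) v, β x v = 1 / (2 * m + 1) * divE D A₀ x (hor θ x v) := fun x v => by
    simp [β]
  have hβs : SmoothForm β := fun X hX => by
    simp only [hβ]
    exact contMDiff_const.mul (smoothFn_tr
      (A := fun y => (nabE D A₀ y).flip (hor θ y (X y))) fun Y hY =>
      hA₀.nabE hD hY (hθ.smoothEnd_hor hD X hX))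
  have hβt : ∀ x, β x (reeb θ x) = 0 := fun x => by
    rw [hβ, hor_apply, hθ.theta_reeb, one_smul, sub_self, map_zero, mul_zero]
  clear_value β
  let a : (x : M) → Tan m x := fun x => (-1 : ℝ) • sharp θ x (β x).toLinearMap
  have ha : SmoothVF a := (hθ.smoothVF_sharp hD hβs).smul contMDiff_const
  have haθ : ∀ x, θ x (a x) = 0 := fun x => by
    simp only [a, map_smul, hθ.theta_sharp, ContinuousLinearMap.coe_coe, hβt, smul_zero]
  have haom : ∀ x v, om θ x (a x) v = -β x v := fun x v => by
    simp only [a, LinearMap.smul_apply, map_smul, hθ.om_sharp, ContinuousLinearMap.coe_coe, hβt,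
      smul_eq_mul]
    ring
  clear_value a
  let A : (x : M) → Tan m x →ₗ[ℝ] Tan m x := fun x =>
    A₀ x + (θ x).toLinearMap.smulRight (a x)
  have hAapp : ∀ x v, A x v = A₀ x v + θ x v • a x := fun _ _ => rfl
  have hAs : SmoothEnd A := hA₀.add (smoothEnd_smulRight hθ.smoothForm ha)
  have hAθ : ∀ x u, θ x (A x u) = 0 := fun x u => by
    rw [hAapp, map_add, map_smul, hA₀θ, haθ, smul_zero, add_zero]
  have hAtr : ∀ x, tr (A x) = 0 := fun x => by
    change tr (A₀ x + (θ x).toLinearMap.smulRight (a x)) = 0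
    rw [map_add, tr_smulRight, ContinuousLinearMap.coe_coe, haθ, add_zero, hA₀tr]
  have hAom : ∀ x u v, om θ x (A x u) v = -α x u v - θ x u * β x v := fun x u v => by
    rw [hAapp, map_add, LinearMap.add_apply, map_smul, LinearMap.smul_apply, hA₀om, haom,
      smul_eq_mul]
    ring
  have hD' := isAffine_connAdd hD (symProd_comm θ A) (smoothBilin_symProd hθ.smoothForm hAs)
  have hch := isChange_connAdd D (symProd θ A)
  set D' := connAdd D (symProd θ A) with hDdef
  have hnab := hθ.nab1_symProd hD hA.nab1_eq hAs hAθ hch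
  have hsc : ∀ (x : M) (vol : TopForm m x) (u : Tan m x),
      nabla D' 2 (scale θ) x vol ![] ![u] = 0 := fun x vol u => by
    rw [hθ.nabla_scale_symProd hD hA.nab1_eq hAs hAθ hAtr hch, hA.nabla_scale_eq_zero hθ]
  have hRc : ∀ x u v, Ric D' x u v = Ric D' x v u :=
    hθ.ric_symm hD' fun x vol _ u => hsc x vol u
  refine ⟨D', A, hD', hch, hnab, hsc, fun x => ?_⟩
  have hP : ∀ b c, θ x b = 0 → schouten D' x b c = 1 / 2 * α x b c + θ x c * β x b := by
    intro b c hb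
    have h1 := (hθ.theta_weyl hD' hnab hm hRc x b c 0).1
    have h2 := hθ.divE_add_smulRight hD hA.nab1_eq hA₀ ha hb
    have h3 := hβ x b
    rw [hor_of_theta_eq_zero hb] at h3
    have h4 : divE D A₀ x b = (2 * m + 1) * β x b := by
      rw [h3]
      field_simp
    have h5 : Ric D x b c = (m + 1) * α x b c := by
      rw [hα]
      field_simp
    rw [haom, h4] at h2
    rw [h1, hθ.Ric_symProd hD hA.nab1_eq hAs hAθ hAtr hD' hch hb, hAom, hAom, hb]
    change 1 / (2 * (m : ℝ)) * (_ + θ x c * divE D (fun y => A₀ y +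
      (θ y).toLinearMap.smulRight (a y)) x b) = _
    rw [h2, h5, hαc x c b]
    field_simp
    ring
  -- The values `P(t, ·)` can stay unknown: they enter `θ(W(u, v) w)` with the symmetric factor
  -- `θ(u) θ(v)` and cancel in the skew expression.
  have hP' : ∀ b c, schouten D' x b c = 1 / 2 * α x b c + θ x c * β x b
      + θ x b * schouten D' x (reeb θ x) c := by
    intro b c
    have h1 := hP (hor θ x b) c ((hθ.ker x _).1 (hθ.hor_mem x b))
    have h2 : ∀ u v w : Tan m x, ∀ s : ℝ, schouten D' x (u - s • v) w
        = schouten D' x u w - s * schouten D' x v w := fun u v w s => by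
      simp only [(hθ.theta_weyl hD' hnab hm hRc x _ w 0).1, map_sub, map_smul,
        LinearMap.sub_apply, LinearMap.smul_apply, smul_eq_mul]
      ring
    rw [hor_apply, h2, map_sub, map_sub, map_smul, map_smul, LinearMap.sub_apply,
      LinearMap.smul_apply, hβt, hαc x (reeb θ x) c, hαt, smul_zero, sub_zero,
      sub_zero] at h1
    linarith
  intro u v w
  rw [(hθ.theta_weyl hD' hnab hm hRc x u v w).2, hch.nab2_eq (SmoothTwo.om hD hθ.smoothForm),
    hA.nab2_om, hP' v w, hP' u w, symProd_apply, symProd_apply]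
  simp only [map_add, map_smul, LinearMap.add_apply, LinearMap.smul_apply, smul_eq_mul]
  rw [om_skew θ x u (A x v), om_skew θ x u (A x w), hAom, hAom, hAom, hAom, hαc x u v, hαc x u w,
    hαc x v w, hαc x w u, hαc x w v]
  ring

end

end

section

variable {m : ℕ} {M : Type*} [TopologicalSpace M] [ChartedSpace (Model m) M]
  [IsManifold (𝓡 (2 * m + 1)) ∞ M]

/-! ### The conformal contact form in the projective class of a normalised connection -/

/-- A connection with `∇τ = 0`, `∇θ = ½ dθ` and `W_ab^d_c θ_d = 0`. -/
structure IsNormalized (θ : (x : M) → Cotan m x) (D : Conn m M) : Prop where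
  affine : IsAffine D
  nab1_eq : ∀ x u v, nab1 D θ x u v = 1 / 2 * om θ x u v
  nabla_scale : ∀ (x : M) (vol : TopForm m x), vol ≠ 0 → ∀ u : Tan m x,
    nabla D 2 (scale θ) x vol ![] ![u] = 0
  theta_weyl : ∀ x a b c, θ x (weyl D x a b c) = 0

/-- The 2-form `½ dθ + Υ ∧ θ`. -/
def muForm (θ Υ : (x : M) → Cotan m x) (x : M) : Tan m x →ₗ[ℝ] Tan m x →ₗ[ℝ] ℝ :=
  (1 / 2 : ℝ) • om θ x + (Υ x).toLinearMap.smulRight (θ x).toLinearMap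
    - (θ x).toLinearMap.smulRight (Υ x).toLinearMap

theorem muForm_apply (θ Υ : (x : M) → Cotan m x) (x : M) (u v : Tan m x) :
    muForm θ Υ x u v = 1 / 2 * om θ x u v + Υ x u * θ x v - θ x u * Υ x v := rfl

theorem IsHGeodesicOn.of_change {C : ContactStructure m M} {D D' : Conn m M}
    {S : (x : M) → Tan m x →ₗ[ℝ] Tan m x →ₗ[ℝ] Tan m x} (h : IsChange D D' S)
    (hS : ∀ x, ∀ v ∈ C.H x, ∃ c : ℝ, S x v v = c • v) {J : Set ℝ} {γ : ℝ → M}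
    (hg : IsHGeodesicOn C D J γ) : IsHGeodesicOn C D' J γ :=
  ⟨hg.1.of_change h fun t ht => hS _ _ (hg.2 t ht), hg.2⟩

theorem IsChange.isHGeodesicOn_iff {C : ContactStructure m M} {D D' : Conn m M}
    {S : (x : M) → Tan m x →ₗ[ℝ] Tan m x →ₗ[ℝ] Tan m x} (h : IsChange D D' S)
    (hS : ∀ x, ∀ v ∈ C.H x, ∃ c : ℝ, S x v v = c • v) (J : Set ℝ) (γ : ℝ → M) :
    IsHGeodesicOn C D' J γ ↔ IsHGeodesicOn C D J γ := by
  refine ⟨fun hg => hg.of_change h.symm fun x v hv => ?_, fun hg => hg.of_change h hS⟩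
  obtain ⟨c, hc⟩ := hS x v hv
  exact ⟨-c, by rw [LinearMap.neg_apply, LinearMap.neg_apply, hc, neg_smul]⟩

/-- A bilinear form as a multilinear map. -/
def bilinMultilinear {x : M} (T : Tan m x →ₗ[ℝ] Tan m x →ₗ[ℝ] ℝ) :
    MultilinearMap ℝ (fun _ : Fin 2 => Tan m x) ℝ where
  toFun v := T (v 0) (v 1)
  map_update_add' v i a b := by
    fin_cases i <;> simp
  map_update_smul' v i c a := by
    fin_cases i <;> simp

section

variable [T2Space M] {H : (x : M) → Submodule ℝ (Tan m x)} {θ : (x : M) → Cotan m x}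
  (hθ : IsContactForm H θ)
include hθ

theorem IsContactForm.smoothTwo_muForm {D : Conn m M} (hD : IsAffine D) {Υ : (x : M) → Cotan m x}
    (hΥ : SmoothForm Υ) : SmoothTwo (muForm θ Υ) := fun X Y hX hY => by
  simp only [muForm_apply]
  exact ContMDiff.sub (ContMDiff.add (contMDiff_const.mul (SmoothTwo.om hD hθ.smoothForm X Y hX hY))
    (ContMDiff.mul (hΥ X hX) (hθ.smoothForm Y hY))) (ContMDiff.mul (hθ.smoothForm X hX) (hΥ Y hY))

theorem IsContactForm.isWeightedTensor_weightedForm {D : Conn m M} (hD : IsAffine D) :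
    IsWeightedTensor 2 (weightedForm θ) :=
  hθ.isWeightedTensor_scale_mul hD
    (F := fun x => MultilinearMap.ofSubsingleton ℝ _ _ (0 : Fin 1) (θ x).toLinearMap)
    fun _ hX => hθ.smoothForm _ (hX 0)

theorem IsContactForm.isWeightedTensor_scale_mul_two {D : Conn m M} (hD : IsAffine D)
    {T : (x : M) → Tan m x →ₗ[ℝ] Tan m x →ₗ[ℝ] ℝ} (hT : SmoothTwo T) :
    IsWeightedTensor 2 (fun x vol α (v : Fin 2 → Tan m x) => scale θ x vol α ![] * T x (v 0) (v 1) :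
      WField m M 0 2) :=
  hθ.isWeightedTensor_scale_mul hD (F := fun x => bilinMultilinear (T x))
    fun _ hX => hT _ _ (hX 0) (hX 1)

variable {D : Conn m M} (hN : IsNormalized θ D)
include hN

theorem IsNormalized.ric_comm (x : M) (u v : Tan m x) : Ric D x u v = Ric D x v u :=
  hθ.ric_symm hN.affine hN.nabla_scale x u v

/-- The condition `θ(W) = 0`, solved for `∇ω`. This is the second tractor equation for `½ dθ` in the
splitting of `D`. -/
theorem IsNormalized.nab2_om (hm : 1 ≤ m) (x : M) (a b c : Tan m x) :
    1 / 2 * nab2 D (om θ) x a b c = schouten D x a c * θ x b - schouten D x a b * θ x c := by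
  have hR := hN.ric_comm hθ
  have hs := fun a b c => hθ.theta_weyl hN.affine hN.nab1_eq hm hR x a b c
  have h := (hs b c a).2
  rw [hN.theta_weyl, (hs c a 0).1, (hs b a 0).1, hR x c a, hR x b a] at h
  rw [(hs a c 0).1, (hs a b 0).1]
  linarith

variable {D' : Conn m M} {Υ : (x : M) → Cotan m x} (h : IsProjectiveChange D D' Υ)
include h

/-- The trace of `Υ ∨ id` is `(2m+2) Υ(u)`, which the weight `2` turns into `2 Υ(u)`. -/
theorem IsNormalized.nabla_scale_eq (x : M) (vol : TopForm m x) (hvol : vol ≠ 0) (u : Tan m x) :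
    nabla D' 2 (scale θ) x vol ![] ![u] = 2 * Υ x u * scale θ x vol ![] ![] := by
  have e : (symProd Υ idEnd x).flip u = (Υ x).toLinearMap.smulRight u
      + Υ x u • LinearMap.id := by
    ext1 v
    rfl
  have hm1 : (m + 1 : ℝ) ≠ 0 := by positivity
  rw [hθ.nabla_scale_change hN.affine h.isChange, hN.nabla_scale x vol hvol, e, map_add, map_smul,
    tr_smulRight, tr_id, ContinuousLinearMap.coe_coe, smul_eq_mul]
  field_simp
  ring

/-- From `2 Υ(u) θ(v)` in the derivative of the scale one subtracts `Υ(u) θ(v) + Υ(v) θ(u)` from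
that of the form, and a skew expression remains. This is at once the Killing equation for every
connection in the class and the first tractor equation. -/
theorem IsNormalized.nabla_weightedForm (hD' : IsAffine D') (x : M) (vol : TopForm m x)
    (hvol : vol ≠ 0) (u v : Tan m x) :
    nabla D' 2 (weightedForm θ) x vol ![] ![u, v]
      = scale θ x vol ![] ![] * muForm θ Υ x u v := by
  have e := hθ.nabla_scale_mul_one hD' hθ.smoothForm vol u v
  change nabla D' 2 (weightedForm θ) x vol ![] ![u, v] = _ at e
  rw [e, hN.nabla_scale_eq hθ h x vol hvol, h.isChange.nab1_eq hθ.smoothForm, hN.nab1_eq,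
    muForm_apply, symProd_apply, idEnd_apply, idEnd_apply, map_add, map_smul, map_smul]
  simp only [smul_eq_mul]
  ring

/-- The second tractor equation for `D + Υ`: the derivatives of `Υ` in `∇(Υ ∧ θ)` are absorbed by
the change of the Schouten tensor. -/
theorem IsNormalized.nabla_scale_mul_muForm (hm : 1 ≤ m) (hD' : IsAffine D') (x : M)
    (vol : TopForm m x) (hvol : vol ≠ 0) (a b c : Tan m x) :
    nabla D' 2 (fun x vol α (v : Fin 2 → Tan m x) =>
        scale θ x vol α ![] * muForm θ Υ x (v 0) (v 1)) x vol ![] ![a, b, c]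
      = scale θ x vol ![] ![] * (schouten D' x a c * θ x b - schouten D' x a b * θ x c) := by
  have hD := hN.affine
  have hΥ := h.smooth
  have hmu := hθ.smoothTwo_muForm hD hΥ
  have hom := SmoothTwo.om hD hθ.smoothForm
  have hb := smoothVF_fieldAt b
  have hc := smoothVF_fieldAt c
  have e : nab2 D (muForm θ Υ) x a b c = 1 / 2 * nab2 D (om θ) x a b c
      + (nab1 D Υ x a b * θ x c + Υ x b * nab1 D θ x a c)
      - (nab1 D θ x a b * Υ x c + θ x b * nab1 D Υ x a c) := by
    have e0 := nab2_spec D hmu (hb.diff x) hc a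
    have e1 := nab2_spec D hom (hb.diff x) hc a
    have e2 := nab1_spec D hθ.smoothForm (hb.diff x) a
    have e3 := nab1_spec D hθ.smoothForm (hc.diff x) a
    have e4 := nab1_spec D hΥ (hb.diff x) a
    have e5 := nab1_spec D hΥ (hc.diff x) a
    have d1 := (hom _ _ hb hc).diff x
    have d2 := (hθ.smoothForm _ hb).diff x
    have d3 := (hθ.smoothForm _ hc).diff x
    have d4 := (hΥ _ hb).diff x
    have d5 := (hΥ _ hc).diff x
    simp only [muForm_apply] at e0
    have d6 : DiffFnAt m (fun y => 1 / 2 * om θ y (fieldAt b y) (fieldAt c y)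
        + Υ y (fieldAt b y) * θ y (fieldAt c y)) x :=
      MDifferentiableAt.add (DiffFnAt.mul mdifferentiableAt_const d1) (d4.mul d3)
    rw [dfun_sub d6 (d2.mul d5),
      dfun_add (DiffFnAt.mul mdifferentiableAt_const d1) (d4.mul d3), dfun_const_mul d1,
      dfun_mul d4 d3, dfun_mul d2 d5, e1, e2, e3, e4, e5] at e0
    simp only [fieldAt_self] at e0
    linarith
  rw [hθ.nabla_scale_mul_two hD' hmu, hN.nabla_scale_eq hθ h x vol hvol, h.isChange.nab2_eq hmu, e,
    hN.nab2_om hθ hm, hN.nab1_eq, hN.nab1_eq, h.schouten_eq hD hD' hm, h.schouten_eq hD hD' hm,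
    rhoDiff_apply, rhoDiff_apply]
  simp only [symProd_apply, idEnd_apply, map_add, map_smul, LinearMap.add_apply,
    LinearMap.smul_apply, muForm_apply, smul_eq_mul]
  rw [om_skew θ x b a]
  ring

end

/-! ### From distinguished connections to the tractor form, and existence -/

section

variable [T2Space M] {C : ContactStructure m M} {q : Set (Conn m M)}

/-- With `τ` parallel, the Killing equation for `τθ` says that `∇θ` is skew, hence equal to `½ dθ`;
and `E = 0` reduces the Weyl condition to `θ(W) = 0`. -/
theorem IsDistinguishedConnection.isNormalized {θ : (x : M) → Cotan m x} (hθ : θ ∈ C.positive)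
    {D : Conn m M} (hD : IsAffine D) (h : IsDistinguishedConnection C q θ D)
    (hT : torsionUp D θ = 0) : IsNormalized θ D := by
  have hc := C.contact θ hθ
  refine ⟨hD, fun x u v => ?_, h.scale_parallel, fun x a b c => ?_⟩
  · obtain ⟨vol, hvol⟩ := exists_topForm_ne_zero (m := m) x
    have h1 := h.killing x vol hvol u v
    rw [C.k_eq hθ] at h1
    have e := fun u v : Tan m x => hc.nabla_scale_mul_one hD hc.smoothForm vol u v
    change ∀ u v : Tan m x, nabla D 2 (weightedForm θ) x vol ![] ![u, v] = _ at e
    rw [e, e, h.scale_parallel x vol hvol, h.scale_parallel x vol hvol, zero_mul, zero_mul,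
      zero_add, zero_add, ← mul_add] at h1
    have h2 := (mul_eq_zero.1 h1).resolve_left (hc.scale_pos hvol _ _).ne'
    have h3 := om_eq_nab1 hD hc.smoothForm x u v
    linarith
  · obtain ⟨vol, hvol⟩ := exists_topForm_ne_zero (m := m) x
    have h1 := h.weyl_eq x vol hvol a b c
    rw [C.k_eq hθ, tensorE_eq_zero hT, mul_zero] at h1
    exact (mul_eq_zero.1 h1).resolve_left (hc.scale_pos hvol _ _).ne'

/-- In a projective class with a normalised connection the conformal contact form is the projecting
part of a parallel tractor symplectic form. -/
theorem IsNormalized.exists_tractorTwoForm (hm : 1 ≤ m) {θ : (x : M) → Cotan m x}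
    (hθ : θ ∈ C.positive) {D₀ : Conn m M} (hN : IsNormalized θ D₀) :
    IsWeightedTensor 2 C.k ∧ (∀ D ∈ projectiveClass D₀, IsKilling D C.k) ∧
      ∃ Ω : TractorTwoForm (projectiveClass D₀), Ω.IsParallel ∧ Ω.IsSymplectic ∧ Ω.proj = C.k := by
  have hc := C.contact θ hθ
  have hD₀ := hN.affine
  have hΥ : ∀ D ∈ projectiveClass D₀, ∃ Υ, IsProjectiveChange D₀ D Υ := fun D hD =>
    exists_projectiveChange hD₀ hD
  -- The 1-form leading from `D₀` to `D`. Outside the projective class its value is irrelevant.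
  let Y : Conn m M → (x : M) → Cotan m x := fun D =>
    Classical.epsilon fun Υ => IsProjectiveChange D₀ D Υ
  have hY : ∀ D ∈ projectiveClass D₀, IsProjectiveChange D₀ D (Y D) := fun D hD =>
    Classical.epsilon_spec (hΥ D hD)
  rw [C.k_eq hθ]
  have hw : IsWeightedTensor 2 (weightedForm θ) := hc.isWeightedTensor_weightedForm hD₀
  refine ⟨hw, fun D hD x vol hvol u v => ?_, ?_⟩
  · rw [hN.nabla_weightedForm hc (hY D hD) hD.1 x vol hvol,
      hN.nabla_weightedForm hc (hY D hD) hD.1 x vol hvol, muForm_apply, muForm_apply, om_skew θ x v u]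
    ring
  let Ω : TractorTwoForm (projectiveClass D₀) :=
    { proj := weightedForm θ
      mu := fun D x vol α v => scale θ x vol α ![] * muForm θ (Y D) x (v 0) (v 1)
      proj_tensor := hw
      mu_tensor := fun D hD => hc.isWeightedTensor_scale_mul_two hD₀
        (hc.smoothTwo_muForm hD₀ (hY D hD).smooth)
      mu_skew := fun D _ x vol _ u v => by
        simp only [Matrix.cons_val_zero, Matrix.cons_val_one, muForm_apply]
        rw [om_skew θ x v u]
        ring
      change := fun D hD D' hD' Υ h x vol _ u v => by
        -- By uniqueness the chosen 1-forms are additive under composition of changes.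
        have e := (hY D' hD').unique ((hY D hD).trans h)
        simp only [Matrix.cons_val_zero, Matrix.cons_val_one, muForm_apply, weightedForm]
        rw [e, _root_.add_apply, _root_.add_apply]
        ring }
  refine ⟨Ω, fun D hD x vol hvol => ⟨fun a b => ?_, fun a b c => ?_⟩,
    fun D hD x vol hvol ρ u h => ?_, rfl⟩
  · exact sub_eq_zero.2 (hN.nabla_weightedForm hc (hY D hD) hD.1 x vol hvol a b)
  · have e := hN.nabla_scale_mul_muForm hc (hY D hD) hm hD.1 x vol hvol a b c
    change nabla D 2 (Ω.mu D) x vol ![] ![a, b, c] = _ at e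
    rw [e]
    simp only [Ω, weightedForm, Matrix.cons_val_zero]
    ring
  · have hs := (hc.scale_pos hvol ![] ![]).ne'
    have h1 : ∀ (ρ' : ℝ) (v : Tan m x),
        ρ * θ x v - ρ' * θ x u + muForm θ (Y D) x u v = 0 := fun ρ' v => by
      refine (mul_eq_zero.1 ?_).resolve_left hs
      rw [← h ρ' v]
      simp only [Ω, weightedForm, Matrix.cons_val_zero, Matrix.cons_val_one]
      ring
    have hu : θ x u = 0 := by
      -- This choice of the test pair isolates `θ(u)`.
      have h2 := h1 (-1) 0
      simp only [map_zero] at h2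
      linarith
    -- The Reeb field gives `ρ + Υ(u) = 0`; what is left of the equation is `½ dθ(u, ·) = 0` with
    -- `θ(u) = 0`.
    have h3 := h1 0 (reeb θ x)
    rw [muForm_apply, hc.om_reeb, hc.theta_reeb, hu] at h3
    have h4 : u = 0 := hc.gm_nondegenerate fun v => by
      have h5 := h1 0 v
      rw [muForm_apply, hu] at h5
      rw [gm_apply, hu]
      have h6 : (ρ + Y D x u) * θ x v = 0 := by
        rw [show ρ + Y D x u = 0 by linarith, zero_mul]
      linarith
    refine ⟨?_, h4⟩
    rw [h4, map_zero] at h3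
    linarith

/-- The choice `Υ = ½ d log f` is forced by `∇'(f⁻¹τ) = (2Υ − d log f) f⁻¹τ`. The other two
conditions hold throughout the projective class. -/
theorem IsProjectiveChange.isDistinguishedConnection (hm : 1 ≤ m) {θ : (x : M) → Cotan m x}
    (hθ : θ ∈ C.positive) {D D' : Conn m M} (hN : IsNormalized θ D) (hD' : IsAffine D')
    {f : M → ℝ} (hf : SmoothFn m f) (hpos : ∀ x, 0 < f x)
    (hfθ : (fun x => f x • θ x) ∈ C.positive) {Υ : (x : M) → Cotan m x}
    (h : IsProjectiveChange D D' Υ) (hΥ : ∀ x u, Υ x u = 1 / 2 * (f x)⁻¹ * dfun f x u)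
    (hq : D' ∈ q) (hT : torsionUp D' (fun x => f x • θ x) = 0) :
    IsDistinguishedConnection C q (fun x => f x • θ x) D' := by
  have hc := C.contact θ hθ
  have hinv : SmoothFn m (fun x => (f x)⁻¹) := fun x => (hf x).inv₀ (hpos x).ne'
  refine ⟨hq, fun x vol hvol u => ?_, ?_, fun x vol hvol a b c => ?_⟩
  · have hfx := (hpos x).ne'
    have hd : dfun (fun x => (f x)⁻¹) x u = -(f x ^ 2)⁻¹ * dfun f x u :=
      dfun_comp (hasDerivAt_inv hfx) (hf.diff x) u
    rw [hc.scale_change hf (C.contact _ hfθ) hpos, hc.nabla_fun_mul_scale hinv hD',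
      hN.nabla_scale_eq hc h x vol hvol, hd, hΥ]
    field_simp
    ring
  · intro x vol hvol u v
    rw [C.k_eq hθ, hN.nabla_weightedForm hc h hD' x vol hvol,
      hN.nabla_weightedForm hc h hD' x vol hvol, muForm_apply, muForm_apply, om_skew θ x v u]
    ring
  · rw [tensorE_eq_zero hT, C.k_eq hθ, weightedForm, h.weyl_eq hN.affine hD' hm]
    simp only [Matrix.cons_val_zero]
    rw [hN.theta_weyl]
    simp

/-- The adapted connection and then its correction. The first change sends `(v, v)` with `v ∈ H` to
a multiple of `v` and the second to zero, so the `H`-geodesics stay the same; total geodesy of `H`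
follows from skewness of `∇θ`. -/
theorem IsContactProjectiveStructure.exists_normalized (hm : 1 ≤ m)
    (hq : IsContactProjectiveStructure C q) (hT : IsTorsionFree C q) {θ : (x : M) → Cotan m x}
    (hθ : θ ∈ C.positive) : ∃ D ∈ q, IsNormalized θ D := by
  obtain ⟨D₀, hD₀, hC₀, rfl⟩ := hq
  have hc := C.contact θ hθ
  have hT₀ := hT D₀ ⟨hD₀, hC₀, fun _ _ => Iff.rfl⟩ θ hθ
  obtain ⟨D₁, S, hA, hS, hSp⟩ := hc.exists_adapted hD₀ (fun x v hv => hC₀.nab1_self hc hD₀ hv)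
    fun x a ha b hb c hc' => hc.nuFreeL_eq_zero hD₀ (hT₀ x) ha hb hc'
  obtain ⟨D, A, hD, hch, hnab, hsc, hW⟩ := hA.exists_theta_weyl_eq_zero hc hm
  refine ⟨D, ⟨hD, isCompatible_of_skew hc hD fun x u => ?_,
    (hS.trans hch).isHGeodesicOn_iff fun x v hv => ?_⟩, hD, hnab, fun x vol _ u => hsc x vol u, hW⟩
  · rw [hnab, om_self, mul_zero]
  · obtain ⟨c, hcv⟩ := hSp x v hv
    have hv' := (hc.ker x v).1 hv
    exact ⟨c, by rw [LinearMap.add_apply, LinearMap.add_apply, hcv, symProd_apply, hv']; module⟩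

theorem IsContactProjectiveStructure.mem_of_isProjectiveChange
    (hq : IsContactProjectiveStructure C q) {D D' : Conn m M} (hD : D ∈ q) (hD' : IsAffine D')
    {Υ : (x : M) → Cotan m x} (h : IsProjectiveChange D D' Υ) : D' ∈ q := by
  obtain ⟨D₀, hD₀, hC₀, rfl⟩ := hq
  refine ⟨hD', fun J γ hg => hD.2.1 J γ ((h.isGeodesicOn_iff J γ).1 hg), fun J γ => ?_⟩
  rw [← hD.2.2 J γ, IsHGeodesicOn, IsHGeodesicOn, h.isGeodesicOn_iff]

theorem IsContactProjectiveStructure.torsionUp_eq_zero (hq : IsContactProjectiveStructure C q)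
    (hT : IsTorsionFree C q) {θ : (x : M) → Cotan m x} (hθ : θ ∈ C.positive) {D : Conn m M}
    (hD : D ∈ q) : torsionUp D θ = 0 ∧ IsAffine D := by
  have hDa : IsAffine D := by
    obtain ⟨D₀, -, -, rfl⟩ := hq
    exact hD.1
  exact ⟨(C.contact θ hθ).torsionUp_eq_zero hDa (hT D hD θ hθ), hDa⟩

/-- The projective class of a connection normalised for one contact form contains a distinguished
connection for every other, obtained by `Υ = ½ d log f`. -/
theorem IsContactProjectiveStructure.exists_distinguished (hm : 1 ≤ m)
    (hq : IsContactProjectiveStructure C q) (hT : IsTorsionFree C q) :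
    ∃ p, IsDistinguishedProjectiveStructure C q p := by
  obtain ⟨θ, hθ⟩ := C.nonempty
  obtain ⟨D, hDq, hN⟩ := hq.exists_normalized hm hT hθ
  refine ⟨projectiveClass D, fun θ' hθ' => ?_⟩
  obtain ⟨f, hf, hpos, rfl⟩ := (C.mem_iff θ hθ θ').1 hθ'
  let Υ : (x : M) → Cotan m x := fun x => (1 / 2 * (f x)⁻¹) • toCotan (dlin f x)
  have hΥ : ∀ (x : M) (u : Tan m x), Υ x u = 1 / 2 * (f x)⁻¹ * dfun f x u := fun x u => by
    simp only [Υ, _root_.smul_apply, toCotan_apply, smul_eq_mul]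
    rfl
  have hinv : SmoothFn m (fun x => (f x)⁻¹) := fun x => (hf x).inv₀ (hpos x).ne'
  have hΥs : SmoothForm Υ := fun X hX => by
    simp only [hΥ]
    exact ContMDiff.mul (contMDiff_const.mul hinv) (smoothFn_dfun hf hX)
  have hD' := isAffine_connAdd hN.affine (symProd_comm Υ idEnd)
    (smoothBilin_symProd hΥs smoothEnd_idEnd)
  have hch := isChange_connAdd D (symProd Υ idEnd)
  have h : IsProjectiveChange D (connAdd D (symProd Υ idEnd)) Υ :=
    ⟨smoothForm_iff.1 hΥs, fun X x hX u => by
      rw [hch X x hX, symProd_apply, idEnd_apply, idEnd_apply]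
      abel⟩
  have hq' := hq.mem_of_isProjectiveChange hDq hD' h
  exact ⟨_, h.isDistinguishedConnection hm hθ hN hD' hf hpos hθ' hΥ hq'
    (hq.torsionUp_eq_zero hT hθ' hq').1, h.projectiveClass_eq.symm⟩

end

end

end ContactProjective

end

theorem mainTheorem9 (m : ℕ) (hm : 1 ≤ m) {M : Type*} [TopologicalSpace M]
    [ChartedSpace (Model m) M] [IsManifold (𝓡 (2 * m + 1)) ∞ M] [T2Space M] [SigmaCompactSpace M]
    (C : ContactStructure m M) (q : Set (Conn m M))
    (hq : IsContactProjectiveStructure C q) (hT : IsTorsionFree C q) :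
    (∃ p, IsDistinguishedProjectiveStructure C q p) ∧
      ∀ p, IsDistinguishedProjectiveStructure C q p →
        IsNormalSolution p C.k ∧
          ∃ Ω : TractorTwoForm p, Ω.IsParallel ∧ Ω.IsSymplectic ∧ Ω.proj = C.k := by
  refine ⟨hq.exists_distinguished hm hT, fun p hp => ?_⟩
  -- A single contact form suffices: its distinguished connection generates `p` and is normalised.
  obtain ⟨θ, hθ⟩ := C.nonempty
  obtain ⟨D, hD, rfl⟩ := hp θ hθ
  obtain ⟨hT', hDa⟩ := hq.torsionUp_eq_zero hT hθ hD.mem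
  obtain ⟨h1, h2, Ω, h3, h4, h5⟩ := (hD.isNormalized hθ hDa hT').exists_tractorTwoForm hm hθ
  exact ⟨⟨h1, h2, Ω, h3, h5⟩, Ω, h3, h4, h5⟩
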